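/- **Setting.** Let $\mathcal G$ be an acyclic directed mixed graph (ADMG) on finitely many observed variables $O$, with a binary treatment $A\in\{0,1\}$ and a real-valued outcome $Y\ne A$. Fix a topological order $\tau$ in which $A$ follows all its non-descendants and $Y$ is last. The district of a vertex is the set of vertices joined to it by bidirected paths (including itself). Assume that $A$ is primal fixable: no child of $A$ lies in the district of $A$. Let $\mathcal L$ consist of $A$ and all post-treatment variables in the district of $A$, and $\mathcal M$ of the other post-treatment variables; let $Z_1,\dots,Z_K$ be the post-treatment variables other than $Y$ in the order $\tau$, and $Z_{K+1}=Y$. Fix $a_0\in\{0,1\}$, $a_1=1-a_0$, and put $a_V=a_0$ for $V\in\mathcal M$ and $a_V=a_1$ for $V\in\mathcal L$. The Markov pillow $\mathrm{mp}(V)$ is the district of $V$ together with the parents of that district, in the subgraph on $V$ and its predecessors, without $V$; $\mathrm{mp}^{-A}(V)=\mathrm{mp}(V)\setminus\{A\}$. The laws considered have a density with respect to a fixed product of $\sigma$-finite measures (counting measure for $A$) and satisfy positivity: $0<P(A=1\mid O\setminus\{A,Y\})<1$ almost surely. They form the nonparametric model $\mathbb M$; those with the topological factorization $p=\prod_{V}p(V\mid\mathrm{mp}(V))$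 form the model $\mathbb M(\mathcal G)$. Write $f_V(\cdot\mid\mathrm{mp}^{-A}(V),a)$ for the conditional density of $V$ given its Markov pillow with $A$ set to $a$, $\pi(a\mid\mathrm{mp}(A))$ for the propensity score, and $$\psi_{a_0}(P)=E\Big[\pi(a_1\mid\mathrm{mp}(A))\int y\,dP(y\mid\mathrm{mp}^{-A}(y),a_Y)\prod_{k=1}^K dP(z_k\mid\mathrm{mp}^{-A}(z_k),a_{Z_k})\Big]+E[I(A=a_0)Y].$$ Let $\mu(\mathrm{mp}^{-A}(Y),a)=\int y\,dP(y\mid \mathrm{mp}^{-A}(Y),a)$, $B_{Z_{K+1}}=\mu$, and recursively, for $k\le K$, let $B_{Z_k}(\cdot,a)=\int B_{Z_{k+1}}(\cdot,a_{Z_{k+1}})\,f_{Z_k}(z_k\mid\mathrm{mp}^{-A}(Z_k),a)\,dz_k$. Put $f^r_{V}=f_V(V\mid\mathrm{mp}^{-A}(V),a_V)/f_V(V\mid\mathrm{mp}^{-A}(V),1-a_V)$, $f^r_A=\pi(a_1\mid\mathrm{mp}(A))/\pi(a_0\mid\mathrm{mp}(A))$ and, for $V\in\{Z_1,\dots,Z_K,Y\}$,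 $$R_V=I(V\in\mathcal L)\prod_{M\in\mathcal M,\,M\prec V}f^r_M+I(V\in\mathcal M)\,f^r_A\prod_{L\in\mathcal L\setminus A,\,L\prec V}f^r_L .$$ Define $$\begin{aligned}\Phi_{a_0}=\;&I(A=a_Y)R_Y\{Y-\mu(\mathrm{mp}^{-A}(Y),a_Y)\}+\sum_{k=1}^{K}I(A=a_{Z_k})R_{Z_k}\{B_{Z_{k+1}}(\cdot,a_{Z_{k+1}})-B_{Z_k}(\cdot,a_{Z_k})\}\\&+\{I(A=a_1)-\pi(a_1\mid\mathrm{mp}(A))\}B_{Z_1}(\cdot,a_0)+\pi(a_1\mid\mathrm{mp}(A))B_{Z_1}(\cdot,a_0)+I(A=a_0)Y-\psi_{a_0}(P).\end{aligned}$$ A regular submodel of a model through $P$ is a family $(P_t)$ of its members, $P_0=P$, that is defined for $t$ near $0$, is differentiable in quadratic mean at $0$ with score $s$, and satisfies $P_t\ll P$ and $|dP_t/dP-1|\le C|t|$ $P$-a.s. for some constant $C$ and all small $t$. An influence function of a parameter $\theta$ at $P$ is a $\varphi\in L^2(P)$ with $E\varphi=0$ and $\frac{d}{dt}\theta(P_t)\big|_{t=0}=E[\varphi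 s]$ for every regular submodel; it is efficient if it lies in the $L^2(P)$-closure of the linear span of the scores. **Lemma.** Let $P\in\mathbb M(\mathcal G)$ be such that the two expectations in $\psi_{a_0}(P)$ converge absolutely. 1. If $\mathcal G$ imposes no restriction (every Markov pillow consists of all predecessors), then $\mathbb M(\mathcal G)=\mathbb M$, and $\varphi$ is an efficient influence function of $\psi_{a_0}$ at $P$ in the nonparametric model if and only if $\Phi_{a_0}\in L^2(P)$ and $\varphi=\Phi_{a_0}$ $P$-a.s. That is, the nonparametric efficient influence function is $\Phi_{a_0}$, and it exists exactly when $\Phi_{a_0}$ has finite variance. 2. For every $\mathcal G$, let $\psi^{\mathrm{np}}$ be given by the formula of $\psi_{a_0}$ with each Markov pillow replaced by the set of all predecessors. Then $\psi^{\mathrm{np}}=\psi_{a_0}$ on $\mathbb M(\mathcal G)$, and $\varphi$ is an efficient influence function of $\psi^{\mathrm{np}}$ at $P$ in the nonparametric model if and only if $\Phi_{a_0}\in L^2(P)$ and $\varphi=\Phi_{a_0}$ $P$-a.s. 3. For every $\mathcal G$, if $\Phi_{a_0}\in L^2(P)$, then $\Phi_{a_0}$ is an influence function of $\psi_{a_0}$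 at $P$ in the model $\mathbb M(\mathcal G)$. -/

import Mathlib

open MeasureTheory Filter Topology
open scoped ENNReal

noncomputable section

/-- An acyclic directed mixed graph: directed edges `dir u v` (`u → v`) without directed cycles,
and bidirected edges `bi u v` (`u ↔ v`). -/
structure ADMG (V : Type*) where
  dir : V → V → Prop
  bi : V → V → Prop
  acyclic : ∀ v, ¬ Relation.TransGen dir v v
  bi_symm : ∀ u v, bi u v → bi v u
  bi_irrefl : ∀ v, ¬ bi v v

namespace ADMG

variable {V : Type*}

/-- Children. -/
def children (G : ADMG V) (v : V) : Set V := {w | G.dir v w}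

/-- District: the vertices joined to `v` by a bidirected path (including `v`). -/
def district (G : ADMG V) (v : V) : Set V := {w | Relation.ReflTransGen G.bi v w}

/-- `v` is primal fixable: no child of `v` lies in the district of `v`. -/
def PrimalFixable (G : ADMG V) (v : V) : Prop := G.children v ∩ G.district v = ∅

/-- District of `v` in the subgraph on the vertices `≤ v` of the topological order. -/
def districtUpTo [LinearOrder V] (G : ADMG V) (v : V) : Set V :=
  {w | Relation.ReflTransGen (fun a b => G.bi a b ∧ a ≤ v ∧ b ≤ v) v w}

open Classical in
/-- Markov pillow of `v`: its district together with the parents of its district, in the subgraph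
on the vertices `≤ v`, without `v` itself. -/
def markovPillow [Fintype V] [LinearOrder V] (G : ADMG V) (v : V) : Finset V :=
  Finset.univ.filter fun w =>
    w ≠ v ∧ w ≤ v ∧ (w ∈ G.districtUpTo v ∨ ∃ d ∈ G.districtUpTo v, G.dir w d)

end ADMG

/-- All predecessors of `v`. -/
def predecessors {V : Type*} [Fintype V] [LinearOrder V] (v : V) : Finset V :=
  Finset.univ.filter fun w => w < v

/-- The fixed data: an ADMG on the observed variables, whose vertices are linearly ordered by a
valid topological order; the state spaces `𝓧 v` with σ-finite reference measures `ν v`; a binary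
treatment `A` that follows all its non-descendants; a real-valued outcome `Y`, last in the order;
and the treatment level `a₀`. -/
structure CausalSetup (V : Type*) [Fintype V] [LinearOrder V]
    (𝓧 : V → Type*) [∀ v, MeasurableSpace (𝓧 v)] where
  G : ADMG V
  topological : ∀ u v, G.dir u v → u < v
  A : V
  Y : V
  A_ne_Y : A ≠ Y
  follows_nondescendants : ∀ v, ¬ Relation.TransGen G.dir A v → v ≤ A
  Y_last : ∀ v, v ≤ Y
  ν : ∀ v, Measure (𝓧 v)
  sigmaFinite : ∀ v, SigmaFinite (ν v)
  /-- the treatment is binary -/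
  level : 𝓧 A ≃ᵐ Bool
  ν_treatment : ν A = Measure.count
  /-- the real value of the outcome variable -/
  outcome : 𝓧 Y → ℝ
  measurable_outcome : Measurable outcome
  a₀ : Bool

namespace CausalSetup

variable {V : Type*} [Fintype V] [LinearOrder V] {𝓧 : V → Type*} [∀ v, MeasurableSpace (𝓧 v)]
variable (S : CausalSetup V 𝓧)

/-- The other treatment level. -/
def a₁ : Bool := !S.a₀

/-- The outcome as a function of the observation. -/
def y (x : ∀ v, 𝓧 v) : ℝ := S.outcome (x S.Y)

/-- The observation `x` with the treatment coordinate replaced by `a`. -/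
def setA (a : Bool) (x : ∀ v, 𝓧 v) : ∀ v, 𝓧 v := Function.update x S.A (S.level.symm a)

/-- The indicator `I(A = a)`. -/
def indA (a : Bool) (x : ∀ v, 𝓧 v) : ℝ := if S.level (x S.A) = a then 1 else 0

/-- Post-treatment variables in the district of the treatment, together with the treatment. -/
def inL (v : V) : Prop := S.A ≤ v ∧ v ∈ S.G.district S.A

/-- Post-treatment variables outside of the district of the treatment. -/
def inM (v : V) : Prop := S.A < v ∧ v ∉ S.G.district S.A

/-- The post-treatment variables `Z₁, …, Z_K, Y`. -/
def post : Finset V := Finset.univ.filter fun v => S.A < v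

/-- The post-treatment pre-outcome variables `Z₁, …, Z_K`. -/
def Z : Finset V := Finset.univ.filter fun v => S.A < v ∧ v < S.Y

open Classical in
/-- The level `a_v`: `a₀` for `v` in `M` and `a₁` for `v` in `L`. -/
def lvl (v : V) : Bool := if S.inL v then S.a₁ else S.a₀

/-! ### Laws, marginal and conditional densities -/

/-- The product of the reference measures. -/
def base : Measure (∀ v, 𝓧 v) := Measure.pi S.ν

/-- The law with density `p`. -/
def law (p : (∀ v, 𝓧 v) → ℝ≥0∞) : Measure (∀ v, 𝓧 v) := S.base.withDensity p

/-- Marginal density of the variables in `T`, as a function that ignores the other coordinates. -/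
def marg (p : (∀ v, 𝓧 v) → ℝ≥0∞) (T : Finset V) : (∀ v, 𝓧 v) → ℝ≥0∞ :=
  lmarginal S.ν Tᶜ p

/-- Conditional density of the variable `v` given the variables in `T`, at the point `x`. -/
def cond (p : (∀ v, 𝓧 v) → ℝ≥0∞) (T : Finset V) (v : V) (x : ∀ v, 𝓧 v) : ℝ≥0∞ :=
  S.marg p (insert v T) x / S.marg p T x

/-! ### Models -/

/-- The nonparametric model: all densities that satisfy positivity, i.e. both treatment levels have
positive conditional probability given all variables other than the treatment and the outcome. -/
def nonparametricModel : Set ((∀ v, 𝓧 v) → ℝ≥0∞) :=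
  {p | Measurable p ∧ ∫⁻ x, p x ∂S.base = 1 ∧
    ∀ᵐ x ∂S.law p, ∀ a : Bool, S.marg p (Finset.univ.erase S.Y) (S.setA a x) ≠ 0}

/-- The model of the graph: the elements of the nonparametric model with the topological
factorization `p = ∏_v p(v | mp(v))`. -/
def graphModel : Set ((∀ v, 𝓧 v) → ℝ≥0∞) :=
  {p | p ∈ S.nonparametricModel ∧
    ∀ᵐ x ∂S.base, p x = ∏ v, S.cond p (S.G.markovPillow v) v x}

/-! ### Target parameter and nuisances

All of these take the conditioning sets `c v` of the variables as an argument: they are the Markov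
pillows `S.G.markovPillow`, or, for a law without independence restrictions, all predecessors. -/

variable (c : V → Finset V) (p : (∀ v, 𝓧 v) → ℝ≥0∞)

/-- `f_v(v | mp^{-A}(v), a)`: the conditional density of `v` with the treatment set to `a`. -/
def f (v : V) (a : Bool) (x : ∀ v, 𝓧 v) : ℝ := (S.cond p (c v) v (S.setA a x)).toReal

/-- The propensity score `π(a | mp(A))`. -/
def propensity (a : Bool) (x : ∀ v, 𝓧 v) : ℝ := S.f c p S.A a x

/-- The integral, against `∏ ν`, over the post-treatment coordinates. -/
def gIntegral (h : (∀ v, 𝓧 v) → ℝ) (x : ∀ v, 𝓧 v) : ℝ :=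
  ∫ z : (∀ i : S.post, 𝓧 i), h (Function.updateFinset x S.post z)
    ∂Measure.pi fun i : S.post => S.ν i

/-- The target parameter
`E[π(a₁ | mp(A)) ∫ y dP(y | mp^{-A}(y), a_Y) ∏ₖ dP(zₖ | mp^{-A}(zₖ), a_{Zₖ})] + E[I(A = a₀) Y]`. -/
def psi : ℝ :=
  (∫ x, S.propensity c p S.a₁ x *
      S.gIntegral (fun w => S.y w * ∏ v ∈ S.post, S.f c p v (S.lvl v) w) x ∂S.law p)
    + ∫ x, S.indA S.a₀ x * S.y x ∂S.law p

/-- The two expectations in the target parameter converge absolutely. -/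
def TargetFinite : Prop :=
  (∫⁻ x, ENNReal.ofReal (S.propensity c p S.a₁ x) *
      (∫⁻ z : (∀ i : S.post, 𝓧 i),
        ENNReal.ofReal (|S.y (Function.updateFinset x S.post z)| *
          ∏ v ∈ S.post, S.f c p v (S.lvl v) (Function.updateFinset x S.post z))
        ∂Measure.pi fun i : S.post => S.ν i) ∂S.law p < ∞)
    ∧ Integrable (fun x => S.indA S.a₀ x * S.y x) (S.law p)

/-- The regression `∫ h f_v(v | mp^{-A}(v), a) dν_v` of `h` on the conditional law of `v` at
treatment level `a`. -/
def regress (v : V) (a : Bool) (h : (∀ v, 𝓧 v) → ℝ) (x : ∀ v, 𝓧 v) : ℝ :=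
  ∫ z, h (Function.update x v z) * S.f c p v a (Function.update x v z) ∂S.ν v

/-- Sequential regression of `Y` along a list of variables, each at its level `a_v`. -/
def seqRegress : List V → (∀ v, 𝓧 v) → ℝ
  | [] => S.y
  | v :: l => S.regress c p v (S.lvl v) (seqRegress l)

/-- The variables after `v`, in increasing order. -/
def after (v : V) : List V := (Finset.univ.filter fun w => v < w).sort (· ≤ ·)

/-- `B_{Z_{k+1}}(mp^{-A}(Z_{k+1}), a_{Z_{k+1}})` for `v = Z_k`. -/
def nextB (v : V) : (∀ v, 𝓧 v) → ℝ := S.seqRegress c p (after v)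

/-- `B_v(mp^{-A}(v), a)`, the regression of `nextB v` on the conditional law of `v`. -/
def B (v : V) (a : Bool) : (∀ v, 𝓧 v) → ℝ := S.regress c p v a (S.nextB c p v)

/-- The outcome regression `μ(mp^{-A}(Y), a)`. -/
def mu (a : Bool) : (∀ v, 𝓧 v) → ℝ := S.regress c p S.Y a S.y

/-- `B_{Z₁}(mp^{-A}(Z₁), a)`, where `Z₁` is the first post-treatment variable
(the outcome if there is no mediator). -/
def BZ₁ (a : Bool) : (∀ v, 𝓧 v) → ℝ :=
  match after S.A with
  | [] => S.y
  | v :: _ => S.B c p v a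

/-- The density ratio `f_v(v | mp^{-A}(v), a_v) / f_v(v | mp^{-A}(v), 1 - a_v)`. -/
def ratio (v : V) (x : ∀ v, 𝓧 v) : ℝ := S.f c p v (S.lvl v) x / S.f c p v (!S.lvl v) x

/-- The propensity ratio `π(a₁ | mp(A)) / π(a₀ | mp(A))`. -/
def ratioA (x : ∀ v, 𝓧 v) : ℝ := S.propensity c p S.a₁ x / S.propensity c p S.a₀ x

open Classical in
/-- The product `R_v` of density ratios. -/
def R (v : V) (x : ∀ v, 𝓧 v) : ℝ :=
  (if S.inL v then 1 else 0) *
      ∏ m ∈ Finset.univ.filter (fun m => S.inM m ∧ m < v), S.ratio c p m x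
    + (if S.inM v then 1 else 0) * (S.ratioA c p x *
      ∏ l ∈ Finset.univ.filter (fun l => S.inL l ∧ l < v ∧ l ≠ S.A), S.ratio c p l x)

/-- The function `Φ_{a₀}`. -/
def Phi (x : ∀ v, 𝓧 v) : ℝ :=
  S.indA (S.lvl S.Y) x * S.R c p S.Y x * (S.y x - S.mu c p (S.lvl S.Y) x)
  + ∑ v ∈ S.Z, S.indA (S.lvl v) x * S.R c p v x * (S.nextB c p v x - S.B c p v (S.lvl v) x)
  + (S.indA S.a₁ x - S.propensity c p S.a₁ x) * S.BZ₁ c p S.a₀ x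
  + S.propensity c p S.a₁ x * S.BZ₁ c p S.a₀ x + S.indA S.a₀ x * S.y x - S.psi c p

/-! ### Regular submodels, gradients, efficient influence functions -/

/-- The likelihood ratio of `q` with respect to `p`. -/
def likRatio (p q : (∀ v, 𝓧 v) → ℝ≥0∞) (x : ∀ v, 𝓧 v) : ℝ := (q x / p x).toReal

/-- `γ` is a regular one-dimensional submodel of the model `𝓜` through `p` with score `s`:
its likelihood ratios are Lipschitz at `0`, and it is differentiable in quadratic mean. -/
structure IsRegularPath (𝓜 : Set ((∀ v, 𝓧 v) → ℝ≥0∞)) (p : (∀ v, 𝓧 v) → ℝ≥0∞)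
    (γ : ℝ → (∀ v, 𝓧 v) → ℝ≥0∞) (s : (∀ v, 𝓧 v) → ℝ) : Prop where
  at_zero : γ 0 = p
  mem : ∀ᶠ t in 𝓝 (0 : ℝ), γ t ∈ 𝓜
  ac : ∀ᶠ t in 𝓝 (0 : ℝ), S.law (γ t) ≪ S.law p
  lipschitz : ∃ C : ℝ, ∀ᶠ t in 𝓝 (0 : ℝ), ∀ᵐ x ∂S.law p, |likRatio p (γ t) x - 1| ≤ C * |t|
  measurable_score : Measurable s
  qmd : Tendsto (fun t : ℝ =>
      eLpNorm (fun x => (Real.sqrt (likRatio p (γ t) x) - 1) / t - s x / 2) 2 (S.law p))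
    (𝓝[≠] 0) (𝓝 0)

/-- `φ` is a gradient (influence function) at `p` of the parameter `θ` on the model `𝓜`. -/
def IsGradient (𝓜 : Set ((∀ v, 𝓧 v) → ℝ≥0∞)) (θ : ((∀ v, 𝓧 v) → ℝ≥0∞) → ℝ)
    (p : (∀ v, 𝓧 v) → ℝ≥0∞) (φ : (∀ v, 𝓧 v) → ℝ) : Prop :=
  MemLp φ 2 (S.law p) ∧ ∫ x, φ x ∂S.law p = 0 ∧
    ∀ γ s, S.IsRegularPath 𝓜 p γ s →
      HasDerivAt (fun t => θ (γ t)) (∫ x, φ x * s x ∂S.law p) 0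

/-- `φ` is an efficient influence function at `p` of `θ` on the model `𝓜`: a gradient in the tangent
space, the `L²(P)`-closure of the linear span of the scores of regular submodels. -/
def IsEIF (𝓜 : Set ((∀ v, 𝓧 v) → ℝ≥0∞)) (θ : ((∀ v, 𝓧 v) → ℝ≥0∞) → ℝ)
    (p : (∀ v, 𝓧 v) → ℝ≥0∞) (φ : (∀ v, 𝓧 v) → ℝ) : Prop :=
  S.IsGradient 𝓜 θ p φ ∧
    ∀ ε : ℝ, 0 < ε → ∃ s ∈ Submodule.span ℝ {s | ∃ γ, S.IsRegularPath 𝓜 p γ s},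
      eLpNorm (fun x => φ x - s x) 2 (S.law p) ≤ ENNReal.ofReal ε

end CausalSetup

end

/-!
Condition every variable on all its predecessors first. Then `psi` is, up to the explicit term
`E[1{A = a₀} Y]`, the mean of `Y` under the *intervened* measure on the slice `A = a₁`: its density
`interv` is the product of the marginal density of the variables up to `A`, at `A = a₁`, and of
the conditional density of each post-treatment variable `v` at its level `lvl v` of the treatment
(`psi_eq_integral_intervLaw`).

**Expansion.** Let `q = h p` with `|h - 1| ≤ ε`. Every conditional density is a quotient of two
marginals, so the intervened density of `q` is that of `p` times a product `c ∏ a_v / b_v` of ratios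
of marginals of `q` to those of `p` (`IsClose.ae_interv_eq`). All these ratios lie within `ε` of
one, so the product is `c + ∑ (a_v - b_v)` up to a uniform error `O(ε²)`
(`exists_abs_mul_prod_div_sub_le`). The mean of `a_v Y` and of `b_v Y` under the intervened measure
is a mean under `q` of the regression `nextB` after, respectively before, the variable `v`, with
weight `R`: positivity makes the weight `R` carry the observed density at treatment level `lvl v`
into the intervened density (`RegularPoint.marg_mul_R`, `lintegral_indE_mul_eNext`). Primal
fixability gives the first post-treatment variable the level `a₀` (`inM_of_covBy`), so that
`BZ₁` at `a₀` is the regression after `A`. The linear term is therefore the integral of `Phi` under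
`q`, whence the von Mises expansion
`ψ(q) - ψ(p) = ∫ Φ dq + O(ε²)` (`exists_abs_psi_sub_psi_sub_integral_Phi_le`), which needs only the
finiteness of the target. Along a regular submodel `ε = C |t|`, so the derivative of `ψ` is
the derivative of `∫ Φ dP_t`, which is `∫ Φ s dP` by differentiability in quadratic mean when `Φ` is
square-integrable (`isGradient_Phi`).

**Uniqueness and necessity.** For bounded mean-zero `s` the path `(1 + t s) p` is regular with
score `s`, and the expansion gives the derivative `∫ Φ s dP` without square-integrability of `Φ`.
Hence any influence function agrees with `Φ` when tested against bounded mean-zero functions, so it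
equals `Φ` almost surely (`IsGradient.ae_eq_Phi`). Since these scores are dense among
the mean-zero functions of `L²`, every influence function in the nonparametric model is efficient
(`isEIF_iff`).

**Laws with the topological factorization.** If the density is the product of the conditional
densities given the Markov pillows, integrating out the last variables bounds the marginals by
the partial products. Both sides have mass at most one, the marginals exactly one, so they are equal
(`ae_marg_eq_prod_cond`). The conditional densities given the pillows and given all predecessors
thus agree wherever the latter are defined (`ae_agree`). Consequently `psi` and `Phi` are
the same for the two choices of conditioning sets (`psi_congr`, `ae_Phi_congr`), which reduces the
general graph to the case of all predecessors.
-/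

/-! ### Marginal integrals of functions of finitely many coordinates -/

section DependsOn

open Function

variable {ι : Type*} {X : ι → Type*} {β : Type*}

theorem DependsOn.mul [Mul β] {f g : (∀ i, X i) → β} {s : Set ι}
    (hf : DependsOn f s) (hg : DependsOn g s) : DependsOn (fun x ↦ f x * g x) s :=
  fun _ _ h ↦ by simp only [hf h, hg h]

theorem DependsOn.div [Div β] {f g : (∀ i, X i) → β} {s : Set ι}
    (hf : DependsOn f s) (hg : DependsOn g s) : DependsOn (fun x ↦ f x / g x) s :=
  fun _ _ h ↦ by simp only [hf h, hg h]

theorem DependsOn.prod {κ : Type*} [CommMonoid β] {f : κ → (∀ i, X i) → β} {s : Set ι}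
    {t : Finset κ} (hf : ∀ k ∈ t, DependsOn (f k) s) : DependsOn (fun x ↦ ∏ k ∈ t, f k x) s :=
  fun _ _ h ↦ Finset.prod_congr rfl fun k hk ↦ hf k hk h

variable [DecidableEq ι]

theorem DependsOn.apply_updateFinset {g : (∀ i, X i) → β} {s : Set ι}
    (hg : DependsOn g s) {T : Finset ι} (hT : Disjoint s (T : Set ι)) (x : ∀ i, X i)
    (z : ∀ i : T, X i) : g (Function.updateFinset x T z) = g x :=
  hg fun i hi ↦ by
    have : i ∉ T := fun h ↦ Set.disjoint_left.1 hT hi (by simpa using h)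
    simp [Function.updateFinset, this]

theorem DependsOn.apply_update {g : (∀ i, X i) → β} {s : Set ι}
    (hg : DependsOn g s) {i : ι} (hi : i ∉ s) (x : ∀ i, X i) (z : X i) :
    g (Function.update x i z) = g x :=
  hg fun j hj ↦ by
    have : j ≠ i := by rintro rfl; exact hi hj
    simp [this]

end DependsOn

namespace MeasureTheory

open Function

variable {ι : Type*} [DecidableEq ι] {X : ι → Type*} [∀ i, MeasurableSpace (X i)]
  {μ : ∀ i, Measure (X i)}

theorem dependsOn_lmarginal (T : Finset ι) (f : (∀ i, X i) → ℝ≥0∞) :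
    DependsOn (lmarginal μ T f) ((T : Set ι)ᶜ) :=
  fun _ _ h ↦ lmarginal_congr μ f fun i hi ↦ h i (by simpa using hi)

theorem _root_.DependsOn.lmarginal {s : Set ι} {f : (∀ i, X i) → ℝ≥0∞} (hf : DependsOn f s)
    (T : Finset ι) : DependsOn (lmarginal μ T f) (s \ T) := fun x y hxy ↦ by
  refine lintegral_congr fun z ↦ hf fun i hi ↦ ?_
  by_cases hT : i ∈ T
  · simp [Function.updateFinset, hT]
  · simpa [Function.updateFinset, hT] using hxy i ⟨hi, hT⟩

theorem lmarginal_const_mul_of_dependsOn {T : Finset ι} {s : Set ι} {g f : (∀ i, X i) → ℝ≥0∞}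
    (hg : DependsOn g s) (hs : Disjoint s (T : Set ι)) (hf : Measurable f) (x : ∀ i, X i) :
    lmarginal μ T (fun x ↦ g x * f x) x = g x * lmarginal μ T f x := by
  simp only [lmarginal, hg.apply_updateFinset hs]
  exact lintegral_const_mul _ (hf.comp measurable_updateFinset)

/-- The marginal integral over `T` of a function of the coordinates in `T` is a constant. -/
theorem lmarginal_eq_of_dependsOn {T : Finset ι} {f : (∀ i, X i) → ℝ≥0∞}
    (hf : DependsOn f (T : Set ι)) (x x' : ∀ i, X i) : lmarginal μ T f x = lmarginal μ T f x' := by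
  simp only [lmarginal]
  refine lintegral_congr fun z ↦ hf fun i hi ↦ ?_
  have : i ∈ T := by simpa using hi
  simp [updateFinset, this]

variable [Fintype ι] [∀ i, SigmaFinite (μ i)]

theorem lintegral_lmarginal_eq_zero {T : Finset ι} {f : (∀ i, X i) → ℝ≥0∞} (hf : Measurable f)
    (h : ∫⁻ x, f x ∂Measure.pi μ = 0) : ∫⁻ x, lmarginal μ T f x ∂Measure.pi μ = 0 := by
  rcases isEmpty_or_nonempty (∀ i, X i) with _ | ⟨⟨x⟩⟩
  · simp
  have hu : T ∪ Tᶜ = Finset.univ := by simp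
  have hd : Disjoint T Tᶜ := disjoint_compl_right
  rw [lintegral_eq_lmarginal_univ x, ← hu, lmarginal_union μ _ (hf.lmarginal μ) hd,
    ← lmarginal_union' μ _ hf hd, hu, lmarginal_univ, h]
  simp [lmarginal]

/-- A property that holds almost everywhere holds at almost every point after the coordinates in `T`
have been replaced by almost every value. -/
theorem ae_ae_updateFinset {P : (∀ i, X i) → Prop} (h : ∀ᵐ x ∂Measure.pi μ, P x) (T : Finset ι) :
    ∀ᵐ x ∂Measure.pi μ, ∀ᵐ z ∂Measure.pi fun i : T ↦ μ i, P (updateFinset x T z) := by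
  obtain ⟨N, hN, hNm, hN0⟩ := exists_measurable_superset_of_null (ae_iff.1 h)
  have hm : Measurable (N.indicator (1 : (∀ i, X i) → ℝ≥0∞)) := measurable_one.indicator hNm
  have h0 := lintegral_lmarginal_eq_zero (μ := μ) (T := T) hm
    (by simp [lintegral_indicator_one hNm, hN0])
  rw [lintegral_eq_zero_iff (hm.lmarginal μ)] at h0
  filter_upwards [h0] with x hx
  simp only [lmarginal, Pi.zero_apply] at hx
  replace hx := (lintegral_eq_zero_iff (hm.comp measurable_updateFinset)).1 hx
  filter_upwards [hx] with z hz
  by_contra hP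
  simp [Set.indicator_of_mem (hN hP)] at hz

theorem ae_ae_update {P : (∀ i, X i) → Prop} (h : ∀ᵐ x ∂Measure.pi μ, P x) (i : ι) :
    ∀ᵐ x ∂Measure.pi μ, ∀ᵐ z ∂μ i, P (update x i z) := by
  obtain ⟨N, hN, hNm, hN0⟩ := exists_measurable_superset_of_null (ae_iff.1 h)
  have hm : Measurable (N.indicator (1 : (∀ i, X i) → ℝ≥0∞)) := measurable_one.indicator hNm
  have h0 := lintegral_lmarginal_eq_zero (μ := μ) (T := {i}) hm
    (by simp [lintegral_indicator_one hNm, hN0])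
  rw [lintegral_eq_zero_iff (hm.lmarginal μ)] at h0
  filter_upwards [h0] with x hx
  simp only [lmarginal_singleton, Pi.zero_apply] at hx
  replace hx := (lintegral_eq_zero_iff (hm.comp (measurable_update x))).1 hx
  filter_upwards [hx] with z hz
  by_contra hP
  simp [Set.indicator_of_mem (hN hP)] at hz

/-- Converse of `ae_ae_updateFinset` for measurable properties. -/
theorem ae_of_ae_ae_updateFinset {P : (∀ i, X i) → Prop} (hP : MeasurableSet {x | P x})
    (T : Finset ι)
    (h : ∀ᵐ x ∂Measure.pi μ, ∀ᵐ z ∂Measure.pi fun i : T ↦ μ i, P (updateFinset x T z)) :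
    ∀ᵐ x ∂Measure.pi μ, P x := by
  rcases eq_or_ne (Measure.pi μ) 0 with h0 | h0
  · simp [h0]
  have : NeZero (Measure.pi μ) := ⟨h0⟩
  have hm : Measurable ({x | P x}ᶜ.indicator (1 : (∀ i, X i) → ℝ≥0∞)) :=
    measurable_one.indicator hP.compl
  have h1 : ∀ᵐ x ∂Measure.pi μ, lmarginal μ T ({x | P x}ᶜ.indicator 1) x = 0 := by
    filter_upwards [h] with x hx
    refine (lintegral_eq_zero_iff (hm.comp measurable_updateFinset)).2 ?_
    filter_upwards [hx] with z hz
    simp [hz]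
  obtain ⟨x, hx⟩ := (ae_ae_updateFinset h1 Tᶜ).exists
  have hu : Tᶜ ∪ T = Finset.univ := by rw [Finset.union_comm]; simp
  have h2 : ∫⁻ x, {x | P x}ᶜ.indicator 1 x ∂Measure.pi μ = 0 := by
    rw [lintegral_eq_lmarginal_univ x, ← hu, lmarginal_union μ _ hm disjoint_compl_left]
    exact (lintegral_congr_ae hx).trans lintegral_zero
  rw [lintegral_indicator_one hP.compl] at h2
  exact h2

theorem lmarginal_mono_ae {f g : (∀ i, X i) → ℝ≥0∞} (h : f ≤ᵐ[Measure.pi μ] g) (T : Finset ι) :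
    lmarginal μ T f ≤ᵐ[Measure.pi μ] lmarginal μ T g := by
  filter_upwards [ae_ae_updateFinset h T] with x hx
  exact lintegral_mono_ae hx

theorem lmarginal_congr_ae {f g : (∀ i, X i) → ℝ≥0∞} (h : f =ᵐ[Measure.pi μ] g) (T : Finset ι) :
    lmarginal μ T f =ᵐ[Measure.pi μ] lmarginal μ T g := by
  filter_upwards [ae_ae_updateFinset h T] with x hx
  exact lintegral_congr_ae hx

/-- Functions of the coordinates in `T` that agree almost everywhere have the same integral over
these coordinates, not merely for almost every value of the others. -/
theorem lmarginal_congr_of_dependsOn [NeZero (Measure.pi μ)] {f g : (∀ i, X i) → ℝ≥0∞}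
    (h : f =ᵐ[Measure.pi μ] g) {T : Finset ι} (hf : DependsOn f (T : Set ι))
    (hg : DependsOn g (T : Set ι)) (x : ∀ i, X i) : lmarginal μ T f x = lmarginal μ T g x := by
  obtain ⟨x', hx'⟩ := (lmarginal_congr_ae h T).exists
  rw [lmarginal_eq_of_dependsOn hf x x', hx', lmarginal_eq_of_dependsOn hg x' x]

theorem ae_eq_zero_of_lmarginal_eq_zero {f : (∀ i, X i) → ℝ≥0∞} (hf : Measurable f) {T : Finset ι}
    (h : ∀ x, lmarginal μ T f x = 0) : ∀ᵐ x ∂Measure.pi μ, f x = 0 := by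
  refine ae_of_ae_ae_updateFinset (hf (measurableSet_singleton 0)) T (ae_of_all _ fun x ↦ ?_)
  exact (lintegral_eq_zero_iff (hf.comp measurable_updateFinset)).1 (h x)

theorem ae_lt_top_of_lmarginal_ne_top {f : (∀ i, X i) → ℝ≥0∞} (hf : Measurable f) {T : Finset ι}
    (h : ∀ x, lmarginal μ T f x ≠ ∞) : ∀ᵐ x ∂Measure.pi μ, f x < ∞ :=
  ae_of_ae_ae_updateFinset (measurableSet_lt hf measurable_const) T
    (ae_of_all _ fun x ↦ ae_lt_top (hf.comp measurable_updateFinset) (h x))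

/-- A function below another with the same finite mass on every slice agrees with it almost
everywhere. -/
theorem ae_eq_of_ae_le_of_lmarginal_le {f g : (∀ i, X i) → ℝ≥0∞} (hf : Measurable f)
    (hg : Measurable g) {T : Finset ι} (hle : f ≤ᵐ[Measure.pi μ] g)
    (hfin : ∀ x, lmarginal μ T f x ≠ ∞) (h : ∀ x, lmarginal μ T g x ≤ lmarginal μ T f x) :
    f =ᵐ[Measure.pi μ] g := by
  refine ae_of_ae_ae_updateFinset (measurableSet_eq_fun hf hg) T ?_
  filter_upwards [ae_ae_updateFinset hle T] with x hx
  exact ae_eq_of_ae_le_of_lintegral_le hx (hfin x)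
    (hg.comp measurable_updateFinset).aemeasurable (h x)

/-- Integrating a function of the coordinates in `T` against a density only involves the marginal
density of these coordinates. -/
theorem lintegral_mul_eq_lmarginal {g p : (∀ i, X i) → ℝ≥0∞} (hg : Measurable g)
    (hp : Measurable p) {T : Finset ι} (hT : DependsOn g (T : Set ι)) (x : ∀ i, X i) :
    ∫⁻ x, g x * p x ∂Measure.pi μ = lmarginal μ T (fun x ↦ g x * lmarginal μ Tᶜ p x) x := by
  have hu : T ∪ Tᶜ = Finset.univ := by simp
  rw [lintegral_eq_lmarginal_univ x, ← hu, lmarginal_union μ (fun x ↦ g x * p x) (hg.mul hp)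
    disjoint_compl_right]
  congr 1
  funext x
  refine lmarginal_const_mul_of_dependsOn hT ?_ hp x
  simpa using disjoint_compl_right

end MeasureTheory

/-! ### Marginal densities and the treatment coordinate -/

namespace CausalSetup

open Function

variable {V : Type*} [Fintype V] [LinearOrder V] {𝓧 : V → Type*} [∀ v, MeasurableSpace (𝓧 v)]
variable (S : CausalSetup V 𝓧) {p q : (∀ v, 𝓧 v) → ℝ≥0∞}

instance (v : V) : SigmaFinite (S.ν v) := S.sigmaFinite v

theorem measurable_marg (hp : Measurable p) (T : Finset V) : Measurable (S.marg p T) :=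
  hp.lmarginal S.ν

theorem measurable_cond (hp : Measurable p) (T : Finset V) (v : V) :
    Measurable (S.cond p T v) :=
  (S.measurable_marg hp _).div (S.measurable_marg hp _)

theorem measurable_setA (a : Bool) : Measurable (S.setA a) := measurable_update_left

theorem dependsOn_marg (p : (∀ v, 𝓧 v) → ℝ≥0∞) (T : Finset V) :
    DependsOn (S.marg p T) (T : Set V) := by
  have h := dependsOn_lmarginal (μ := S.ν) Tᶜ p
  rwa [Finset.coe_compl, compl_compl] at h

theorem dependsOn_cond (p : (∀ v, 𝓧 v) → ℝ≥0∞) (T : Finset V) (v : V) :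
    DependsOn (S.cond p T v) ((insert v T : Finset V) : Set V) :=
  (S.dependsOn_marg p _).div ((S.dependsOn_marg p T).mono (by simp))

theorem marg_univ (p : (∀ v, 𝓧 v) → ℝ≥0∞) : S.marg p Finset.univ = p := by
  simp [marg]

theorem marg_empty (p : (∀ v, 𝓧 v) → ℝ≥0∞) (x : ∀ v, 𝓧 v) :
    S.marg p ∅ x = ∫⁻ x, p x ∂S.base := by
  simp [marg, base]

/-- All marginal densities have the mass of `p`. -/
theorem lmarginal_marg (hp : Measurable p) (T : Finset V) (x : ∀ v, 𝓧 v) :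
    lmarginal S.ν T (S.marg p T) x = ∫⁻ x, p x ∂S.base := by
  have h := lintegral_mul_eq_lmarginal (μ := S.ν) (g := 1) measurable_one hp (T := T)
    (fun _ _ _ ↦ rfl) x
  simp only [Pi.one_apply, one_mul] at h
  exact h.symm

theorem lintegral_marg_update (hp : Measurable p) {T : Finset V} {v : V} (hv : v ∉ T)
    (x : ∀ v, 𝓧 v) : ∫⁻ z, S.marg p (insert v T) (update x v z) ∂S.ν v = S.marg p T x := by
  have h : insert v (insert v T)ᶜ = Tᶜ := by
    ext w
    by_cases hw : w = v <;> simp [hw, hv]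
  have h2 := lmarginal_insert (μ := S.ν) p hp (s := (insert v T)ᶜ) (i := v) (by simp) x
  rw [h] at h2
  exact h2.symm

theorem ae_law_iff (hp : Measurable p) {P : (∀ v, 𝓧 v) → Prop} :
    (∀ᵐ x ∂S.law p, P x) ↔ ∀ᵐ x ∂S.base, p x ≠ 0 → P x :=
  ae_withDensity_iff hp

theorem law_absolutelyContinuous : S.law p ≪ S.base := withDensity_absolutelyContinuous _ _

theorem ae_marg_lt_top (hp : Measurable p) (h : ∫⁻ x, p x ∂S.base ≠ ∞) (T : Finset V) :
    ∀ᵐ x ∂S.base, S.marg p T x < ∞ :=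
  ae_lt_top_of_lmarginal_ne_top (S.measurable_marg hp T) (T := T) fun x ↦ by
    rwa [S.lmarginal_marg hp]

/-- A property of the coordinates in `T` that holds almost surely holds at almost every point where
the marginal density of these coordinates is nonzero. -/
theorem ae_of_ae_law (hp : Measurable p) {T : Finset V} {P : (∀ v, 𝓧 v) → Prop}
    (hP : MeasurableSet {x | P x}) (hT : DependsOn P (T : Set V)) (h : ∀ᵐ x ∂S.law p, P x) :
    ∀ᵐ x ∂S.base, S.marg p T x ≠ 0 → P x := by
  classical
  set g : (∀ v, 𝓧 v) → ℝ≥0∞ := {x | P x}ᶜ.indicator 1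
  have hg : Measurable g := measurable_one.indicator hP.compl
  have hd : DependsOn g (T : Set V) := fun x y hxy ↦ by
    simp only [g, Set.indicator_apply, Set.mem_compl_iff, Set.mem_ofPred_eq, hT hxy, Pi.one_apply]
  have h0 : ∫⁻ x, g x * p x ∂S.base = 0 := by
    refine (lintegral_eq_zero_iff (hg.mul hp)).2 ?_
    filter_upwards [(S.ae_law_iff hp).1 h] with x hx
    by_cases hpx : p x = 0
    · simp [hpx]
    · simp [g, hx hpx]
  have h1 := ae_eq_zero_of_lmarginal_eq_zero (μ := S.ν) (hg.mul (S.measurable_marg hp T)) (T := T)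
    fun x ↦ (lintegral_mul_eq_lmarginal hg hp hd x).symm.trans h0
  filter_upwards [h1] with x hx hx0
  by_contra hPx
  simp [g, hPx, hx0] at hx

theorem ae_law_marg_ne_zero (hp : Measurable p) (T : Finset V) :
    ∀ᵐ x ∂S.law p, S.marg p T x ≠ 0 := by
  set g : (∀ v, 𝓧 v) → ℝ≥0∞ := {x | S.marg p T x = 0}.indicator 1
  have hN : MeasurableSet {x | S.marg p T x = 0} :=
    S.measurable_marg hp T (measurableSet_singleton 0)
  have hg : Measurable g := measurable_one.indicator hN
  have hd : DependsOn g (T : Set V) := fun x y hxy ↦ by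
    simp only [g, Set.indicator_apply, Set.mem_ofPred_eq, S.dependsOn_marg p T hxy, Pi.one_apply]
  rw [S.ae_law_iff hp]
  have h0 : ∫⁻ x, g x * p x ∂S.base = 0 := by
    rcases isEmpty_or_nonempty (∀ v, 𝓧 v) with _ | ⟨⟨x⟩⟩
    · simp
    rw [base, lintegral_mul_eq_lmarginal hg hp hd x]
    have : (fun x ↦ g x * lmarginal S.ν Tᶜ p x) = fun _ ↦ 0 := by
      funext x
      by_cases hx : S.marg p T x = 0
      · have : lmarginal S.ν Tᶜ p x = 0 := hx
        simp [this]
      · simp [g, hx]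
    rw [this]
    simp [lmarginal]
  filter_upwards [(lintegral_eq_zero_iff (hg.mul hp)).1 h0] with x hx hpx h
  simp [g, h, hpx] at hx

/-- The support of a marginal density shrinks when variables are added. -/
theorem ae_marg_ne_zero_of_subset (hp : Measurable p) {T T' : Finset V} (hT : T ⊆ T') :
    ∀ᵐ x ∂S.base, S.marg p T' x ≠ 0 → S.marg p T x ≠ 0 := by
  refine S.ae_of_ae_law hp ?_ ?_ (S.ae_law_marg_ne_zero hp T)
  · exact (S.measurable_marg hp T (measurableSet_singleton 0)).compl
  · intro x y hxy
    simp only [S.dependsOn_marg p T fun i hi ↦ hxy i (by exact_mod_cast hT hi)]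

/-! The treatment coordinate carries the counting measure on two points. -/

instance : MeasurableSingletonClass (𝓧 S.A) where
  measurableSet_singleton a := by
    have : {a} = S.level ⁻¹' {S.level a} := by ext; simp
    rw [this]
    exact S.level.measurable (measurableSet_singleton _)

theorem lintegral_treatment (g : 𝓧 S.A → ℝ≥0∞) :
    ∫⁻ z, g z ∂S.ν S.A = ∑ a, g (S.level.symm a) := by
  have : Fintype (𝓧 S.A) := Fintype.ofEquiv _ S.level.symm.toEquiv
  rw [S.ν_treatment, lintegral_count, tsum_fintype]
  exact (Equiv.sum_comp S.level.symm.toEquiv g).symm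

theorem ae_setA {P : (∀ v, 𝓧 v) → Prop} (h : ∀ᵐ x ∂S.base, P x) :
    ∀ᵐ x ∂S.base, ∀ a, P (S.setA a x) := by
  filter_upwards [ae_ae_update (μ := S.ν) h S.A] with x hx a
  rw [S.ν_treatment] at hx
  have h0 := ae_iff.1 hx
  rw [Measure.count_eq_zero_iff] at h0
  by_contra hP
  exact Set.notMem_empty _ (h0 ▸ hP : S.level.symm a ∈ (∅ : Set (𝓧 S.A)))

@[simp] theorem setA_setA (a b : Bool) (x : ∀ v, 𝓧 v) : S.setA a (S.setA b x) = S.setA a x := by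
  simp [setA]

@[simp] theorem level_setA (a : Bool) (x : ∀ v, 𝓧 v) : S.level (S.setA a x S.A) = a := by
  simp [setA]

theorem setA_eq_self {a : Bool} {x : ∀ v, 𝓧 v} (h : S.level (x S.A) = a) : S.setA a x = x := by
  simp [setA, ← h]

theorem _root_.DependsOn.comp_setA {β : Type*} {g : (∀ v, 𝓧 v) → β} {s : Set V}
    (hg : DependsOn g s) (a : Bool) : DependsOn (fun x ↦ g (S.setA a x)) (s \ {S.A}) :=
  fun x y h ↦ hg fun i hi ↦ by
    by_cases hA : i = S.A
    · subst hA; simp [setA]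
    · simpa [setA, hA] using h i ⟨hi, hA⟩

theorem _root_.DependsOn.apply_setA {β : Type*} {g : (∀ v, 𝓧 v) → β} {s : Set V}
    (hg : DependsOn g s) (hs : S.A ∉ s) (a : Bool) (x : ∀ v, 𝓧 v) : g (S.setA a x) = g x :=
  hg.apply_update hs x _

/-- The indicator of `A = a` with values in `ℝ≥0∞`. -/
def indE (a : Bool) (x : ∀ v, 𝓧 v) : ℝ≥0∞ := if S.level (x S.A) = a then 1 else 0

theorem measurableSet_level (a : Bool) : MeasurableSet {x : ∀ v, 𝓧 v | S.level (x S.A) = a} :=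
  (S.level.measurable.comp (measurable_pi_apply S.A)) (measurableSet_singleton a)

theorem measurable_indE (a : Bool) : Measurable (S.indE a) :=
  Measurable.ite (S.measurableSet_level a) measurable_const measurable_const

theorem toReal_indE (a : Bool) (x : ∀ v, 𝓧 v) : (S.indE a x).toReal = S.indA a x := by
  simp only [indE, indA]; split_ifs <;> simp

theorem dependsOn_indE (a : Bool) : DependsOn (S.indE a) {S.A} :=
  fun x y h ↦ by simp [indE, h S.A rfl]

theorem lmarginal_indE_mul (a : Bool) (g : (∀ v, 𝓧 v) → ℝ≥0∞) (x : ∀ v, 𝓧 v) :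
    lmarginal S.ν {S.A} (fun x ↦ S.indE a x * g x) x = g (S.setA a x) := by
  rw [lmarginal_singleton]
  simp only
  rw [S.lintegral_treatment]
  cases a <;> simp [indE, setA]

/-- The slice `A = a` of an integral can be transported to the other slices. -/
theorem lintegral_indE_mul (a b : Bool) {g : (∀ v, 𝓧 v) → ℝ≥0∞} (hg : Measurable g) :
    ∫⁻ x, S.indE a x * g x ∂S.base = ∫⁻ x, S.indE b x * g (S.setA a x) ∂S.base := by
  refine lintegral_eq_of_lmarginal_eq {S.A} ((S.measurable_indE a).mul hg)
    ((S.measurable_indE b).mul (hg.comp (S.measurable_setA a))) ?_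
  funext x
  rw [lmarginal_indE_mul, S.lmarginal_indE_mul b (fun x ↦ g (S.setA a x))]
  simp

end CausalSetup

/-! ### The topological order -/

/-- The initial segment of the order ending at `v`. -/
def upTo {V : Type*} [Fintype V] [LinearOrder V] (v : V) : Finset V := insert v (predecessors v)

section Order

variable {V : Type*} [Fintype V] [LinearOrder V]

@[simp] theorem mem_predecessors {v w : V} : w ∈ predecessors v ↔ w < v := by simp [predecessors]

@[simp] theorem mem_upTo {v w : V} : w ∈ upTo v ↔ w ≤ v := by
  simp [upTo, le_iff_eq_or_lt]

theorem predecessors_eq_upTo {v w : V} (h : v ⋖ w) : predecessors w = upTo v := by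
  ext u
  simp only [mem_predecessors, mem_upTo]
  exact ⟨fun hu ↦ not_lt.1 fun h' ↦ h.2 h' hu, fun hu ↦ hu.trans_lt h.1⟩

theorem predecessors_subset_upTo (v : V) : predecessors v ⊆ upTo v := Finset.subset_insert _ _

theorem upTo_subset_upTo {v w : V} (h : v ≤ w) : upTo v ⊆ upTo w := fun u hu ↦ by
  simp only [mem_upTo] at hu ⊢; exact hu.trans h

end Order

namespace CausalSetup

open Function

variable {V : Type*} [Fintype V] [LinearOrder V] {𝓧 : V → Type*} [∀ v, MeasurableSpace (𝓧 v)]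
variable (S : CausalSetup V 𝓧) {p q : (∀ v, 𝓧 v) → ℝ≥0∞}

theorem A_lt_Y : S.A < S.Y := lt_of_le_of_ne (S.Y_last _) S.A_ne_Y

theorem upTo_Y : upTo S.Y = Finset.univ := by ext; simp [S.Y_last]

/-- Induction along the order, downwards from the outcome. -/
theorem down_induction {P : V → Prop} (hY : P S.Y) (h : ∀ v w, v ⋖ w → P w → P v) : ∀ v, P v := by
  intro v
  induction v using (wellFounded_gt (α := V)).induction with
  | _ v ih =>
    rcases (S.Y_last v).eq_or_lt with rfl | hv
    · exact hY
    · obtain ⟨w, hw, -⟩ := exists_covBy_le_of_lt hv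
      exact h v w hw (ih w hw.1)

theorem exists_covBy_of_A_lt {v : V} (hv : S.A < v) : ∃ u, S.A ≤ u ∧ u ⋖ v :=
  exists_le_covBy_of_lt hv

/-- Induction along the order, upwards from the treatment. -/
theorem up_induction {P : ∀ v, S.A ≤ v → Prop} (hA : P S.A le_rfl)
    (h : ∀ v w (hv : S.A ≤ v) (hvw : v ⋖ w), P v hv → P w (hv.trans hvw.1.le)) (v : V)
    (hv : S.A ≤ v) : P v hv := by
  induction v using (wellFounded_lt (α := V)).induction with
  | _ v ih =>
    rcases hv.eq_or_lt with rfl | hv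
    · exact hA
    · obtain ⟨u, hu, huv⟩ := S.exists_covBy_of_A_lt hv
      exact h u v hu huv (ih u huv.1 hu)

theorem after_Y : after S.Y = [] := by
  have : (Finset.univ.filter fun w ↦ S.Y < w) = ∅ := by ext w; simp [S.Y_last w]
  simp only [after, this, Finset.sort_empty]

theorem after_covBy {v w : V} (h : v ⋖ w) : after v = w :: after w := by
  have : (Finset.univ.filter fun u ↦ v < u) = insert w (Finset.univ.filter fun u ↦ w < u) := by
    ext u
    simp only [Finset.mem_filter, Finset.mem_univ, true_and, Finset.mem_insert]
    refine ⟨fun hu ↦ ?_, ?_⟩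
    · rcases lt_trichotomy u w with h1 | h1 | h1
      · exact absurd h1 (h.2 hu)
      · exact .inl h1
      · exact .inr h1
    · rintro (rfl | hu)
      · exact h.1
      · exact h.1.trans hu
  rw [after, this, Finset.sort_insert _ (by simp +contextual [le_of_lt]) (by simp)]
  rfl

/-- The variable that follows the treatment is a child of the treatment, hence lies outside of its
district. -/
theorem inM_of_covBy (hfix : S.G.PrimalFixable S.A) {w : V} (h : S.A ⋖ w) : S.inM w := by
  have hdesc : Relation.TransGen S.G.dir S.A w := by
    by_contra hn
    exact absurd (S.follows_nondescendants w hn) (not_le.2 h.1)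
  have hlt : ∀ u v, Relation.TransGen S.G.dir u v → u < v := fun u v huv ↦ by
    induction huv with
    | single h => exact S.topological _ _ h
    | tail _ h ih => exact ih.trans (S.topological _ _ h)
  have hdir : S.G.dir S.A w := by
    rcases Relation.TransGen.tail'_iff.1 hdesc with ⟨u, hu, huw⟩
    rcases Relation.reflTransGen_iff_eq_or_transGen.1 hu with rfl | hu
    · exact huw
    · exact absurd (S.topological _ _ huw) (h.2 (hlt _ _ hu))
  refine ⟨h.1, fun hd ↦ ?_⟩
  have : w ∈ S.G.children S.A ∩ S.G.district S.A := ⟨hdir, hd⟩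
  rw [hfix] at this
  exact this

theorem inM_iff {v : V} (hv : S.A < v) : S.inM v ↔ ¬ S.inL v := by
  simp [inM, inL, hv, hv.le]

theorem lvl_of_inL {v : V} (h : S.inL v) : S.lvl v = S.a₁ := if_pos h

theorem lvl_of_not_inL {v : V} (h : ¬ S.inL v) : S.lvl v = S.a₀ := if_neg h

/-! ### Regular points of a density -/

/-- The points at which, at either treatment level, the marginal densities of `p` are finite, have
nested supports, and satisfy positivity. Almost every point is of this kind. -/
structure RegularPoint (p : (∀ v, 𝓧 v) → ℝ≥0∞) (x : ∀ v, 𝓧 v) : Prop where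
  ne_top : ∀ a T, S.marg p T (S.setA a x) ≠ ∞
  subset : ∀ a {T T'}, T ⊆ T' → S.marg p T' (S.setA a x) ≠ 0 → S.marg p T (S.setA a x) ≠ 0
  pos : ∀ a b {T}, S.Y ∉ T → S.marg p T (S.setA a x) ≠ 0 → S.marg p T (S.setA b x) ≠ 0

theorem base_ne_zero (hp : p ∈ S.nonparametricModel) : S.base ≠ 0 := fun h ↦ by
  have := hp.2.1
  simp [h] at this

theorem ae_regularPoint (hp : p ∈ S.nonparametricModel) :
    ∀ᵐ x ∂S.base, S.RegularPoint p x := by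
  obtain ⟨hm, h1, hpos⟩ := hp
  have hfin : ∀ᵐ x ∂S.base, ∀ T, S.marg p T x < ∞ :=
    ae_all_iff.2 fun T ↦ S.ae_marg_lt_top hm (by simp [h1]) T
  have hsub : ∀ᵐ x ∂S.base, ∀ T T', T ⊆ T' → S.marg p T' x ≠ 0 → S.marg p T x ≠ 0 :=
    ae_all_iff.2 fun T ↦ ae_all_iff.2 fun T' ↦ by
      by_cases h : T ⊆ T'
      · simpa [h] using S.ae_marg_ne_zero_of_subset hm h
      · simp [h]
  have hpos' : ∀ᵐ x ∂S.base, ∀ T, S.Y ∉ T → S.marg p T x ≠ 0 →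
      ∀ b, S.marg p T (S.setA b x) ≠ 0 := by
    refine ae_all_iff.2 fun T ↦ ?_
    by_cases hT : S.Y ∈ T
    · simp [hT]
    simp only [hT, not_false_eq_true, forall_true_left]
    refine S.ae_of_ae_law hm ?_ ?_ ?_
    · simp only [Set.ofPred_forall]
      exact MeasurableSet.iInter fun b ↦ ((S.measurable_marg hm T).comp (S.measurable_setA b)
        (measurableSet_singleton 0)).compl
    · intro x y hxy
      simp only [fun b ↦ ((S.dependsOn_marg p T).comp_setA S b).mono Set.sdiff_subset hxy]
    · filter_upwards [hpos, S.law_absolutelyContinuous.ae_le (S.ae_setA hsub)] with x hx hs b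
      refine hs b T _ ?_ (hx b)
      intro v hv
      simp only [Finset.mem_erase, Finset.mem_univ, and_true]
      rintro rfl
      exact hT hv
  filter_upwards [S.ae_setA hfin, S.ae_setA hsub, S.ae_setA hpos'] with x h1 h2 h3
  refine ⟨fun a T ↦ (h1 a T).ne, fun a T T' h ↦ h2 a T T' h, fun a b T hT h ↦ ?_⟩
  simpa using h3 a T hT h b

theorem ae_law_ne_zero (hp : Measurable p) : ∀ᵐ x ∂S.law p, p x ≠ 0 :=
  (S.ae_law_iff hp).2 (ae_of_all _ fun _ h ↦ h)

namespace RegularPoint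

variable {S} {x : ∀ v, 𝓧 v} (hx : S.RegularPoint p x)
include hx

theorem marg_upTo (a : Bool) (v : V) : S.marg p (upTo v) (S.setA a x) =
    S.marg p (predecessors v) (S.setA a x) * S.cond p (predecessors v) v (S.setA a x) := by
  have h : S.marg p (insert v (predecessors v)) = S.marg p (upTo v) := rfl
  rw [cond, h]
  by_cases h0 : S.marg p (predecessors v) (S.setA a x) = 0
  · rw [h0, zero_mul]
    by_contra h1
    exact hx.subset a (predecessors_subset_upTo v) h1 h0
  · rw [ENNReal.mul_div_cancel h0 (hx.ne_top _ _)]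

theorem cond_ne_top (a : Bool) (T : Finset V) (v : V) : S.cond p T v (S.setA a x) ≠ ∞ := by
  rw [cond]
  by_cases h0 : S.marg p T (S.setA a x) = 0
  · have : S.marg p (insert v T) (S.setA a x) = 0 := by
      by_contra h1
      exact hx.subset a (Finset.subset_insert v T) h1 h0
    simp [this]
  · exact ENNReal.div_ne_top (hx.ne_top _ _) h0

end RegularPoint

/-! ### The density of the intervened law -/

/-- The density `p(≤ A)(a₁) ∏ p(w | < w, a_w)`, over the post-treatment variables `w ≤ v`. -/
noncomputable def interv (p : (∀ v, 𝓧 v) → ℝ≥0∞) (v : V) (x : ∀ v, 𝓧 v) : ℝ≥0∞ :=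
  S.marg p (upTo S.A) (S.setA S.a₁ x) *
    ∏ w ∈ Finset.univ.filter (fun w ↦ S.A < w ∧ w ≤ v),
      S.cond p (predecessors w) w (S.setA (S.lvl w) x)

theorem interv_A (p : (∀ v, 𝓧 v) → ℝ≥0∞) (x : ∀ v, 𝓧 v) :
    S.interv p S.A x = S.marg p (upTo S.A) (S.setA S.a₁ x) := by
  have : (Finset.univ.filter (fun w ↦ S.A < w ∧ w ≤ S.A)) = ∅ := by
    ext w; simp
  simp [interv, this]

theorem filter_covBy {v w : V} (hv : S.A ≤ v) (h : v ⋖ w) :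
    (Finset.univ.filter (fun u ↦ S.A < u ∧ u ≤ w)) =
      insert w (Finset.univ.filter (fun u ↦ S.A < u ∧ u ≤ v)) := by
  ext u
  simp only [Finset.mem_filter, Finset.mem_univ, true_and, Finset.mem_insert]
  constructor
  · rintro ⟨h1, h2⟩
    rcases h2.eq_or_lt with rfl | h2
    · exact .inl rfl
    · exact .inr ⟨h1, not_lt.1 fun h' ↦ h.2 h' h2⟩
  · rintro (rfl | ⟨h1, h2⟩)
    · exact ⟨hv.trans_lt h.1, le_rfl⟩
    · exact ⟨h1, h2.trans h.1.le⟩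

theorem interv_covBy (p : (∀ v, 𝓧 v) → ℝ≥0∞) {v w : V} (hv : S.A ≤ v) (h : v ⋖ w) (x : ∀ v, 𝓧 v) :
    S.interv p w x = S.interv p v x * S.cond p (predecessors w) w (S.setA (S.lvl w) x) := by
  rw [interv, S.filter_covBy hv h, Finset.prod_insert (by simp [h.1]), interv]
  ring

theorem measurable_interv (hp : Measurable p) (v : V) : Measurable (S.interv p v) :=
  ((S.measurable_marg hp _).comp (S.measurable_setA _)).mul
    (Finset.measurable_fun_prod _ fun _ _ ↦ (S.measurable_cond hp _ _).comp (S.measurable_setA _))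

theorem dependsOn_interv (p : (∀ v, 𝓧 v) → ℝ≥0∞) {v : V} (hv : S.A ≤ v) :
    DependsOn (S.interv p v) ((upTo v : Set V) \ {S.A}) := by
  refine DependsOn.mul (((S.dependsOn_marg p _).comp_setA S _).mono ?_)
    (DependsOn.prod fun w hw ↦ ?_)
  · exact Set.sdiff_subset_sdiff_left (by exact_mod_cast upTo_subset_upTo hv)
  · refine ((S.dependsOn_cond p _ _).comp_setA S _).mono (Set.sdiff_subset_sdiff_left ?_)
    exact_mod_cast upTo_subset_upTo (Finset.mem_filter.1 hw).2.2

/-- Integration of `h` against the conditional law of `v` at level `a_v` given its predecessors. -/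
noncomputable def eRegress (p : (∀ v, 𝓧 v) → ℝ≥0∞) (v : V) (h : (∀ v, 𝓧 v) → ℝ≥0∞)
    (x : ∀ v, 𝓧 v) : ℝ≥0∞ :=
  ∫⁻ z, h (update x v z) * S.cond p (predecessors v) v (S.setA (S.lvl v) (update x v z)) ∂S.ν v

/-- Sequential integration of `e` along a list of variables, each at its level `a_v`. -/
noncomputable def eSeq (p e : (∀ v, 𝓧 v) → ℝ≥0∞) : List V → (∀ v, 𝓧 v) → ℝ≥0∞
  | [] => e
  | v :: l => S.eRegress p v (eSeq p e l)

/-- Integration of `e` over the variables after `v`, each at its level `a_v`. -/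
noncomputable def eNext (p e : (∀ v, 𝓧 v) → ℝ≥0∞) (v : V) : (∀ v, 𝓧 v) → ℝ≥0∞ :=
  S.eSeq p e (after v)

theorem eNext_Y (p e : (∀ v, 𝓧 v) → ℝ≥0∞) : S.eNext p e S.Y = e := by
  rw [eNext, after_Y, eSeq]

theorem eNext_covBy (p e : (∀ v, 𝓧 v) → ℝ≥0∞) {v w : V} (h : v ⋖ w) :
    S.eNext p e v = S.eRegress p w (S.eNext p e w) := by
  rw [eNext, after_covBy h, eSeq, eNext]

theorem measurable_eRegress (hp : Measurable p) (v : V) {h : (∀ v, 𝓧 v) → ℝ≥0∞}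
    (hh : Measurable h) : Measurable (S.eRegress p v h) := by
  have : S.eRegress p v h = lmarginal S.ν {v}
      (fun x ↦ h x * S.cond p (predecessors v) v (S.setA (S.lvl v) x)) := by
    rw [lmarginal_singleton]; rfl
  rw [this]
  exact (hh.mul ((S.measurable_cond hp _ _).comp (S.measurable_setA _))).lmarginal S.ν

theorem measurable_eNext (hp : Measurable p) {e : (∀ v, 𝓧 v) → ℝ≥0∞} (he : Measurable e) (v : V) :
    Measurable (S.eNext p e v) := by
  induction v using S.down_induction with
  | hY => rwa [S.eNext_Y]
  | h v w h ih => rw [S.eNext_covBy p e h]; exact S.measurable_eRegress hp w ih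

theorem dependsOn_eRegress (p : (∀ v, 𝓧 v) → ℝ≥0∞) {v w : V} (h : v ⋖ w) {g : (∀ v, 𝓧 v) → ℝ≥0∞}
    (hg : DependsOn g ((upTo w : Set V) \ {S.A})) :
    DependsOn (S.eRegress p w g) ((upTo v : Set V) \ {S.A}) := by
  intro x y hxy
  refine lintegral_congr fun z ↦ ?_
  have key : ∀ i ∈ (upTo w : Set V) \ {S.A}, update x w z i = update y w z i := by
    rintro i ⟨hi, hiA⟩
    by_cases hiw : i = w
    · subst hiw; simp
    · rw [update_of_ne hiw, update_of_ne hiw]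
      refine hxy i ⟨?_, hiA⟩
      rw [← predecessors_eq_upTo h]
      simp only [Finset.mem_coe, mem_upTo, mem_predecessors] at hi ⊢
      exact lt_of_le_of_ne hi hiw
  exact congrArg₂ (· * ·) (hg key)
    ((S.dependsOn_cond p (predecessors w) w).comp_setA S (S.lvl w) key)

theorem dependsOn_eNext (p : (∀ v, 𝓧 v) → ℝ≥0∞) {e : (∀ v, 𝓧 v) → ℝ≥0∞} (he : DependsOn e {S.Y})
    (v : V) : DependsOn (S.eNext p e v) ((upTo v : Set V) \ {S.A}) := by
  induction v using S.down_induction with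
  | hY =>
    rw [S.eNext_Y]
    exact he.mono (by simp [S.A_ne_Y.symm])
  | h v w h ih => rw [S.eNext_covBy p e h]; exact S.dependsOn_eRegress p h ih

/-- Integrating `e` over the variables after `v` in the intervened density. -/
theorem lmarginal_mul_interv_mul_eNext (hp : Measurable p) {e : (∀ v, 𝓧 v) → ℝ≥0∞}
    (he : Measurable e) {v : V} (hv : S.A ≤ v) {h : (∀ v, 𝓧 v) → ℝ≥0∞} (hh : Measurable h)
    (hd : DependsOn h (upTo v : Set V)) (x : ∀ v, 𝓧 v) :
    lmarginal S.ν (upTo v) (fun x ↦ h x * (S.interv p v x * S.eNext p e v x)) x =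
      ∫⁻ x, h x * (S.interv p S.Y x * e x) ∂S.base := by
  induction v using S.down_induction generalizing x with
  | hY => rw [S.upTo_Y, lmarginal_univ, S.eNext_Y]; rfl
  | h v w hvw ih =>
    rw [← ih (hv.trans hvw.1.le) (hd.mono (by exact_mod_cast upTo_subset_upTo hvw.1.le)) x]
    rw [show upTo w = insert w (predecessors w) from rfl, lmarginal_insert' _ _ (by simp),
      predecessors_eq_upTo hvw]
    swap
    · exact hh.mul ((S.measurable_interv hp w).mul (S.measurable_eNext hp he w))
    congr 1
    funext x
    have hw : w ∉ (upTo v : Set V) := by simp [hvw.1]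
    have hw' : w ∉ (upTo v : Set V) \ {S.A} := fun h ↦ hw h.1
    simp only [hd.apply_update hw, S.interv_covBy p hv hvw, S.eNext_covBy p e hvw, eRegress,
      (S.dependsOn_interv p hv).apply_update hw']
    rw [← mul_assoc, ← lintegral_const_mul]
    · refine lintegral_congr fun z ↦ ?_
      ring
    · exact ((S.measurable_eNext hp he w).mul ((S.measurable_cond hp _ _).comp
        (S.measurable_setA _))).comp (measurable_update x)

end CausalSetup

/-! ### The weights `R` -/

namespace CausalSetup

open Function

variable {V : Type*} [Fintype V] [LinearOrder V] {𝓧 : V → Type*} [∀ v, MeasurableSpace (𝓧 v)]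
variable (S : CausalSetup V 𝓧) {p q : (∀ v, 𝓧 v) → ℝ≥0∞}

@[simp] theorem not_a₀ : (!S.a₀) = S.a₁ := rfl

@[simp] theorem not_a₁ : (!S.a₁) = S.a₀ := Bool.not_not _

section Nuisances

variable (c : V → Finset V)

theorem f_setA (p : (∀ v, 𝓧 v) → ℝ≥0∞) (v : V) (a b : Bool) (x : ∀ v, 𝓧 v) :
    S.f c p v a (S.setA b x) = S.f c p v a x := by simp [f]

theorem R_setA (p : (∀ v, 𝓧 v) → ℝ≥0∞) (v : V) (a : Bool) (x : ∀ v, 𝓧 v) :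
    S.R c p v (S.setA a x) = S.R c p v x := by
  simp only [R, ratio, ratioA, propensity, f_setA]

theorem f_nonneg (p : (∀ v, 𝓧 v) → ℝ≥0∞) (v : V) (a : Bool) (x : ∀ v, 𝓧 v) :
    0 ≤ S.f c p v a x := ENNReal.toReal_nonneg

theorem ratio_nonneg (p : (∀ v, 𝓧 v) → ℝ≥0∞) (v : V) (x : ∀ v, 𝓧 v) :
    0 ≤ S.ratio c p v x := div_nonneg (S.f_nonneg c ..) (S.f_nonneg c ..)

theorem ratioA_nonneg (p : (∀ v, 𝓧 v) → ℝ≥0∞) (x : ∀ v, 𝓧 v) :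
    0 ≤ S.ratioA c p x := div_nonneg (S.f_nonneg c ..) (S.f_nonneg c ..)

theorem R_nonneg (p : (∀ v, 𝓧 v) → ℝ≥0∞) (v : V) (x : ∀ v, 𝓧 v) : 0 ≤ S.R c p v x := by
  have h : ∀ s : Finset V, 0 ≤ ∏ m ∈ s, S.ratio c p m x :=
    fun s ↦ Finset.prod_nonneg fun m _ ↦ S.ratio_nonneg c p m x
  refine add_nonneg (mul_nonneg (by split_ifs <;> simp) (h _))
    (mul_nonneg (by split_ifs <;> simp) (mul_nonneg (S.ratioA_nonneg c p x) (h _)))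

variable {c}

theorem measurable_f (hp : Measurable p) (v : V) (a : Bool) : Measurable (S.f c p v a) :=
  ((S.measurable_cond hp _ _).comp (S.measurable_setA a)).ennreal_toReal

theorem measurable_R (hp : Measurable p) (v : V) : Measurable (S.R c p v) := by
  have h : ∀ s : Finset V, Measurable fun x ↦ ∏ m ∈ s, S.ratio c p m x := fun s ↦
    Finset.measurable_fun_prod _ fun m _ ↦ (S.measurable_f hp _ _).div (S.measurable_f hp _ _)
  exact ((h _).const_mul _).add
    ((((S.measurable_f hp _ _).div (S.measurable_f hp _ _)).mul (h _)).const_mul _)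

end Nuisances

theorem dependsOn_f (p : (∀ v, 𝓧 v) → ℝ≥0∞) (v : V) (a : Bool) :
    DependsOn (S.f predecessors p v a) ((upTo v : Set V) \ {S.A}) := fun _ _ h ↦
  congrArg ENNReal.toReal ((S.dependsOn_cond p (predecessors v) v).comp_setA S a h)

theorem dependsOn_R (p : (∀ v, 𝓧 v) → ℝ≥0∞) {u v : V} (hu : S.A ≤ u) (h : u ⋖ v) :
    DependsOn (S.R predecessors p v) (upTo u : Set V) := by
  classical
  have hf : ∀ w, w < v → ∀ a, DependsOn (S.f predecessors p w a) (upTo u : Set V) := fun w hw a ↦ by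
    refine (S.dependsOn_f p w a).mono (Set.sdiff_subset.trans ?_)
    exact_mod_cast upTo_subset_upTo (not_lt.1 fun h' ↦ h.2 h' hw)
  intro x y hxy
  have hr : ∀ m, m < v → S.ratio predecessors p m x = S.ratio predecessors p m y :=
    fun m hm ↦ congrArg₂ (· / ·) (hf m hm _ hxy) (hf m hm _ hxy)
  have hA : S.ratioA predecessors p x = S.ratioA predecessors p y :=
    congrArg₂ (· / ·) (hf _ (hu.trans_lt h.1) _ hxy) (hf _ (hu.trans_lt h.1) _ hxy)
  simp only [R, hA]
  congr 2
  · exact Finset.prod_congr rfl fun m hm ↦ hr m (Finset.mem_filter.1 hm).2.2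
  · congr 1
    exact Finset.prod_congr rfl fun m hm ↦ hr m (Finset.mem_filter.1 hm).2.2.1

namespace RegularPoint

variable {S} {x : ∀ v, 𝓧 v} (hx : S.RegularPoint p x)
include hx

theorem marg_upTo_eq_prod (a : Bool) {v : V} (hv : S.A ≤ v) : S.marg p (upTo v) (S.setA a x) =
    S.marg p (upTo S.A) (S.setA a x) * ∏ w ∈ Finset.univ.filter (fun w ↦ S.A < w ∧ w ≤ v),
      S.cond p (predecessors w) w (S.setA a x) := by
  induction v, hv using S.up_induction with
  | hA =>
    have : (Finset.univ.filter (fun w ↦ S.A < w ∧ w ≤ S.A)) = ∅ := by ext w; simp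
    simp [this]
  | h v w hv h ih =>
    rw [S.filter_covBy hv h, Finset.prod_insert (by simp [h.1]), hx.marg_upTo,
      predecessors_eq_upTo h, ih]
    ring

theorem marg_upTo_ne_zero_iff {v : V} (hv : v < S.Y) (a b : Bool) :
    S.marg p (upTo v) (S.setA a x) ≠ 0 ↔ S.marg p (upTo v) (S.setA b x) ≠ 0 :=
  ⟨hx.pos a b (by simpa using hv), hx.pos b a (by simpa using hv)⟩

theorem interv_ne_zero_iff {v : V} (hv : S.A ≤ v) (hY : v < S.Y) (a : Bool) :
    S.interv p v x ≠ 0 ↔ S.marg p (upTo v) (S.setA a x) ≠ 0 := by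
  induction v, hv using S.up_induction with
  | hA => rw [interv_A]; exact hx.marg_upTo_ne_zero_iff hY _ _
  | h v w hv h ih =>
    rw [hx.marg_upTo_ne_zero_iff hY a (S.lvl w), S.interv_covBy p hv h, hx.marg_upTo,
      mul_ne_zero_iff, mul_ne_zero_iff, ih (h.1.trans hY), predecessors_eq_upTo h,
      hx.marg_upTo_ne_zero_iff (h.1.trans hY) a (S.lvl w)]

theorem ofReal_f_div {T : V → Finset V} {v : V} {a b : Bool}
    (h : S.cond p (T v) v (S.setA b x) ≠ 0) :
    ENNReal.ofReal (S.f T p v a x / S.f T p v b x) =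
      S.cond p (T v) v (S.setA a x) / S.cond p (T v) v (S.setA b x) := by
  rw [f, f, ENNReal.ofReal_div_of_pos (ENNReal.toReal_pos h (hx.cond_ne_top _ _ _)),
    ENNReal.ofReal_toReal (hx.cond_ne_top _ _ _), ENNReal.ofReal_toReal (hx.cond_ne_top _ _ _)]

/-- The weight `R` turns the observed density, at treatment level `a_v`, of the predecessors of `v`
into the intervened density. -/
theorem marg_mul_R {u v : V} (hu : S.A ≤ u) (h : u ⋖ v) :
    S.marg p (upTo u) (S.setA (S.lvl v) x) * ENNReal.ofReal (S.R predecessors p v x) =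
      S.interv p u x := by
  classical
  have huY : u < S.Y := h.1.trans_le (S.Y_last v)
  have hAv : S.A < v := hu.trans_lt h.1
  by_cases h0 : S.interv p u x = 0
  · have := (hx.interv_ne_zero_iff hu huY (S.lvl v)).not.1 (not_not.2 h0)
    rw [not_not.1 this, zero_mul, h0]
  have hm : ∀ a, S.marg p (upTo u) (S.setA a x) ≠ 0 := fun a ↦
    (hx.interv_ne_zero_iff hu huY a).1 h0
  set s := Finset.univ.filter (fun w ↦ S.A < w ∧ w ≤ u) with hs
  have hlt : ∀ w, w ≤ u ↔ w < v := fun w ↦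
    ⟨fun hw ↦ hw.trans_lt h.1, fun hw ↦ not_lt.1 fun h' ↦ h.2 h' hw⟩
  have hα : ∀ w ∈ s, ∀ a, S.cond p (predecessors w) w (S.setA a x) ≠ 0 := fun w hw a ↦ by
    have := hm a
    rw [hx.marg_upTo_eq_prod a hu] at this
    exact Finset.prod_ne_zero_iff.1 (mul_ne_zero_iff.1 this).2 w hw
  have hprod : S.marg p (upTo u) (S.setA (S.lvl v) x) = S.marg p (upTo S.A) (S.setA (S.lvl v) x) *
      ∏ w ∈ s, S.cond p (predecessors w) w (S.setA (S.lvl v) x) := hx.marg_upTo_eq_prod _ hu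
  have hint : S.interv p u x = S.marg p (upTo S.A) (S.setA S.a₁ x) *
      ∏ w ∈ s, S.cond p (predecessors w) w (S.setA (S.lvl w) x) := rfl
  rw [hprod, hint]
  by_cases hL : S.inL v
  -- at level `a₁`, the factors of the variables in `M` have to be moved to level `a₀`
  · have hM : ¬ S.inM v := by simp [S.inM_iff hAv, hL]
    have hf : (Finset.univ.filter fun m ↦ S.inM m ∧ m < v) = s.filter fun m ↦ S.inM m := by
      ext m
      simp only [hs, Finset.mem_filter, Finset.mem_univ, true_and, hlt]
      exact ⟨fun h ↦ ⟨⟨h.1.1, h.2⟩, h.1⟩, fun h ↦ ⟨h.2, h.1.2⟩⟩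
    rw [S.lvl_of_inL hL, R, if_pos hL, if_neg hM, zero_mul, add_zero, one_mul,
      ENNReal.ofReal_prod_of_nonneg fun m _ ↦ S.ratio_nonneg _ p m x, mul_assoc]
    congr 1
    rw [hf]
    have hAs : ∀ w ∈ s, S.A < w := fun w hw ↦ (Finset.mem_filter.1 hw).2.1
    clear_value s
    rw [Finset.prod_filter, ← Finset.prod_mul_distrib]
    refine Finset.prod_congr rfl fun w hw ↦ ?_
    have hAw : S.A < w := hAs w hw
    split_ifs with hwM
    · rw [ratio, S.lvl_of_not_inL ((S.inM_iff hAw).1 hwM), not_a₀, hx.ofReal_f_div (hα w hw _),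
        ENNReal.mul_div_cancel (hα w hw _) (hx.cond_ne_top _ _ _)]
    · rw [S.lvl_of_inL (not_not.1 ((S.inM_iff hAw).not.1 hwM)), mul_one]
  -- at level `a₀`, the treatment and the factors of the variables in `L` have to be moved to `a₁`
  · have hM : S.inM v := (S.inM_iff hAv).2 hL
    have hf : (Finset.univ.filter fun l ↦ S.inL l ∧ l < v ∧ l ≠ S.A) =
        s.filter fun l ↦ S.inL l := by
      ext l
      simp only [hs, Finset.mem_filter, Finset.mem_univ, true_and, hlt]
      exact ⟨fun h ↦ ⟨⟨lt_of_le_of_ne h.1.1 h.2.2.symm, h.2.1⟩, h.1⟩,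
        fun h ↦ ⟨h.2, h.1.2, h.1.1.ne'⟩⟩
    have hA : S.marg p (upTo S.A) (S.setA S.a₀ x) * ENNReal.ofReal (S.ratioA predecessors p x) =
        S.marg p (upTo S.A) (S.setA S.a₁ x) := by
      have h1 : S.marg p (upTo S.A) (S.setA S.a₀ x) ≠ 0 :=
        hx.subset _ (upTo_subset_upTo hu) (hm _)
      have hpred : S.marg p (predecessors S.A) (S.setA S.a₁ x) =
          S.marg p (predecessors S.A) (S.setA S.a₀ x) := by
        rw [(S.dependsOn_marg p _).apply_setA S (by simp),
          (S.dependsOn_marg p _).apply_setA S (by simp)]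
      rw [hx.marg_upTo] at h1 ⊢
      have h2 := (mul_ne_zero_iff.1 h1).2
      rw [ratioA, propensity, propensity, hx.ofReal_f_div h2, hx.marg_upTo, hpred, mul_assoc,
        ENNReal.mul_div_cancel h2 (hx.cond_ne_top _ _ _)]
    rw [S.lvl_of_not_inL hL, R, if_neg hL, if_pos hM, zero_mul, zero_add, one_mul,
      ENNReal.ofReal_mul (S.ratioA_nonneg _ p x), ← hA,
      ENNReal.ofReal_prod_of_nonneg fun m _ ↦ S.ratio_nonneg _ p m x, mul_mul_mul_comm]
    congr 1
    rw [hf]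
    have hAs : ∀ w ∈ s, S.A < w := fun w hw ↦ (Finset.mem_filter.1 hw).2.1
    clear_value s
    rw [Finset.prod_filter, ← Finset.prod_mul_distrib]
    refine Finset.prod_congr rfl fun w hw ↦ ?_
    have hAw : S.A < w := hAs w hw
    split_ifs with hwL
    · rw [ratio, S.lvl_of_inL hwL, not_a₁, hx.ofReal_f_div (hα w hw _),
        ENNReal.mul_div_cancel (hα w hw _) (hx.cond_ne_top _ _ _)]
    · rw [S.lvl_of_not_inL hwL, mul_one]

theorem marg_upTo_mul_R {v : V} (hv : S.A < v) :
    S.marg p (upTo v) (S.setA (S.lvl v) x) * ENNReal.ofReal (S.R predecessors p v x) =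
      S.interv p v x := by
  obtain ⟨u, hu, h⟩ := S.exists_covBy_of_A_lt hv
  rw [hx.marg_upTo, S.interv_covBy p hu h, ← hx.marg_mul_R hu h, predecessors_eq_upTo h]
  ring

end RegularPoint

end CausalSetup

/-! ### Perturbed densities -/

namespace CausalSetup

open Function

variable {V : Type*} [Fintype V] [LinearOrder V] {𝓧 : V → Type*} [∀ v, MeasurableSpace (𝓧 v)]
variable (S : CausalSetup V 𝓧) {p q : (∀ v, 𝓧 v) → ℝ≥0∞}

/-- The measure with density `interv p Y` on the slice `A = a₁`. The integral of `y` against it is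
the first expectation in the target parameter. -/
noncomputable def intervLaw (p : (∀ v, 𝓧 v) → ℝ≥0∞) : Measure (∀ v, 𝓧 v) :=
  S.base.withDensity fun x ↦ S.indE S.a₁ x * S.interv p S.Y x

theorem measurable_indE_mul_interv (hp : Measurable p) :
    Measurable fun x ↦ S.indE S.a₁ x * S.interv p S.Y x :=
  (S.measurable_indE _).mul (S.measurable_interv hp _)

theorem lintegral_intervLaw (hp : Measurable p) {g : (∀ v, 𝓧 v) → ℝ≥0∞} (hg : Measurable g) :
    ∫⁻ x, g x ∂S.intervLaw p = ∫⁻ x, S.indE S.a₁ x * (S.interv p S.Y x * g x) ∂S.base := by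
  rw [intervLaw, lintegral_withDensity_eq_lintegral_mul _ (S.measurable_indE_mul_interv hp) hg]
  simp only [Pi.mul_apply, mul_assoc]

theorem ae_intervLaw_iff (hp : Measurable p) {P : (∀ v, 𝓧 v) → Prop} :
    (∀ᵐ x ∂S.intervLaw p, P x) ↔
      ∀ᵐ x ∂S.base, S.indE S.a₁ x * S.interv p S.Y x ≠ 0 → P x :=
  ae_withDensity_iff (S.measurable_indE_mul_interv hp)

theorem lintegral_law (hp : Measurable p) {g : (∀ v, 𝓧 v) → ℝ≥0∞} (hg : Measurable g) :
    ∫⁻ x, g x ∂S.law p = ∫⁻ x, g x * p x ∂S.base := by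
  rw [law, lintegral_withDensity_eq_lintegral_mul _ hp hg]
  simp only [Pi.mul_apply, mul_comm]

/-- Ratio of the marginal densities of the variables in `T` at treatment level `a`. -/
noncomputable def margRatio (p q : (∀ v, 𝓧 v) → ℝ≥0∞) (T : Finset V) (a : Bool)
    (x : ∀ v, 𝓧 v) : ℝ≥0∞ :=
  S.marg q T (S.setA a x) / S.marg p T (S.setA a x)

theorem measurable_margRatio (hp : Measurable p) (hq : Measurable q) (T : Finset V) (a : Bool) :
    Measurable (S.margRatio p q T a) :=
  ((S.measurable_marg hq _).comp (S.measurable_setA a)).div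
    ((S.measurable_marg hp _).comp (S.measurable_setA a))

theorem dependsOn_margRatio (p q : (∀ v, 𝓧 v) → ℝ≥0∞) (T : Finset V) (a : Bool) :
    DependsOn (S.margRatio p q T a) ((T : Set V) \ {S.A}) :=
  ((S.dependsOn_marg q T).comp_setA S a).div ((S.dependsOn_marg p T).comp_setA S a)

/-- `q` lies between `(1 - ε) p` and `(1 + ε) p` almost everywhere. -/
structure IsClose (p q : (∀ v, 𝓧 v) → ℝ≥0∞) (ε : ℝ) : Prop where
  nonneg : 0 ≤ ε
  le_half : ε ≤ 1 / 2
  lower : ∀ᵐ x ∂S.base, ENNReal.ofReal (1 - ε) * p x ≤ q x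
  upper : ∀ᵐ x ∂S.base, q x ≤ ENNReal.ofReal (1 + ε) * p x

theorem IsClose.refl (p : (∀ v, 𝓧 v) → ℝ≥0∞) : S.IsClose p p 0 where
  nonneg := le_rfl
  le_half := by norm_num
  lower := by simp
  upper := by simp

theorem IsClose.ae_marg {S : CausalSetup V 𝓧} {ε : ℝ} (h : S.IsClose p q ε) (hp : Measurable p) :
    ∀ᵐ x ∂S.base, ∀ a T,
      ENNReal.ofReal (1 - ε) * S.marg p T (S.setA a x) ≤ S.marg q T (S.setA a x) ∧
      S.marg q T (S.setA a x) ≤ ENNReal.ofReal (1 + ε) * S.marg p T (S.setA a x) := by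
  have key : ∀ᵐ x ∂S.base, ∀ T, ENNReal.ofReal (1 - ε) * S.marg p T x ≤ S.marg q T x ∧
      S.marg q T x ≤ ENNReal.ofReal (1 + ε) * S.marg p T x := by
    refine ae_all_iff.2 fun T ↦ ?_
    have hc : ∀ (c : ℝ≥0∞) (x : ∀ v, 𝓧 v), lmarginal S.ν Tᶜ (fun x ↦ c * p x) x =
        c * S.marg p T x := fun c x ↦
      lmarginal_const_mul_of_dependsOn (s := ∅) (g := fun _ ↦ c) (fun _ _ _ ↦ rfl) (by simp) hp x
    filter_upwards [lmarginal_mono_ae (μ := S.ν) h.lower Tᶜ,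
      lmarginal_mono_ae (μ := S.ν) h.upper Tᶜ] with x h1 h2
    rw [hc] at h1 h2
    exact ⟨h1, h2⟩
  filter_upwards [S.ae_setA key] with x hx a T using hx a T

theorem IsClose.ae_margRatio {S : CausalSetup V 𝓧} {ε : ℝ} (h : S.IsClose p q ε)
    (hp : p ∈ S.nonparametricModel) :
    ∀ᵐ x ∂S.base, ∀ a T,
      S.marg q T (S.setA a x) = S.margRatio p q T a x * S.marg p T (S.setA a x) ∧
      S.margRatio p q T a x ≤ 2 ∧ (S.marg p T (S.setA a x) ≠ 0 →
        |(S.margRatio p q T a x).toReal - 1| ≤ ε) := by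
  have hε := h.nonneg
  have hε' := h.le_half
  filter_upwards [S.ae_regularPoint hp, h.ae_marg hp.1] with x hx hc a T
  obtain ⟨h1, h2⟩ := hc a T
  have htop := hx.ne_top a T
  rw [margRatio]
  by_cases h0 : S.marg p T (S.setA a x) = 0
  · simp only [h0, mul_zero, nonpos_iff_eq_zero] at h2
    simp [h0, h2]
  refine ⟨(ENNReal.div_mul_cancel h0 htop).symm, ?_, fun _ ↦ ?_⟩
  · refine ENNReal.div_le_of_le_mul (h2.trans ?_)
    gcongr
    exact ENNReal.ofReal_le_of_le_toReal (by norm_num; linarith)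
  · have h3 : ENNReal.ofReal (1 - ε) ≤ S.marg q T (S.setA a x) / S.marg p T (S.setA a x) :=
      (ENNReal.le_div_iff_mul_le (.inl h0) (.inl htop)).2 h1
    have h4 : S.marg q T (S.setA a x) / S.marg p T (S.setA a x) ≤ ENNReal.ofReal (1 + ε) :=
      ENNReal.div_le_of_le_mul h2
    have h5 : S.marg q T (S.setA a x) / S.marg p T (S.setA a x) ≠ ∞ :=
      ne_top_of_le_ne_top ENNReal.ofReal_ne_top h4
    rw [ENNReal.ofReal_le_iff_le_toReal h5] at h3
    have h6 := ENNReal.toReal_le_of_le_ofReal (by linarith) h4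
    rw [abs_le]
    constructor <;> linarith

/-- Change of weights: an expectation under `q` of a sequential regression computed from `p`,
weighted into the intervened law of `p`, is an expectation under that law. -/
theorem lintegral_indE_mul_eNext {ε : ℝ} (hc : S.IsClose p q ε) (hp : p ∈ S.nonparametricModel)
    (hq : Measurable q) {u : V} (hu : S.A ≤ u) {a : Bool} {r : (∀ v, 𝓧 v) → ℝ≥0∞}
    (hr : Measurable r) (hrd : DependsOn r (upTo u : Set V))
    (hrp : ∀ᵐ x ∂S.base, S.marg p (upTo u) (S.setA a x) * r (S.setA a x) = S.interv p u x)
    {e : (∀ v, 𝓧 v) → ℝ≥0∞} (he : Measurable e) (hed : DependsOn e {S.Y}) :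
    ∫⁻ x, S.indE a x * (r x * S.eNext p e u x) ∂S.law q =
      ∫⁻ x, S.margRatio p q (upTo u) a x * e x ∂S.intervLaw p := by
  have : NeZero S.base := ⟨S.base_ne_zero hp⟩
  have : NeZero (Measure.pi S.ν) := this
  obtain ⟨x₀, -⟩ := (S.ae_regularPoint hp).exists
  have hmI := S.measurable_indE (𝓧 := 𝓧) a
  have hmN := S.measurable_eNext hp.1 he u
  have hmW := S.measurable_margRatio hp.1 hq (upTo u) a
  have hdI : DependsOn (S.indE a) (upTo u : Set V) := (S.dependsOn_indE a).mono (by simpa using hu)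
  have hdN : DependsOn (S.eNext p e u) (upTo u : Set V) :=
    (S.dependsOn_eNext p hed u).mono Set.sdiff_subset
  have hdW := (S.dependsOn_margRatio p q (upTo u) a)
  have hdW' : DependsOn (S.margRatio p q (upTo u) a) (upTo u : Set V) := hdW.mono Set.sdiff_subset
  have hdG : DependsOn (S.interv p u) (upTo u : Set V) :=
    (S.dependsOn_interv p hu).mono Set.sdiff_subset
  have hmT : Measurable fun x ↦ S.indE a x * (r x * S.eNext p e u x) := hmI.mul (hr.mul hmN)
  have hmWe : Measurable fun x ↦ S.margRatio p q (upTo u) a x * e x := hmW.mul he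
  rw [S.lintegral_law hq hmT, base, lintegral_mul_eq_lmarginal hmT hq (hdI.mul (hrd.mul hdN)) x₀]
  have hae : (fun x ↦ S.indE a x * (r x * S.eNext p e u x) * S.marg q (upTo u) x)
      =ᵐ[Measure.pi S.ν]
      fun x ↦ (S.indE a x * S.margRatio p q (upTo u) a x) * (S.interv p u x * S.eNext p e u x) := by
    filter_upwards [hc.ae_margRatio hp, hrp] with x hx hrx
    by_cases hA : S.level (x S.A) = a
    · have h1 := (hx a (upTo u)).1
      rw [S.setA_eq_self hA] at h1 hrx
      rw [h1, ← hrx]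
      ring
    · simp [indE, hA]
  refine (lmarginal_congr_of_dependsOn hae ((hdI.mul (hrd.mul hdN)).mul (S.dependsOn_marg q _))
    ((hdI.mul hdW').mul (hdG.mul hdN)) x₀).trans ?_
  refine (S.lmarginal_mul_interv_mul_eNext hp.1 he hu (hmI.mul hmW) (hdI.mul hdW') x₀).trans ?_
  rw [S.lintegral_intervLaw hp.1 hmWe]
  simp only [Pi.mul_apply, mul_assoc]
  have hmG := S.measurable_interv hp.1 S.Y
  refine (S.lintegral_indE_mul a S.a₁ (hmW.mul (hmG.mul he))).trans ?_
  refine lintegral_congr fun x ↦ ?_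
  simp only [Pi.mul_apply]
  rw [hdW.apply_setA S (by simp), (S.dependsOn_interv p S.A_lt_Y.le).apply_setA S (by simp),
    hed.apply_setA S (by simpa using S.A_ne_Y)]
  ring

/-- The factor by which the density of the intervened law changes from `p` to `q`. -/
noncomputable def intervRatio (p q : (∀ v, 𝓧 v) → ℝ≥0∞) (x : ∀ v, 𝓧 v) : ℝ :=
  (S.margRatio p q (upTo S.A) S.a₁ x).toReal *
    ∏ v ∈ S.post, (S.margRatio p q (upTo v) (S.lvl v) x).toReal /
      (S.margRatio p q (predecessors v) (S.lvl v) x).toReal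

theorem measurable_intervRatio (hp : Measurable p) (hq : Measurable q) :
    Measurable (S.intervRatio p q) :=
  (S.measurable_margRatio hp hq _ _).ennreal_toReal.mul (Finset.measurable_fun_prod _ fun _ _ ↦
    (S.measurable_margRatio hp hq _ _).ennreal_toReal.div
      (S.measurable_margRatio hp hq _ _).ennreal_toReal)

theorem intervRatio_nonneg (p q : (∀ v, 𝓧 v) → ℝ≥0∞) (x : ∀ v, 𝓧 v) : 0 ≤ S.intervRatio p q x :=
  mul_nonneg ENNReal.toReal_nonneg (Finset.prod_nonneg fun _ _ ↦
    div_nonneg ENNReal.toReal_nonneg ENNReal.toReal_nonneg)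

theorem post_eq : S.post = Finset.univ.filter (fun w ↦ S.A < w ∧ w ≤ S.Y) := by
  ext v; simp [post, S.Y_last]

/-- Where the intervened density of `p` is nonzero, so are the marginal densities that it
involves. -/
theorem RegularPoint.marg_ne_zero {S : CausalSetup V 𝓧} {x : ∀ v, 𝓧 v} (hx : S.RegularPoint p x)
    (h : S.interv p S.Y x ≠ 0) {v : V} (hv : S.A < v) :
    S.marg p (upTo v) (S.setA (S.lvl v) x) ≠ 0 ∧
      S.marg p (predecessors v) (S.setA (S.lvl v) x) ≠ 0 := by
  have h1 : S.cond p (predecessors v) v (S.setA (S.lvl v) x) ≠ 0 :=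
    Finset.prod_ne_zero_iff.1 (mul_ne_zero_iff.1 h).2 v (by simp [hv, S.Y_last])
  have h2 : S.marg p (upTo v) (S.setA (S.lvl v) x) ≠ 0 := fun h0 ↦
    h1 (ENNReal.div_eq_zero_iff.2 (.inl h0))
  exact ⟨h2, hx.subset _ (predecessors_subset_upTo v) h2⟩

theorem IsClose.ae_abs_margRatio_sub_one_le {S : CausalSetup V 𝓧} {ε : ℝ} (hc : S.IsClose p q ε)
    (hp : p ∈ S.nonparametricModel) : ∀ᵐ x ∂S.base, S.interv p S.Y x ≠ 0 →
      |(S.margRatio p q (upTo S.A) S.a₁ x).toReal - 1| ≤ ε ∧ ∀ v ∈ S.post,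
        |(S.margRatio p q (upTo v) (S.lvl v) x).toReal - 1| ≤ ε ∧
        |(S.margRatio p q (predecessors v) (S.lvl v) x).toReal - 1| ≤ ε := by
  filter_upwards [S.ae_regularPoint hp, hc.ae_margRatio hp] with x hx hr h0
  refine ⟨(hr _ _).2.2 (mul_ne_zero_iff.1 h0).1, fun v hv ↦ ?_⟩
  have := hx.marg_ne_zero h0 (v := v) (by simpa [post] using hv)
  exact ⟨(hr _ _).2.2 this.1, (hr _ _).2.2 this.2⟩

/-- The intervened density of `q` is that of `p` times a product of ratios of marginal densities. -/
theorem IsClose.ae_interv_eq {S : CausalSetup V 𝓧} {ε : ℝ} (hc : S.IsClose p q ε)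
    (hp : p ∈ S.nonparametricModel) : ∀ᵐ x ∂S.base,
      S.interv q S.Y x = S.interv p S.Y x * ENNReal.ofReal (S.intervRatio p q x) := by
  have hε := hc.le_half
  filter_upwards [S.ae_regularPoint hp, hc.ae_margRatio hp, hc.ae_abs_margRatio_sub_one_le hp]
    with x hx hr habs
  have hratio : ∀ v a, S.cond q (predecessors v) v (S.setA a x) =
      S.margRatio p q (upTo v) a x * S.marg p (upTo v) (S.setA a x) /
        (S.margRatio p q (predecessors v) a x * S.marg p (predecessors v) (S.setA a x)) :=
      fun v a ↦ by
    rw [← (hr a (upTo v)).1, ← (hr a (predecessors v)).1]; rfl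
  by_cases h0 : S.interv p S.Y x = 0
  · rw [h0, zero_mul, interv, (hr _ _).1]
    rcases mul_eq_zero.1 h0 with h1 | h1
    · rw [h1, mul_zero, zero_mul]
    · obtain ⟨v, hv, hv0⟩ := Finset.prod_eq_zero_iff.1 h1
      refine mul_eq_zero_of_right _ (Finset.prod_eq_zero hv ?_)
      rw [cond, ENNReal.div_eq_zero_iff] at hv0
      have : S.marg p (upTo v) (S.setA (S.lvl v) x) = 0 :=
        hv0.resolve_right (hx.ne_top _ _)
      rw [hratio, this, mul_zero, ENNReal.zero_div]
  · obtain ⟨hA, hv⟩ := habs h0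
    have htop : ∀ a T, S.margRatio p q T a x ≠ ∞ := fun a T ↦
      ne_top_of_le_ne_top (by simp) (hr a T).2.1
    have hpos : ∀ t : ℝ, |t - 1| ≤ ε → 0 < t := fun t ht ↦ by
      rw [abs_le] at ht; linarith
    rw [intervRatio, ENNReal.ofReal_mul ENNReal.toReal_nonneg, ENNReal.ofReal_toReal (htop _ _),
      ENNReal.ofReal_prod_of_nonneg fun _ _ ↦
        div_nonneg ENNReal.toReal_nonneg ENNReal.toReal_nonneg,
      interv, interv, (hr _ _).1, ← S.post_eq]
    have : ∀ v ∈ S.post, S.cond q (predecessors v) v (S.setA (S.lvl v) x) =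
        S.cond p (predecessors v) v (S.setA (S.lvl v) x) *
        ENNReal.ofReal ((S.margRatio p q (upTo v) (S.lvl v) x).toReal /
          (S.margRatio p q (predecessors v) (S.lvl v) x).toReal) := fun v hv' ↦ by
      have hpos' := hpos _ (hv v hv').2
      have hne : S.margRatio p q (predecessors v) (S.lvl v) x ≠ 0 := fun h ↦ by
        simp [h] at hpos'
      rw [ENNReal.ofReal_div_of_pos hpos', ENNReal.ofReal_toReal (htop _ _),
        ENNReal.ofReal_toReal (htop _ _), hratio, cond, div_eq_mul_inv, div_eq_mul_inv,
        div_eq_mul_inv, ENNReal.mul_inv (.inl hne) (.inl (htop _ _))]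
      change _ * S.marg p (upTo v) _ * _ = S.marg p (upTo v) _ * _ * _
      ring
    rw [Finset.prod_congr rfl this, Finset.prod_mul_distrib]
    ring

end CausalSetup

/-! ### Sequential regressions as integrals under the intervened law -/

namespace MeasureTheory

theorem integral_eq_toReal_sub_toReal {α : Type*} [MeasurableSpace α] {μ : Measure α} {g : α → ℝ}
    {e₁ e₂ : α → ℝ≥0∞} (h₁ : AEMeasurable e₁ μ) (h₂ : AEMeasurable e₂ μ) (hf₁ : ∫⁻ x, e₁ x ∂μ ≠ ∞)
    (hf₂ : ∫⁻ x, e₂ x ∂μ ≠ ∞) (h : ∀ᵐ x ∂μ, g x = (e₁ x).toReal - (e₂ x).toReal) :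
    Integrable g μ ∧ ∫ x, g x ∂μ = (∫⁻ x, e₁ x ∂μ).toReal - (∫⁻ x, e₂ x ∂μ).toReal := by
  have i₁ := integrable_toReal_of_lintegral_ne_top h₁ hf₁
  have i₂ := integrable_toReal_of_lintegral_ne_top h₂ hf₂
  refine ⟨(i₁.sub i₂).congr (h.mono fun x hx ↦ hx.symm), ?_⟩
  rw [integral_congr_ae h, integral_sub i₁ i₂, integral_toReal h₁ (ae_lt_top' h₁ hf₁),
    integral_toReal h₂ (ae_lt_top' h₂ hf₂)]

end MeasureTheory

namespace CausalSetup

open Function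

variable {V : Type*} [Fintype V] [LinearOrder V] {𝓧 : V → Type*} [∀ v, MeasurableSpace (𝓧 v)]
variable (S : CausalSetup V 𝓧) {p q : (∀ v, 𝓧 v) → ℝ≥0∞}

theorem measurable_y : Measurable S.y := S.measurable_outcome.comp (measurable_pi_apply S.Y)

theorem dependsOn_y {β : Type*} (g : ℝ → β) : DependsOn (fun x ↦ g (S.y x)) {S.Y} :=
  fun x y h ↦ by simp only [CausalSetup.y, h S.Y rfl]

/-- The positive part of the outcome. -/
noncomputable def yPos (x : ∀ v, 𝓧 v) : ℝ≥0∞ := ENNReal.ofReal (S.y x)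

/-- The negative part of the outcome. -/
noncomputable def yNeg (x : ∀ v, 𝓧 v) : ℝ≥0∞ := ENNReal.ofReal (-S.y x)

/-- The absolute value of the outcome. -/
noncomputable def yAbs (x : ∀ v, 𝓧 v) : ℝ≥0∞ := ENNReal.ofReal |S.y x|

theorem measurable_yPos : Measurable S.yPos := S.measurable_y.ennreal_ofReal

theorem measurable_yNeg : Measurable S.yNeg := S.measurable_y.neg.ennreal_ofReal

theorem measurable_yAbs : Measurable S.yAbs := S.measurable_y.abs.ennreal_ofReal

theorem yPos_le (x : ∀ v, 𝓧 v) : S.yPos x ≤ S.yAbs x := ENNReal.ofReal_le_ofReal (le_abs_self _)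

theorem yNeg_le (x : ∀ v, 𝓧 v) : S.yNeg x ≤ S.yAbs x := ENNReal.ofReal_le_ofReal (neg_le_abs _)

theorem toReal_yPos_sub (x : ∀ v, 𝓧 v) : (S.yPos x).toReal - (S.yNeg x).toReal = S.y x := by
  rw [yPos, yNeg, ENNReal.toReal_ofReal', ENNReal.toReal_ofReal', max_zero_sub_eq_self]

theorem eSeq_mono (p : (∀ v, 𝓧 v) → ℝ≥0∞) {e e' : (∀ v, 𝓧 v) → ℝ≥0∞} (h : ∀ x, e x ≤ e' x)
    (l : List V) (x : ∀ v, 𝓧 v) : S.eSeq p e l x ≤ S.eSeq p e' l x := by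
  induction l generalizing x with
  | nil => exact h x
  | cons v l ih => exact lintegral_mono fun z ↦ mul_le_mul_left (ih _) _

theorem nextB_Y (c : V → Finset V) (p : (∀ v, 𝓧 v) → ℝ≥0∞) : S.nextB c p S.Y = S.y := by
  rw [nextB, after_Y, seqRegress]

theorem nextB_covBy (c : V → Finset V) (p : (∀ v, 𝓧 v) → ℝ≥0∞) {v w : V} (h : v ⋖ w) :
    S.nextB c p v = S.B c p w (S.lvl w) := by
  rw [nextB, after_covBy h, seqRegress, B, nextB]

theorem ae_eNext_lt_top (hp : Measurable p) {e : (∀ v, 𝓧 v) → ℝ≥0∞} (he : Measurable e)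
    (hed : DependsOn e {S.Y}) (hfin : ∫⁻ x, e x ∂S.intervLaw p ≠ ∞) {v : V} (hv : S.A ≤ v) :
    ∀ᵐ x ∂S.base, S.interv p v x ≠ 0 → S.eNext p e v x < ∞ := by
  have hmI := S.measurable_indE (𝓧 := 𝓧) S.a₁
  have h := ae_lt_top_of_lmarginal_ne_top (μ := S.ν) (T := upTo v)
    (f := fun x ↦ S.indE S.a₁ x * (S.interv p v x * S.eNext p e v x))
    (hmI.mul ((S.measurable_interv hp v).mul (S.measurable_eNext hp he v))) fun x ↦ by
      rw [S.lmarginal_mul_interv_mul_eNext hp he hv hmI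
        ((S.dependsOn_indE S.a₁).mono (by simpa using hv)), ← S.lintegral_intervLaw hp he]
      exact hfin
  filter_upwards [S.ae_setA h] with x hx h0
  have h1 := hx S.a₁
  rw [(S.dependsOn_interv p hv).apply_setA S (by simp),
    (S.dependsOn_eNext p hed v).apply_setA S (by simp)] at h1
  simp only [indE, level_setA, if_true, one_mul] at h1
  by_contra hN
  rw [not_lt, top_le_iff] at hN
  simp [hN, h0] at h1

/-- At almost every point of the support, the sequential regression of the outcome is the difference
of the sequential integrals of its positive and negative part. -/
theorem ae_nextB_eq (hp : p ∈ S.nonparametricModel) (hfin : ∫⁻ x, S.yAbs x ∂S.intervLaw p ≠ ∞)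
    {v : V} (hv : S.A ≤ v) : ∀ᵐ x ∂S.base, S.interv p v x ≠ 0 →
      S.nextB predecessors p v x =
        (S.eNext p S.yPos v x).toReal - (S.eNext p S.yNeg v x).toReal := by
  induction v using S.down_induction with
  | hY => simp [S.nextB_Y, S.eNext_Y, S.toReal_yPos_sub]
  | h v w hvw ih =>
    have hw : S.A ≤ w := hv.trans hvw.1.le
    filter_upwards [S.ae_eNext_lt_top hp.1 S.measurable_yAbs
        (S.dependsOn_y fun t ↦ ENNReal.ofReal |t|)
        hfin hv, ae_ae_update (μ := S.ν) (ih hw) w,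
      ae_ae_update (μ := S.ν) (S.ae_regularPoint hp) w] with x hx hz hreg h0
    have hfinx := hx h0
    have hle : ∀ e : (∀ v, 𝓧 v) → ℝ≥0∞, (∀ x, e x ≤ S.yAbs x) → S.eNext p e v x ≠ ∞ := fun e he ↦
      ((S.eSeq_mono p he _ x).trans_lt hfinx).ne
    have hmeas : ∀ e : (∀ v, 𝓧 v) → ℝ≥0∞, Measurable e → Measurable fun z ↦
        S.eNext p e w (update x w z) *
          S.cond p (predecessors w) w (S.setA (S.lvl w) (update x w z)) := fun e he ↦
      ((S.measurable_eNext hp.1 he w).mul ((S.measurable_cond hp.1 _ _).comp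
        (S.measurable_setA _))).comp (measurable_update x)
    have h1 := hle _ S.yPos_le
    have h2 := hle _ S.yNeg_le
    rw [S.eNext_covBy p _ hvw] at h1 h2 ⊢
    rw [S.eNext_covBy p _ hvw, S.nextB_covBy _ p hvw]
    refine (integral_eq_toReal_sub_toReal (hmeas _ S.measurable_yPos).aemeasurable
      (hmeas _ S.measurable_yNeg).aemeasurable h1 h2 ?_).2
    filter_upwards [hz, hreg] with z hz hreg
    by_cases hc : S.cond p (predecessors w) w (S.setA (S.lvl w) (update x w z)) = 0
    · simp [f, hc]
    · have hG : S.interv p w (update x w z) ≠ 0 := by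
        rw [S.interv_covBy p hv hvw, (S.dependsOn_interv p hv).apply_update (by simp [hvw.1])]
        exact mul_ne_zero h0 hc
      rw [hz hG, ENNReal.toReal_mul, ENNReal.toReal_mul, f]
      ring

/-- Real-valued form of `lintegral_indE_mul_eNext`. -/
theorem integral_indA_mul_nextB {ε : ℝ} (hc : S.IsClose p q ε) (hp : p ∈ S.nonparametricModel)
    (hq : Measurable q) (hfin : ∫⁻ x, S.yAbs x ∂S.intervLaw p ≠ ∞) {u : V} (hu : S.A ≤ u) {a : Bool}
    {r : (∀ v, 𝓧 v) → ℝ} (hr : Measurable r) (hr0 : ∀ x, 0 ≤ r x)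
    (hrd : DependsOn r (upTo u : Set V))
    (hrp : ∀ᵐ x ∂S.base,
      S.marg p (upTo u) (S.setA a x) * ENNReal.ofReal (r (S.setA a x)) = S.interv p u x) :
    Integrable (fun x ↦ S.indA a x * r x * S.nextB predecessors p u x) (S.law q) ∧
    Integrable (fun x ↦ (S.margRatio p q (upTo u) a x).toReal * S.y x) (S.intervLaw p) ∧
    ∫ x, S.indA a x * r x * S.nextB predecessors p u x ∂S.law q =
      ∫ x, (S.margRatio p q (upTo u) a x).toReal * S.y x ∂S.intervLaw p := by
  have hmI := S.measurable_indE (𝓧 := 𝓧) a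
  have hmW := S.measurable_margRatio hp.1 hq (upTo u) a
  have hr' : Measurable fun x ↦ ENNReal.ofReal (r x) := hr.ennreal_ofReal
  have hrd' : DependsOn (fun x ↦ ENNReal.ofReal (r x)) (upTo u : Set V) := fun x y h ↦ by
    simp only [hrd h]
  have hW2 : ∀ᵐ x ∂S.intervLaw p, S.margRatio p q (upTo u) a x ≤ 2 :=
    (S.ae_intervLaw_iff hp.1).2 ((hc.ae_margRatio hp).mono fun x hx _ ↦ (hx _ _).2.1)
  have hfinW : ∀ e : (∀ v, 𝓧 v) → ℝ≥0∞, (∀ x, e x ≤ S.yAbs x) →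
      ∫⁻ x, S.margRatio p q (upTo u) a x * e x ∂S.intervLaw p ≠ ∞ := fun e he ↦ by
    refine ne_top_of_le_ne_top (ENNReal.mul_ne_top (a := 2) (by simp) hfin) ?_
    rw [← lintegral_const_mul _ S.measurable_yAbs]
    exact lintegral_mono_ae (hW2.mono fun x hx ↦ mul_le_mul' hx (he x))
  have hP := S.lintegral_indE_mul_eNext hc hp hq hu hr' hrd' hrp S.measurable_yPos
    (S.dependsOn_y ENNReal.ofReal)
  have hN := S.lintegral_indE_mul_eNext hc hp hq hu hr' hrd' hrp S.measurable_yNeg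
    (S.dependsOn_y fun t ↦ ENNReal.ofReal (-t))
  have hmP : Measurable fun x ↦ S.indE a x * (ENNReal.ofReal (r x) * S.eNext p S.yPos u x) :=
    hmI.mul (hr'.mul (S.measurable_eNext hp.1 S.measurable_yPos u))
  have hmN : Measurable fun x ↦ S.indE a x * (ENNReal.ofReal (r x) * S.eNext p S.yNeg u x) :=
    hmI.mul (hr'.mul (S.measurable_eNext hp.1 S.measurable_yNeg u))
  have h1 := integral_eq_toReal_sub_toReal (μ := S.intervLaw p)
    (g := fun x ↦ (S.margRatio p q (upTo u) a x).toReal * S.y x)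
    (hmW.mul S.measurable_yPos).aemeasurable (hmW.mul S.measurable_yNeg).aemeasurable
    (hfinW _ S.yPos_le) (hfinW _ S.yNeg_le) (ae_of_all _ fun x ↦ by
      simp only [Pi.mul_apply, ENNReal.toReal_mul, ← S.toReal_yPos_sub x]; ring)
  have h2 := integral_eq_toReal_sub_toReal (μ := S.law q)
    (g := fun x ↦ S.indA a x * r x * S.nextB predecessors p u x)
    hmP.aemeasurable hmN.aemeasurable (hP ▸ hfinW _ S.yPos_le) (hN ▸ hfinW _ S.yNeg_le) (by
      filter_upwards [S.law_absolutelyContinuous.ae_le (S.ae_nextB_eq hp hfin hu),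
        S.law_absolutelyContinuous.ae_le hrp, S.ae_law_marg_ne_zero hq (upTo u),
        S.law_absolutelyContinuous.ae_le (hc.ae_margRatio hp)] with x hx hrx hqx hrat
      simp only [ENNReal.toReal_mul, ENNReal.toReal_ofReal (hr0 x), S.toReal_indE]
      by_cases hA : S.level (x S.A) = a
      · have hm := (hrat a (upTo u)).1
        rw [S.setA_eq_self hA] at hrx hm
        by_cases h0 : S.interv p u x = 0
        · rw [h0] at hrx
          have hr00 : r x = 0 := by
            rcases mul_eq_zero.1 hrx with h | h
            · exact absurd (by rw [hm, h, mul_zero]) hqx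
            · exact le_antisymm (ENNReal.ofReal_eq_zero.1 h) (hr0 x)
          simp [hr00]
        · rw [hx h0]
          ring
      · simp [indA, hA])
  refine ⟨h2.1, h1.1, ?_⟩
  rw [h1.2, h2.2, hP, hN]
  rfl

/-! ### The influence function as a sum over the post-treatment variables -/

theorem Phi_eq (hfix : S.G.PrimalFixable S.A) (c : V → Finset V) (p : (∀ v, 𝓧 v) → ℝ≥0∞)
    (x : ∀ v, 𝓧 v) : S.Phi c p x =
      ∑ v ∈ S.post, (S.indA (S.lvl v) x * S.R c p v x * S.nextB c p v x
        - S.indA (S.lvl v) x * S.R c p v x * S.B c p v (S.lvl v) x)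
      + S.indA S.a₁ x * S.nextB c p S.A x + S.indA S.a₀ x * S.y x - S.psi c p := by
  have hpost : S.post = insert S.Y S.Z := by
    ext v
    simp only [post, Z, Finset.mem_filter, Finset.mem_univ, true_and, Finset.mem_insert]
    constructor
    · intro h
      rcases (S.Y_last v).eq_or_lt with rfl | h'
      · exact .inl rfl
      · exact .inr ⟨h, h'⟩
    · rintro (rfl | h)
      · exact S.A_lt_Y
      · exact h.1
  obtain ⟨w, hw, -⟩ := exists_covBy_le_of_lt S.A_lt_Y
  have hlvl : S.lvl w = S.a₀ :=
    S.lvl_of_not_inL ((S.inM_iff hw.1).1 (S.inM_of_covBy hfix hw))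
  have hB : S.BZ₁ c p S.a₀ = S.nextB c p S.A := by
    rw [S.nextB_covBy c p hw, BZ₁, after_covBy hw, hlvl]
  have hmu : S.mu c p (S.lvl S.Y) = S.B c p S.Y (S.lvl S.Y) := by rw [mu, B, S.nextB_Y]
  rw [Phi, hB, hmu, hpost, Finset.sum_insert (by simp [Z]), S.nextB_Y]
  simp only [mul_sub]
  ring

end CausalSetup

/-! ### The target parameter as a mean under the intervened law -/

namespace CausalSetup

open Function

variable {V : Type*} [Fintype V] [LinearOrder V] {𝓧 : V → Type*} [∀ v, MeasurableSpace (𝓧 v)]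
variable (S : CausalSetup V 𝓧) {p q : (∀ v, 𝓧 v) → ℝ≥0∞}

/-- The product of the conditional densities of the post-treatment variables `v` at levels `a_v`. -/
noncomputable def postDensity (p : (∀ v, 𝓧 v) → ℝ≥0∞) (x : ∀ v, 𝓧 v) : ℝ≥0∞ :=
  ∏ v ∈ S.post, S.cond p (predecessors v) v (S.setA (S.lvl v) x)

theorem measurable_postDensity (hp : Measurable p) : Measurable (S.postDensity p) :=
  Finset.measurable_fun_prod _ fun _ _ ↦ (S.measurable_cond hp _ _).comp (S.measurable_setA _)

theorem dependsOn_postDensity (p : (∀ v, 𝓧 v) → ℝ≥0∞) : DependsOn (S.postDensity p) {S.A}ᶜ :=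
  DependsOn.prod fun _ _ ↦ ((S.dependsOn_cond p _ _).comp_setA S _).mono fun _ hi ↦ hi.2

theorem interv_Y (p : (∀ v, 𝓧 v) → ℝ≥0∞) (x : ∀ v, 𝓧 v) :
    S.interv p S.Y x = S.marg p (upTo S.A) (S.setA S.a₁ x) * S.postDensity p x := by
  rw [interv, postDensity, post_eq]

/-- The treatment probability times the integral over the post-treatment variables has the mean of
`e` under the intervened law as its expectation: averaging over the observed law only involves the
variables before the treatment. -/
theorem lintegral_cond_mul_lmarginal (hp : p ∈ S.nonparametricModel) {e : (∀ v, 𝓧 v) → ℝ≥0∞}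
    (he : Measurable e) (hed : DependsOn e {S.Y}) :
    ∫⁻ x, S.cond p (predecessors S.A) S.A (S.setA S.a₁ x) *
      lmarginal S.ν S.post (fun x ↦ e x * S.postDensity p x) x ∂S.law p =
      ∫⁻ x, e x ∂S.intervLaw p := by
  have : NeZero S.base := ⟨S.base_ne_zero hp⟩
  have : NeZero (Measure.pi S.ν) := this
  obtain ⟨x₀, -⟩ := (S.ae_regularPoint hp).exists
  have hm := hp.1
  have hmC : Measurable fun x ↦ S.cond p (predecessors S.A) S.A (S.setA S.a₁ x) :=
    (S.measurable_cond hm _ _).comp (S.measurable_setA _)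
  have hmE : Measurable fun x ↦ e x * S.postDensity p x := he.mul (S.measurable_postDensity hm)
  have hmL : Measurable (lmarginal S.ν S.post fun x ↦ e x * S.postDensity p x) := hmE.lmarginal S.ν
  have hmM : Measurable fun x ↦ S.marg p (upTo S.A) (S.setA S.a₁ x) :=
    (S.measurable_marg hm _).comp (S.measurable_setA _)
  have hdE : DependsOn (fun x ↦ e x * S.postDensity p x) {S.A}ᶜ :=
    (hed.mono (by simpa using S.A_ne_Y)).mul (S.dependsOn_postDensity p)
  have hdL : DependsOn (lmarginal S.ν S.post fun x ↦ e x * S.postDensity p x)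
      (predecessors S.A : Set V) := (hdE.lmarginal S.post).mono fun v hv ↦ by
    have h1 : v ≠ S.A := hv.1
    have h2 : ¬ S.A < v := fun h ↦ hv.2 (by simpa [post] using h)
    simpa using lt_of_le_of_ne (not_lt.1 h2) h1
  have hup : (upTo S.A : Set V) \ {S.A} ⊆ predecessors S.A := fun v hv ↦ by
    simpa using lt_of_le_of_ne (by simpa using hv.1) hv.2
  have hdC : DependsOn (fun x ↦ S.cond p (predecessors S.A) S.A (S.setA S.a₁ x))
      (predecessors S.A : Set V) := ((S.dependsOn_cond p _ _).comp_setA S _).mono hup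
  have hdM : DependsOn (fun x ↦ S.marg p (upTo S.A) (S.setA S.a₁ x))
      (predecessors S.A : Set V) := ((S.dependsOn_marg p _).comp_setA S _).mono hup
  have hmCL : Measurable fun x ↦ S.cond p (predecessors S.A) S.A (S.setA S.a₁ x) *
      lmarginal S.ν S.post (fun x ↦ e x * S.postDensity p x) x := hmC.mul hmL
  rw [S.lintegral_law hm hmCL, base, lintegral_mul_eq_lmarginal hmCL hm (hdC.mul hdL) x₀]
  have hae : (fun x ↦ S.cond p (predecessors S.A) S.A (S.setA S.a₁ x) *
      lmarginal S.ν S.post (fun x ↦ e x * S.postDensity p x) x * S.marg p (predecessors S.A) x)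
      =ᵐ[Measure.pi S.ν] fun x ↦ S.marg p (upTo S.A) (S.setA S.a₁ x) *
        lmarginal S.ν S.post (fun x ↦ e x * S.postDensity p x) x := by
    filter_upwards [S.ae_regularPoint hp] with x hx
    rw [hx.marg_upTo, (S.dependsOn_marg p (predecessors S.A)).apply_setA S (by simp)]
    ring
  refine (lmarginal_congr_of_dependsOn hae ((hdC.mul hdL).mul (S.dependsOn_marg p _))
    (hdM.mul hdL) x₀).trans ?_
  have hin : (fun x ↦ S.marg p (upTo S.A) (S.setA S.a₁ x) *
      lmarginal S.ν S.post (fun x ↦ e x * S.postDensity p x) x) =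
      lmarginal S.ν S.post fun x ↦ S.interv p S.Y x * e x := by
    funext x
    rw [← lmarginal_const_mul_of_dependsOn hdM _ hmE]
    · congr 1
      funext x
      rw [S.interv_Y]
      ring
    · rw [Set.disjoint_left]
      intro v hv hv'
      simp only [Finset.mem_coe, mem_predecessors] at hv
      simp only [post, Finset.coe_filter, Finset.mem_univ, true_and, Set.mem_ofPred_eq] at hv'
      exact lt_asymm hv hv'
  have hmI := S.measurable_indE (𝓧 := 𝓧) S.a₁
  have hmG : Measurable fun x ↦ S.interv p S.Y x * e x := (S.measurable_interv hm S.Y).mul he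
  have hmIG : Measurable fun x ↦ S.indE S.a₁ x * (S.interv p S.Y x * e x) := hmI.mul hmG
  have hA : lmarginal S.ν {S.A} (fun x ↦ S.indE S.a₁ x * (S.interv p S.Y x * e x)) =
      fun x ↦ S.interv p S.Y x * e x := by
    funext x
    rw [S.lmarginal_indE_mul S.a₁ (fun x ↦ S.interv p S.Y x * e x)]
    rw [(S.dependsOn_interv p S.A_lt_Y.le).apply_setA S (by simp),
      hed.apply_setA S (by simpa using S.A_ne_Y)]
  have hd1 : Disjoint (predecessors S.A) S.post := by
    rw [Finset.disjoint_left]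
    intro v hv hv'
    simp only [mem_predecessors] at hv
    simp only [post, Finset.mem_filter, Finset.mem_univ, true_and] at hv'
    exact lt_asymm hv hv'
  have hd2 : Disjoint (predecessors S.A ∪ S.post) {S.A} := by
    simp [post]
  have hu : (predecessors S.A ∪ S.post) ∪ {S.A} = Finset.univ := by
    ext v
    simp only [Finset.mem_union, mem_predecessors, post, Finset.mem_filter, Finset.mem_univ,
      true_and, Finset.mem_singleton, iff_true]
    rcases lt_trichotomy v S.A with h | h | h <;> simp [h]
  rw [hin, ← lmarginal_union _ _ hmG hd1, S.lintegral_intervLaw hm he, base,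
    lintegral_eq_lmarginal_univ x₀, ← hu, lmarginal_union _ _ hmIG hd2, hA]

theorem ae_ofReal_mul_prod_f (hp : p ∈ S.nonparametricModel) : ∀ᵐ x ∂S.base, ∀ t : ℝ, 0 ≤ t →
    ENNReal.ofReal (t * ∏ v ∈ S.post, S.f predecessors p v (S.lvl v) x) =
      ENNReal.ofReal t * S.postDensity p x := by
  filter_upwards [S.ae_regularPoint hp] with x hx t ht
  rw [ENNReal.ofReal_mul ht, ENNReal.ofReal_prod_of_nonneg fun v _ ↦ S.f_nonneg _ p v _ x,
    postDensity]
  congr 1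
  exact Finset.prod_congr rfl fun v _ ↦ ENNReal.ofReal_toReal (hx.cond_ne_top _ _ _)

theorem ae_lintegral_post_eq (hp : p ∈ S.nonparametricModel) : ∀ᵐ x ∂S.base,
    ∫⁻ z : (∀ i : S.post, 𝓧 i),
        ENNReal.ofReal (|S.y (Function.updateFinset x S.post z)| *
          ∏ v ∈ S.post, S.f predecessors p v (S.lvl v) (Function.updateFinset x S.post z))
        ∂Measure.pi (fun i : S.post => S.ν i) =
      lmarginal S.ν S.post (fun x ↦ S.yAbs x * S.postDensity p x) x := by
  filter_upwards [ae_ae_updateFinset (μ := S.ν) (S.ae_ofReal_mul_prod_f hp) S.post] with x hx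
  exact lintegral_congr_ae (hx.mono fun z hz ↦ hz _ (abs_nonneg _))

theorem ae_ofReal_propensity (hp : p ∈ S.nonparametricModel) : ∀ᵐ x ∂S.base,
    ENNReal.ofReal (S.propensity predecessors p S.a₁ x) =
      S.cond p (predecessors S.A) S.A (S.setA S.a₁ x) := by
  filter_upwards [S.ae_regularPoint hp] with x hx
  exact ENNReal.ofReal_toReal (hx.cond_ne_top _ _ _)

theorem lintegral_yAbs_intervLaw_ne_top (hp : p ∈ S.nonparametricModel)
    (h : S.TargetFinite predecessors p) : ∫⁻ x, S.yAbs x ∂S.intervLaw p ≠ ∞ := by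
  rw [← S.lintegral_cond_mul_lmarginal hp S.measurable_yAbs
    (S.dependsOn_y fun t ↦ ENNReal.ofReal |t|)]
  refine ne_top_of_le_ne_top h.1.ne (le_of_eq (lintegral_congr_ae ?_))
  filter_upwards [S.law_absolutelyContinuous.ae_le (S.ae_ofReal_propensity hp),
    S.law_absolutelyContinuous.ae_le (S.ae_lintegral_post_eq hp)] with x h1 h2
  rw [h1, h2]

theorem psi_eq_integral_intervLaw (hp : p ∈ S.nonparametricModel)
    (hfin : ∫⁻ x, S.yAbs x ∂S.intervLaw p ≠ ∞) :
    S.psi predecessors p = ∫ x, S.y x ∂S.intervLaw p + ∫ x, S.indA S.a₀ x * S.y x ∂S.law p := by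
  rw [psi]
  congr 1
  have hm := hp.1
  have hle : ∀ e : (∀ v, 𝓧 v) → ℝ≥0∞, (∀ x, e x ≤ S.yAbs x) → ∫⁻ x, e x ∂S.intervLaw p ≠ ∞ :=
    fun e he ↦ ne_top_of_le_ne_top hfin (lintegral_mono he)
  have hmC : Measurable fun x ↦ S.cond p (predecessors S.A) S.A (S.setA S.a₁ x) :=
    (S.measurable_cond hm _ _).comp (S.measurable_setA _)
  have hmE : ∀ e : (∀ v, 𝓧 v) → ℝ≥0∞, Measurable e → Measurable fun x ↦ e x * S.postDensity p x :=
    fun e he ↦ he.mul (S.measurable_postDensity hm)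
  have hmL : ∀ e : (∀ v, 𝓧 v) → ℝ≥0∞, Measurable e → Measurable fun x ↦
      S.cond p (predecessors S.A) S.A (S.setA S.a₁ x) *
        lmarginal S.ν S.post (fun x ↦ e x * S.postDensity p x) x :=
    fun e he ↦ hmC.mul ((hmE e he).lmarginal S.ν)
  have hP := S.lintegral_cond_mul_lmarginal hp S.measurable_yPos (S.dependsOn_y ENNReal.ofReal)
  have hN := S.lintegral_cond_mul_lmarginal hp S.measurable_yNeg
    (S.dependsOn_y fun t ↦ ENNReal.ofReal (-t))
  have hA := S.lintegral_cond_mul_lmarginal hp S.measurable_yAbs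
    (S.dependsOn_y fun t ↦ ENNReal.ofReal |t|)
  rw [(integral_eq_toReal_sub_toReal S.measurable_yPos.aemeasurable S.measurable_yNeg.aemeasurable
    (hle _ S.yPos_le) (hle _ S.yNeg_le) (ae_of_all _ fun x ↦ (S.toReal_yPos_sub x).symm)).2,
    ← hP, ← hN]
  refine (integral_eq_toReal_sub_toReal (hmL _ S.measurable_yPos).aemeasurable
    (hmL _ S.measurable_yNeg).aemeasurable (hP ▸ hle _ S.yPos_le) (hN ▸ hle _ S.yNeg_le) ?_).2
  have hfinA := ae_lt_top (hmL _ S.measurable_yAbs) (hA ▸ hfin)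
  filter_upwards [hfinA] with x hx
  simp only [ENNReal.toReal_mul, propensity, f, ← mul_sub]
  by_cases h0 : S.cond p (predecessors S.A) S.A (S.setA S.a₁ x) = 0
  · simp [h0]
  congr 1
  have hlt : lmarginal S.ν S.post (fun x ↦ S.yAbs x * S.postDensity p x) x ≠ ∞ := fun h ↦ by
    simp [h, h0] at hx
  have hle' : ∀ e : (∀ v, 𝓧 v) → ℝ≥0∞, (∀ x, e x ≤ S.yAbs x) →
      lmarginal S.ν S.post (fun x ↦ e x * S.postDensity p x) x ≠ ∞ := fun e he ↦
    ne_top_of_le_ne_top hlt (lmarginal_mono (fun x ↦ mul_le_mul_left (he x) _) x)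
  refine (integral_eq_toReal_sub_toReal
    ((hmE _ S.measurable_yPos).comp measurable_updateFinset).aemeasurable
    ((hmE _ S.measurable_yNeg).comp measurable_updateFinset).aemeasurable
    (hle' _ S.yPos_le) (hle' _ S.yNeg_le) ?_).2
  refine ae_of_all _ fun z ↦ ?_
  simp only [comp_apply, ENNReal.toReal_mul, postDensity, ENNReal.toReal_prod]
  rw [← S.toReal_yPos_sub]
  ring

end CausalSetup

/-! ### First-order expansion of the target parameter -/

/-- First-order expansion of `c ∏ a_k / b_k` at `c = a_k = b_k = 1`. -/
theorem exists_abs_mul_prod_div_sub_le {κ : Type*} (s : Finset κ) : ∃ C K : ℝ, 0 ≤ C ∧ 0 ≤ K ∧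
    ∀ ε : ℝ, 0 ≤ ε → ε ≤ 1 / 2 → ∀ (c : ℝ) (a b : κ → ℝ), |c - 1| ≤ ε →
      (∀ k ∈ s, |a k - 1| ≤ ε ∧ |b k - 1| ≤ ε) →
      |c * ∏ k ∈ s, a k / b k - 1| ≤ C * ε ∧
      |c * ∏ k ∈ s, a k / b k - c - ∑ k ∈ s, (a k - b k)| ≤ K * ε ^ 2 := by
  classical
  induction s using Finset.induction with
  | empty =>
    refine ⟨1, 0, zero_le_one, le_rfl, fun ε h0 _ c a b hc _ ↦ ?_⟩
    simpa using hc
  | insert k s hk ih =>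
    obtain ⟨C, K, hC, hK, ih⟩ := ih
    -- with `X` the product over `s` and `d = a k / b k - 1`, the new product is `X + d X`, where
    -- `|d| ≤ 4 ε` and `d X = (a k - b k) + d (X - b k)`
    refine ⟨C + 4 * (1 + C / 2), K + 4 * (C + 1), by positivity, by positivity,
      fun ε h0 h1 c a b hc hab ↦ ?_⟩
    obtain ⟨i1, i2⟩ := ih ε h0 h1 c a b hc fun j hj ↦ hab j (Finset.mem_insert_of_mem hj)
    obtain ⟨ha, hb⟩ := hab k (Finset.mem_insert_self _ _)
    rw [Finset.prod_insert hk, Finset.sum_insert hk]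
    set X := c * ∏ j ∈ s, a j / b j
    have hb0 : 1 / 2 ≤ b k := by rw [abs_le] at hb; linarith
    have hbpos : 0 < b k := by linarith
    have hab' : |a k - b k| ≤ 2 * ε := by
      rw [abs_le] at ha hb ⊢; constructor <;> linarith
    set d := (a k - b k) / b k with hd
    have hdle : |d| ≤ 4 * ε := by
      rw [hd, abs_div, abs_of_pos hbpos, div_le_iff₀ hbpos]
      nlinarith
    have hX : |X| ≤ 1 + C / 2 := by
      have : |X| ≤ |X - 1| + 1 := by simpa using abs_add_le (X - 1) 1
      nlinarith
    have hmul : c * (a k / b k * ∏ j ∈ s, a j / b j) = X + d * X := by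
      rw [hd]; simp only [X]; field_simp; ring
    rw [hmul]
    constructor
    · calc |X + d * X - 1| = |(X - 1) + d * X| := by ring_nf
        _ ≤ |X - 1| + |d| * |X| := by rw [← abs_mul]; exact abs_add_le _ _
        _ ≤ C * ε + 4 * ε * (1 + C / 2) := by gcongr
        _ = _ := by ring
    · have hXb : |X - b k| ≤ C * ε + ε := by
        calc |X - b k| = |(X - 1) - (b k - 1)| := by ring_nf
          _ ≤ |X - 1| + |b k - 1| := abs_sub _ _
          _ ≤ _ := by gcongr
      have hdb : d * b k = a k - b k := by rw [hd]; field_simp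
      calc |X + d * X - c - (a k - b k + ∑ j ∈ s, (a j - b j))|
          = |(X - c - ∑ j ∈ s, (a j - b j)) + d * (X - b k)| := by
            congr 1; rw [mul_sub, hdb]; ring
        _ ≤ |X - c - ∑ j ∈ s, (a j - b j)| + |d| * |X - b k| := by
            rw [← abs_mul]; exact abs_add_le _ _
        _ ≤ K * ε ^ 2 + 4 * ε * (C * ε + ε) := by gcongr
        _ = _ := by ring

namespace CausalSetup

open Function

variable {V : Type*} [Fintype V] [LinearOrder V] {𝓧 : V → Type*} [∀ v, MeasurableSpace (𝓧 v)]
variable (S : CausalSetup V 𝓧) {p q : (∀ v, 𝓧 v) → ℝ≥0∞}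

theorem isProbabilityMeasure_law (hp : p ∈ S.nonparametricModel) : IsProbabilityMeasure (S.law p) :=
  ⟨by rw [law, withDensity_apply _ MeasurableSet.univ, Measure.restrict_univ]; exact hp.2.1⟩

theorem IsClose.law_le {S : CausalSetup V 𝓧} {ε : ℝ} (hc : S.IsClose p q ε) (hp : Measurable p) :
    S.law q ≤ (2 : ℝ≥0∞) • S.law p := by
  have hε := hc.le_half
  rw [law, law, ← withDensity_smul _ hp]
  refine withDensity_mono ?_
  filter_upwards [hc.upper] with x hx
  refine hx.trans ?_
  simp only [Pi.smul_apply, smul_eq_mul]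
  gcongr
  exact ENNReal.ofReal_le_of_le_toReal (by norm_num; linarith)

theorem IsClose.integrable_law {S : CausalSetup V 𝓧} {ε : ℝ} (hc : S.IsClose p q ε)
    (hp : Measurable p) {g : (∀ v, 𝓧 v) → ℝ} (hg : Integrable g (S.law p)) :
    Integrable g (S.law q) :=
  (hg.smul_measure (c := 2) (by simp)).mono_measure (hc.law_le hp)

theorem integrable_y_intervLaw (hfin : ∫⁻ x, S.yAbs x ∂S.intervLaw p ≠ ∞) :
    Integrable S.y (S.intervLaw p) :=
  ⟨S.measurable_y.aestronglyMeasurable, by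
    rw [hasFiniteIntegral_iff_norm]; exact lt_top_iff_ne_top.2 hfin⟩

/-- The expectation, under a perturbed law `q`, of the influence function computed from `p`. -/
theorem integral_Phi (hfix : S.G.PrimalFixable S.A) {ε : ℝ} (hc : S.IsClose p q ε)
    (hp : p ∈ S.nonparametricModel) (hq : q ∈ S.nonparametricModel)
    (hfin : ∫⁻ x, S.yAbs x ∂S.intervLaw p ≠ ∞)
    (hint : Integrable (fun x ↦ S.indA S.a₀ x * S.y x) (S.law p)) :
    Integrable (S.Phi predecessors p) (S.law q) ∧
    Integrable (fun x ↦ (S.margRatio p q (upTo S.A) S.a₁ x).toReal * S.y x) (S.intervLaw p) ∧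
    (∀ v ∈ S.post, Integrable (fun x ↦ (S.margRatio p q (upTo v) (S.lvl v) x).toReal * S.y x
      - (S.margRatio p q (predecessors v) (S.lvl v) x).toReal * S.y x) (S.intervLaw p)) ∧
    ∫ x, S.Phi predecessors p x ∂S.law q =
      ∑ v ∈ S.post, ∫ x, ((S.margRatio p q (upTo v) (S.lvl v) x).toReal * S.y x
        - (S.margRatio p q (predecessors v) (S.lvl v) x).toReal * S.y x) ∂S.intervLaw p
      + ∫ x, (S.margRatio p q (upTo S.A) S.a₁ x).toReal * S.y x ∂S.intervLaw p
      + ∫ x, S.indA S.a₀ x * S.y x ∂S.law q - S.psi predecessors p := by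
  have := S.isProbabilityMeasure_law hq
  have hreg := S.ae_regularPoint hp
  have h1 : ∀ v ∈ S.post,
      Integrable (fun x ↦ S.indA (S.lvl v) x * S.R predecessors p v x * S.nextB predecessors p v x)
        (S.law q) ∧
      Integrable (fun x ↦ (S.margRatio p q (upTo v) (S.lvl v) x).toReal * S.y x)
        (S.intervLaw p) ∧
      ∫ x, S.indA (S.lvl v) x * S.R predecessors p v x * S.nextB predecessors p v x ∂S.law q =
        ∫ x, (S.margRatio p q (upTo v) (S.lvl v) x).toReal * S.y x ∂S.intervLaw p :=
      fun v hv ↦ by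
    have hAv : S.A < v := by simpa [post] using hv
    obtain ⟨u, hu, huv⟩ := S.exists_covBy_of_A_lt hAv
    exact S.integral_indA_mul_nextB hc hp hq.1 hfin hAv.le (a := S.lvl v)
      (S.measurable_R hp.1 v) (S.R_nonneg predecessors p v)
      ((S.dependsOn_R p hu huv).mono (by exact_mod_cast upTo_subset_upTo huv.1.le))
      (by filter_upwards [hreg] with x hx; rw [S.R_setA]; exact hx.marg_upTo_mul_R hAv)
  have h2 : ∀ v ∈ S.post,
      Integrable (fun x ↦ S.indA (S.lvl v) x * S.R predecessors p v x *
        S.B predecessors p v (S.lvl v) x) (S.law q) ∧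
      Integrable (fun x ↦ (S.margRatio p q (predecessors v) (S.lvl v) x).toReal * S.y x)
        (S.intervLaw p) ∧
      ∫ x, S.indA (S.lvl v) x * S.R predecessors p v x * S.B predecessors p v (S.lvl v) x ∂S.law q =
        ∫ x, (S.margRatio p q (predecessors v) (S.lvl v) x).toReal * S.y x ∂S.intervLaw p :=
      fun v hv ↦ by
    obtain ⟨u, hu, huv⟩ := S.exists_covBy_of_A_lt (v := v) (by simpa [post] using hv)
    rw [← S.nextB_covBy predecessors p huv, predecessors_eq_upTo huv]
    exact S.integral_indA_mul_nextB hc hp hq.1 hfin hu (a := S.lvl v)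
      (S.measurable_R hp.1 v) (S.R_nonneg predecessors p v) (S.dependsOn_R p hu huv)
      (by filter_upwards [hreg] with x hx; rw [S.R_setA]; exact hx.marg_mul_R hu huv)
  have h3 := S.integral_indA_mul_nextB hc hp hq.1 hfin le_rfl (a := S.a₁) (r := fun _ ↦ 1)
      measurable_const (fun _ ↦ zero_le_one) (fun _ _ _ ↦ rfl)
      (ae_of_all _ fun x ↦ by simp [S.interv_A])
  simp only [mul_one] at h3
  have h4 := hc.integrable_law hp.1 hint
  have hterm : ∀ v ∈ S.post, Integrable (fun x ↦
      S.indA (S.lvl v) x * S.R predecessors p v x * S.nextB predecessors p v x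
        - S.indA (S.lvl v) x * S.R predecessors p v x * S.B predecessors p v (S.lvl v) x)
      (S.law q) := fun v hv ↦ (h1 v hv).1.sub (h2 v hv).1
  have hsum : Integrable (fun x ↦ ∑ v ∈ S.post,
      (S.indA (S.lvl v) x * S.R predecessors p v x * S.nextB predecessors p v x
        - S.indA (S.lvl v) x * S.R predecessors p v x * S.B predecessors p v (S.lvl v) x))
      (S.law q) := integrable_finsetSum _ hterm
  have hsum3 : Integrable (fun x ↦ ∑ v ∈ S.post,
      (S.indA (S.lvl v) x * S.R predecessors p v x * S.nextB predecessors p v x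
        - S.indA (S.lvl v) x * S.R predecessors p v x * S.B predecessors p v (S.lvl v) x)
      + S.indA S.a₁ x * S.nextB predecessors p S.A x) (S.law q) := hsum.add h3.1
  have hsum4 : Integrable (fun x ↦ ∑ v ∈ S.post,
      (S.indA (S.lvl v) x * S.R predecessors p v x * S.nextB predecessors p v x
        - S.indA (S.lvl v) x * S.R predecessors p v x * S.B predecessors p v (S.lvl v) x)
      + S.indA S.a₁ x * S.nextB predecessors p S.A x + S.indA S.a₀ x * S.y x) (S.law q) :=
    hsum3.add h4
  refine ⟨?_, h3.2.1, fun v hv ↦ (h1 v hv).2.1.sub (h2 v hv).2.1, ?_⟩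
  · rw [funext (S.Phi_eq hfix predecessors p)]
    exact hsum4.sub (integrable_const _)
  · simp only [S.Phi_eq hfix predecessors p]
    rw [integral_sub hsum4 (integrable_const _), integral_add hsum3 h4, integral_add hsum h3.1,
      integral_finsetSum _ hterm, h3.2.2]
    simp only [integral_const, probReal_univ, one_smul]
    congr 3
    refine Finset.sum_congr rfl fun v hv ↦ ?_
    rw [integral_sub (h1 v hv).1 (h2 v hv).1, integral_sub (h1 v hv).2.1 (h2 v hv).2.1,
      (h1 v hv).2.2, (h2 v hv).2.2]

theorem IsClose.intervLaw_eq {S : CausalSetup V 𝓧} {ε : ℝ} (hc : S.IsClose p q ε)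
    (hp : p ∈ S.nonparametricModel) (hq : Measurable q) :
    S.intervLaw q =
      (S.intervLaw p).withDensity fun x ↦ ENNReal.ofReal (S.intervRatio p q x) := by
  rw [intervLaw, intervLaw, ← withDensity_mul _ (S.measurable_indE_mul_interv hp.1)
    (S.measurable_intervRatio hp.1 hq).ennreal_ofReal]
  refine withDensity_congr_ae ?_
  filter_upwards [hc.ae_interv_eq hp] with x hx
  simp only [Pi.mul_apply, hx, mul_assoc]

/-- The von Mises expansion: under a perturbation `q` of `p` of relative size `ε`, the mean of the
influence function computed from `p` equals the change of the target up to order `ε²`. -/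
theorem exists_abs_psi_sub_psi_sub_integral_Phi_le (hfix : S.G.PrimalFixable S.A)
    (hp : p ∈ S.nonparametricModel) (hfin : ∫⁻ x, S.yAbs x ∂S.intervLaw p ≠ ∞)
    (hint : Integrable (fun x ↦ S.indA S.a₀ x * S.y x) (S.law p)) :
    ∃ K : ℝ, ∀ (q : (∀ v, 𝓧 v) → ℝ≥0∞) (ε : ℝ), q ∈ S.nonparametricModel → S.IsClose p q ε →
      |S.psi predecessors q - S.psi predecessors p - ∫ x, S.Phi predecessors p x ∂S.law q|
        ≤ K * ε ^ 2 := by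
  obtain ⟨C, K, hC, hK, hCK⟩ := exists_abs_mul_prod_div_sub_le S.post
  refine ⟨K * ∫ x, |S.y x| ∂S.intervLaw p, fun q ε hq hc ↦ ?_⟩
  have hε := hc.nonneg
  have hε' := hc.le_half
  obtain ⟨-, hWA, hWv, hPhi⟩ := S.integral_Phi hfix hc hp hq hfin hint
  have hbound : ∀ᵐ x ∂S.intervLaw p, |S.intervRatio p q x - 1| ≤ C * ε ∧
      |S.intervRatio p q x - (S.margRatio p q (upTo S.A) S.a₁ x).toReal -
        ∑ v ∈ S.post, ((S.margRatio p q (upTo v) (S.lvl v) x).toReal -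
          (S.margRatio p q (predecessors v) (S.lvl v) x).toReal)| ≤ K * ε ^ 2 := by
    rw [S.ae_intervLaw_iff hp.1]
    filter_upwards [hc.ae_abs_margRatio_sub_one_le hp] with x hx h0
    obtain ⟨hA, hv⟩ := hx (mul_ne_zero_iff.1 h0).2
    exact hCK ε hε hε' _ (fun v ↦ (S.margRatio p q (upTo v) (S.lvl v) x).toReal)
      (fun v ↦ (S.margRatio p q (predecessors v) (S.lvl v) x).toReal) hA hv
  have hy := S.integrable_y_intervLaw hfin
  have hmr := S.measurable_intervRatio hp.1 hq.1
  have hry : Integrable (fun x ↦ S.intervRatio p q x * S.y x) (S.intervLaw p) := by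
    refine hy.bdd_mul (c := 1 + C * ε) hmr.aestronglyMeasurable ?_
    filter_upwards [hbound] with x hx
    have := abs_le.1 hx.1
    rw [Real.norm_of_nonneg (S.intervRatio_nonneg p q x)]
    linarith
  have hfinq : ∫⁻ x, S.yAbs x ∂S.intervLaw q ≠ ∞ := by
    rw [hc.intervLaw_eq hp hq.1,
      lintegral_withDensity_eq_lintegral_mul _ hmr.ennreal_ofReal S.measurable_yAbs]
    refine ne_top_of_le_ne_top hry.2.ne (lintegral_mono fun x ↦ ?_)
    rw [← ofReal_norm, norm_mul, Real.norm_of_nonneg (S.intervRatio_nonneg p q x),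
      ENNReal.ofReal_mul (S.intervRatio_nonneg p q x)]
    exact le_rfl
  have hyq : ∫ x, S.y x ∂S.intervLaw q = ∫ x, S.intervRatio p q x * S.y x ∂S.intervLaw p := by
    rw [hc.intervLaw_eq hp hq.1, integral_withDensity_eq_integral_toReal_smul hmr.ennreal_ofReal
      (ae_of_all _ fun _ ↦ ENNReal.ofReal_lt_top)]
    simp only [ENNReal.toReal_ofReal (S.intervRatio_nonneg p q _), smul_eq_mul]
  have hdiff : S.psi predecessors q - S.psi predecessors p - ∫ x, S.Phi predecessors p x ∂S.law q =
      ∫ x, (S.intervRatio p q x - (S.margRatio p q (upTo S.A) S.a₁ x).toReal -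
        ∑ v ∈ S.post, ((S.margRatio p q (upTo v) (S.lvl v) x).toReal -
          (S.margRatio p q (predecessors v) (S.lvl v) x).toReal)) * S.y x ∂S.intervLaw p := by
    have hrW : Integrable (fun x ↦ S.intervRatio p q x * S.y x -
        (S.margRatio p q (upTo S.A) S.a₁ x).toReal * S.y x) (S.intervLaw p) := hry.sub hWA
    simp only [sub_mul, Finset.sum_mul]
    rw [integral_sub hrW (integrable_finsetSum _ hWv), integral_sub hry hWA,
      integral_finsetSum _ hWv, hPhi, S.psi_eq_integral_intervLaw hq hfinq, hyq]
    ring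
  rw [hdiff, mul_right_comm, ← integral_const_mul]
  rw [← Real.norm_eq_abs]
  refine norm_integral_le_of_norm_le (hy.abs.const_mul _) ?_
  filter_upwards [hbound] with x hx
  rw [norm_mul]
  exact mul_le_mul_of_nonneg_right hx.2 (norm_nonneg _)

end CausalSetup

/-! ### Derivatives along regular submodels -/

/-- The Cauchy-Schwarz inequality in terms of `eLpNorm`. -/
theorem MeasureTheory.enorm_integral_mul_le {α : Type*} [MeasurableSpace α] {μ : Measure α}
    {f g : α → ℝ} (hf : AEStronglyMeasurable f μ) (hg : AEStronglyMeasurable g μ) :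
    ‖∫ x, f x * g x ∂μ‖ₑ ≤ eLpNorm f 2 μ * eLpNorm g 2 μ := by
  refine (enorm_integral_le_lintegral_enorm _).trans ?_
  rw [← eLpNorm_one_eq_lintegral_enorm]
  exact eLpNorm_smul_le_mul_eLpNorm (f := g) (φ := f) (p := 2) (q := 2) (r := 1) hg hf

namespace CausalSetup

open Function

theorem measurable_likRatio {V : Type*} {𝓧 : V → Type*} [∀ v, MeasurableSpace (𝓧 v)]
    {p q : (∀ v, 𝓧 v) → ℝ≥0∞} (hp : Measurable p) (hq : Measurable q) :
    Measurable (likRatio p q) := (hq.div hp).ennreal_toReal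

theorem likRatio_nonneg {V : Type*} {𝓧 : V → Type*} (p q : (∀ v, 𝓧 v) → ℝ≥0∞)
    (x : ∀ v, 𝓧 v) : 0 ≤ likRatio p q x :=
  ENNReal.toReal_nonneg

variable {V : Type*} [Fintype V] [LinearOrder V] {𝓧 : V → Type*} [∀ v, MeasurableSpace (𝓧 v)]
variable (S : CausalSetup V 𝓧) {p q : (∀ v, 𝓧 v) → ℝ≥0∞}

theorem ae_lt_top_of_mem (hp : p ∈ S.nonparametricModel) : ∀ᵐ x ∂S.base, p x < ∞ :=
  ae_lt_top hp.1 (by simp [hp.2.1])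

/-- A Lipschitz bound on the likelihood ratio, with domination, bounds the density `q` by multiples
of `p` almost everywhere for the reference measure, also off the support of `p`. -/
theorem isClose_of_likRatio (hp : p ∈ S.nonparametricModel) (hq : q ∈ S.nonparametricModel)
    (hac : S.law q ≪ S.law p) {ε : ℝ} (h0 : 0 ≤ ε) (h1 : ε ≤ 1 / 2)
    (h : ∀ᵐ x ∂S.law p, |likRatio p q x - 1| ≤ ε) : S.IsClose p q ε := by
  have hne : ∀ᵐ x ∂S.base, q x ≠ 0 → p x ≠ 0 :=
    (S.ae_law_iff hq.1).1 (hac.ae_le (S.ae_law_ne_zero hp.1))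
  have hb := (S.ae_law_iff hp.1).1 h
  have key : ∀ᵐ x ∂S.base, ENNReal.ofReal (1 - ε) * p x ≤ q x ∧
      q x ≤ ENNReal.ofReal (1 + ε) * p x := by
    filter_upwards [hne, hb, S.ae_lt_top_of_mem hp, S.ae_lt_top_of_mem hq] with x hx hbx hpx hqx
    by_cases hp0 : p x = 0
    · have : q x = 0 := by_contra fun h ↦ hx h hp0
      simp [hp0, this]
    · have htop : q x / p x ≠ ∞ := ENNReal.div_ne_top hqx.ne hp0
      have := abs_le.1 (hbx hp0)
      rw [likRatio] at this
      rw [← ENNReal.le_div_iff_mul_le (.inl hp0) (.inl hpx.ne),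
        ← ENNReal.div_le_iff_le_mul (.inl hp0) (.inl hpx.ne),
        ENNReal.ofReal_le_iff_le_toReal htop, ← ENNReal.ofReal_toReal htop,
        ENNReal.toReal_ofReal ENNReal.toReal_nonneg]
      exact ⟨by linarith, ENNReal.ofReal_le_ofReal (by linarith)⟩
  exact ⟨h0, h1, key.mono fun _ h ↦ h.1, key.mono fun _ h ↦ h.2⟩

theorem IsClose.integral_law {S : CausalSetup V 𝓧} {ε : ℝ} (hc : S.IsClose p q ε)
    (hp : p ∈ S.nonparametricModel) (hq : q ∈ S.nonparametricModel) (g : (∀ v, 𝓧 v) → ℝ) :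
    ∫ x, g x ∂S.law q = ∫ x, likRatio p q x * g x ∂S.law p := by
  have hm : Measurable fun x ↦ q x / p x := hq.1.div hp.1
  have h : S.law q = (S.law p).withDensity fun x ↦ q x / p x := by
    rw [law, law, ← withDensity_mul _ hp.1 hm]
    refine withDensity_congr_ae ?_
    filter_upwards [hc.upper, S.ae_lt_top_of_mem hp] with x hx hpx
    by_cases hp0 : p x = 0
    · simp only [hp0, mul_zero, nonpos_iff_eq_zero] at hx
      simp [hp0, hx]
    · exact (ENNReal.mul_div_cancel hp0 hpx.ne).symm
  rw [h, integral_withDensity_eq_integral_toReal_smul hm]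
  · rfl
  · filter_upwards [S.ae_law_ne_zero hp.1,
      S.law_absolutelyContinuous.ae_le (S.ae_lt_top_of_mem hq)] with x hx hqx
    exact (ENNReal.div_ne_top hqx.ne hx).lt_top

section Derivative

variable (hfix : S.G.PrimalFixable S.A) (hp : p ∈ S.nonparametricModel)
  (hfin : ∫⁻ x, S.yAbs x ∂S.intervLaw p ≠ ∞)
  (hint : Integrable (fun x ↦ S.indA S.a₀ x * S.y x) (S.law p))
include hfix hp hfin hint

theorem integrable_Phi : Integrable (S.Phi predecessors p) (S.law p) :=
  (S.integral_Phi hfix (IsClose.refl S p) hp hp hfin hint).1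

theorem integral_Phi_eq_zero : ∫ x, S.Phi predecessors p x ∂S.law p = 0 := by
  obtain ⟨K, hK⟩ := S.exists_abs_psi_sub_psi_sub_integral_Phi_le hfix hp hfin hint
  simpa using hK p 0 hp (IsClose.refl S p)

/-- By the von Mises expansion, the target is differentiable along a path as soon as the linear
functional given by the influence function is. -/
theorem hasDerivAt_psi {γ : ℝ → (∀ v, 𝓧 v) → ℝ≥0∞} (h0 : γ 0 = p) {C : ℝ}
    (hγ : ∀ᶠ t in 𝓝[≠] (0 : ℝ), γ t ∈ S.nonparametricModel ∧ S.IsClose p (γ t) (C * |t|)) {D : ℝ}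
    (hD : Tendsto (fun t ↦ ∫ x, S.Phi predecessors p x * ((likRatio p (γ t) x - 1) / t) ∂S.law p)
      (𝓝[≠] 0) (𝓝 D)) :
    HasDerivAt (fun t ↦ S.psi predecessors (γ t)) D 0 := by
  obtain ⟨K, hK⟩ := S.exists_abs_psi_sub_psi_sub_integral_Phi_le hfix hp hfin hint
  have hPhi := S.integrable_Phi hfix hp hfin hint
  have hzero := S.integral_Phi_eq_zero hfix hp hfin hint
  rw [hasDerivAt_iff_tendsto_slope]
  have hsmall : Tendsto (fun t : ℝ ↦ K * C ^ 2 * |t|) (𝓝[≠] 0) (𝓝 0) := by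
    have : Tendsto (fun t : ℝ ↦ K * C ^ 2 * |t|) (𝓝 0) (𝓝 (K * C ^ 2 * |0|)) :=
      (continuous_const.mul continuous_abs).tendsto 0
    simpa using this.mono_left nhdsWithin_le_nhds
  refine hD.congr_dist (squeeze_zero' (Eventually.of_forall fun _ ↦ dist_nonneg) ?_ hsmall)
  filter_upwards [hγ, self_mem_nhdsWithin] with t ⟨ht, hc⟩ ht0
  have ht0 : t ≠ 0 := ht0
  have hrPhi : Integrable (fun x ↦ likRatio p (γ t) x * S.Phi predecessors p x) (S.law p) := by
    have := S.isProbabilityMeasure_law hp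
    have hb : ∀ᵐ x ∂S.law p, ‖likRatio p (γ t) x‖ ≤ 2 := by
      rw [S.ae_law_iff hp.1]
      filter_upwards [hc.upper, S.ae_lt_top_of_mem hp] with x hx hpx hp0
      rw [Real.norm_of_nonneg (likRatio_nonneg _ _ _), likRatio]
      refine ENNReal.toReal_le_of_le_ofReal zero_le_two ?_
      rw [ENNReal.div_le_iff_le_mul (.inl hp0) (.inl hpx.ne)]
      refine hx.trans ?_
      gcongr
      have := hc.le_half
      linarith
    exact hPhi.bdd_mul (measurable_likRatio hp.1 ht.1).aestronglyMeasurable hb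
  have hlin : ∫ x, S.Phi predecessors p x * ((likRatio p (γ t) x - 1) / t) ∂S.law p =
      t⁻¹ * ∫ x, S.Phi predecessors p x ∂S.law (γ t) := by
    rw [hc.integral_law hp ht, ← sub_zero (∫ x, likRatio p (γ t) x * _ ∂_), ← hzero,
      ← integral_sub hrPhi hPhi, ← integral_const_mul]
    refine integral_congr_ae (ae_of_all _ fun x ↦ ?_)
    simp only
    ring
  rw [Real.dist_eq, hlin, slope_def_field, h0, sub_zero, abs_sub_comm]
  have hb := hK (γ t) _ ht hc
  have : (S.psi predecessors (γ t) - S.psi predecessors p) / t -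
      t⁻¹ * ∫ x, S.Phi predecessors p x ∂S.law (γ t) =
      (S.psi predecessors (γ t) - S.psi predecessors p -
        ∫ x, S.Phi predecessors p x ∂S.law (γ t)) / t := by
    field_simp
  rw [this, abs_div, div_le_iff₀ (abs_pos.2 ht0)]
  refine hb.trans (le_of_eq ?_)
  rw [mul_pow]
  ring

/-- Along a regular submodel, the derivative of the target is the inner product of the influence
function with the score. -/
theorem isGradient_Phi (hL2 : MemLp (S.Phi predecessors p) 2 (S.law p)) :
    S.IsGradient S.nonparametricModel (S.psi predecessors) p (S.Phi predecessors p) := by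
  have := S.isProbabilityMeasure_law hp
  refine ⟨hL2, S.integral_Phi_eq_zero hfix hp hfin hint, fun γ s hγ ↦ ?_⟩
  obtain ⟨C₀, hC₀⟩ := hγ.lipschitz
  set C := max C₀ 0
  have hC0 : 0 ≤ C := le_max_right _ _
  have hCt : ∀ᶠ t in 𝓝 (0 : ℝ), C * |t| ≤ 1 / 2 := by
    have : Tendsto (fun t : ℝ ↦ C * |t|) (𝓝 0) (𝓝 (C * |0|)) :=
      (continuous_const.mul continuous_abs).tendsto 0
    rw [abs_zero, mul_zero] at this
    exact this.eventually_le_const (by norm_num)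
  have hlip : ∀ᶠ t in 𝓝 (0 : ℝ), ∀ᵐ x ∂S.law p, |likRatio p (γ t) x - 1| ≤ C * |t| :=
    hC₀.mono fun t ht ↦ ht.mono fun x hx ↦
      hx.trans (mul_le_mul_of_nonneg_right (le_max_left _ _) (abs_nonneg _))
  have hgood : ∀ᶠ t in 𝓝 (0 : ℝ), γ t ∈ S.nonparametricModel ∧ S.IsClose p (γ t) (C * |t|) := by
    filter_upwards [hγ.mem, hγ.ac, hlip, hCt] with t h1 h2 h3 h4
    exact ⟨h1, S.isClose_of_likRatio hp h1 h2 (by positivity) h4 h3⟩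
  -- the root density differences are bounded by the density differences
  have hroot : ∀ r : ℝ, 0 ≤ r → |√r - 1| ≤ |r - 1| := fun r hr ↦ by
    have h1 : r - 1 = (√r - 1) * (√r + 1) := by
      nlinarith [Real.mul_self_sqrt hr]
    rw [h1, abs_mul]
    refine le_mul_of_one_le_right (abs_nonneg _) ?_
    rw [abs_of_nonneg (by positivity)]
    linarith [Real.sqrt_nonneg r]
  set u : ℝ → (∀ v, 𝓧 v) → ℝ := fun t x ↦ (√(likRatio p (γ t) x) - 1) / t - s x / 2 with hu
  have hmeas : ∀ t, γ t ∈ S.nonparametricModel → Measurable (u t) := fun t ht ↦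
    (((measurable_likRatio hp.1 ht.1).sqrt.sub_const 1).div_const t).sub
      (hγ.measurable_score.div_const 2)
  -- the score is square integrable
  have hs : MemLp s 2 (S.law p) := by
    have h1 : ∀ᶠ t in 𝓝[≠] (0 : ℝ), eLpNorm (u t) 2 (S.law p) < 1 :=
      hγ.qmd.eventually_lt_const zero_lt_one
    obtain ⟨t, ht1, ⟨ht2, ht3⟩, ht4⟩ := (h1.and (((hgood.and hlip).filter_mono
      nhdsWithin_le_nhds).and self_mem_nhdsWithin)).exists
    have ht4 : t ≠ 0 := ht4
    have hu2 : MemLp (u t) 2 (S.law p) :=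
      ⟨(hmeas t ht2.1).aestronglyMeasurable, ht1.trans ENNReal.one_lt_top⟩
    have hb : MemLp (fun x ↦ (√(likRatio p (γ t) x) - 1) / t) 2 (S.law p) := by
      refine MemLp.of_bound (((measurable_likRatio hp.1 ht2.1.1).sqrt.sub_const
        1).div_const t).aestronglyMeasurable C (ht3.mono fun x hx ↦ ?_)
      rw [Real.norm_eq_abs, abs_div, div_le_iff₀ (abs_pos.2 ht4)]
      exact (hroot _ (likRatio_nonneg _ _ _)).trans hx
    have := (hb.sub hu2).const_mul 2
    refine this.ae_eq (ae_of_all _ fun x ↦ ?_)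
    simp only [hu, Pi.sub_apply]
    ring
  refine S.hasDerivAt_psi hfix hp hfin hint hγ.at_zero (hgood.filter_mono nhdsWithin_le_nhds) ?_
  have hlim : Tendsto (fun t ↦ eLpNorm (S.Phi predecessors p) 2 (S.law p) *
      (3 * eLpNorm (u t) 2 (S.law p) + ENNReal.ofReal (C * |t|) * eLpNorm s 2 (S.law p)))
      (𝓝[≠] 0) (𝓝 0) := by
    have h2 : Tendsto (fun t : ℝ ↦ ENNReal.ofReal (C * |t|)) (𝓝[≠] 0) (𝓝 0) := by
      have : Tendsto (fun t : ℝ ↦ ENNReal.ofReal (C * |t|)) (𝓝 0) (𝓝 (ENNReal.ofReal (C * |0|))) :=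
        (ENNReal.continuous_ofReal.comp (continuous_const.mul continuous_abs)).tendsto 0
      rw [abs_zero, mul_zero, ENNReal.ofReal_zero] at this
      exact this.mono_left nhdsWithin_le_nhds
    have h3 := (ENNReal.Tendsto.const_mul (a := 3) hγ.qmd (.inr (by simp))).add
      (ENNReal.Tendsto.mul_const h2 (b := eLpNorm s 2 (S.law p)) (.inr hs.2.ne))
    rw [mul_zero, zero_mul, add_zero] at h3
    have h4 := ENNReal.Tendsto.const_mul (a := eLpNorm (S.Phi predecessors p) 2 (S.law p)) h3
      (.inr hL2.2.ne)
    rwa [mul_zero] at h4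
  rw [tendsto_iff_edist_tendsto_0]
  refine tendsto_of_tendsto_of_tendsto_of_le_of_le' tendsto_const_nhds hlim
    (Eventually.of_forall fun _ ↦ bot_le) ?_
  filter_upwards [hgood.filter_mono nhdsWithin_le_nhds, hlip.filter_mono nhdsWithin_le_nhds,
    self_mem_nhdsWithin] with t ⟨ht, hc⟩ hl ht0
  have ht0 : t ≠ 0 := ht0
  have hmr := measurable_likRatio hp.1 ht.1
  have hhalf := hc.le_half
  have hd : MemLp (fun x ↦ (likRatio p (γ t) x - 1) / t) 2 (S.law p) := by
    refine MemLp.of_bound ((hmr.sub_const 1).div_const t).aestronglyMeasurable C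
      (hl.mono fun x hx ↦ ?_)
    rwa [Real.norm_eq_abs, abs_div, div_le_iff₀ (abs_pos.2 ht0)]
  have hPd : Integrable (fun x ↦ S.Phi predecessors p x * ((likRatio p (γ t) x - 1) / t))
      (S.law p) := hL2.integrable_mul hd
  have hPs : Integrable (fun x ↦ S.Phi predecessors p x * s x) (S.law p) := hL2.integrable_mul hs
  rw [edist_eq_enorm_sub, ← integral_sub hPd hPs]
  simp only [← mul_sub]
  refine (enorm_integral_mul_le hL2.1 (hd.sub hs).1).trans ?_
  gcongr
  have hbound : ∀ᵐ x ∂S.law p, ‖(likRatio p (γ t) x - 1) / t - s x‖ ≤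
      ‖3 * |u t x| + C * |t| * |s x|‖ := by
    filter_upwards [hl] with x hx
    set r := likRatio p (γ t) x with hr
    have hr0 : 0 ≤ r := likRatio_nonneg _ _ _
    have h1 : |√r - 1| ≤ C * |t| := (hroot r hr0).trans hx
    have h2 : (r - 1) / t - s x = u t x * (√r + 1) + s x / 2 * (√r - 1) := by
      have : r = √r * √r := (Real.mul_self_sqrt hr0).symm
      simp only [hu, ← hr]
      field_simp
      nlinarith
    have h3 : |√r + 1| ≤ 3 := by
      rw [abs_of_nonneg (by positivity)]
      linarith [(abs_le.1 h1).2]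
    rw [Real.norm_eq_abs, Real.norm_of_nonneg (by positivity), h2]
    calc |u t x * (√r + 1) + s x / 2 * (√r - 1)|
        ≤ |u t x| * |√r + 1| + |s x / 2| * |√r - 1| := by
          rw [← abs_mul, ← abs_mul]; exact abs_add_le _ _
      _ ≤ |u t x| * 3 + |s x / 2| * (C * |t|) := by gcongr
      _ ≤ 3 * |u t x| + C * |t| * |s x| := by
          rw [abs_div, abs_two]
          have : 0 ≤ |s x| * (C * |t|) := by positivity
          linarith
  have hu1 : AEStronglyMeasurable (fun x ↦ 3 * |u t x|) (S.law p) :=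
    ((hmeas t ht).abs.const_mul 3).aestronglyMeasurable
  have hs1 : AEStronglyMeasurable (fun x ↦ C * |t| * |s x|) (S.law p) :=
    (hγ.measurable_score.abs.const_mul _).aestronglyMeasurable
  refine (eLpNorm_mono_ae hbound).trans ((eLpNorm_add_le hu1 hs1 one_le_two).trans ?_)
  refine le_of_eq ?_
  congr 1
  · refine (eLpNorm_const_smul (3 : ℝ) (fun x ↦ |u t x|) 2 (S.law p)).trans ?_
    congr 1
    · simp [enorm_eq_nnnorm]
    · exact eLpNorm_norm (u t)
  · refine (eLpNorm_const_smul (C * |t|) (fun x ↦ |s x|) 2 (S.law p)).trans ?_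
    congr 1
    · exact Real.enorm_of_nonneg (by positivity)
    · exact eLpNorm_norm s

end Derivative

end CausalSetup

/-! ### Bounded scores and the tangent space -/

theorem Real.abs_sqrt_one_add_sub_le {w : ℝ} (hw : |w| ≤ 1 / 2) :
    |√(1 + w) - 1 - w / 2| ≤ w ^ 2 := by
  have h0 : 0 ≤ 1 + w := by linarith [(abs_le.1 hw).1]
  set r := √(1 + w)
  have hr : r * r = 1 + w := Real.mul_self_sqrt h0
  have hr0 : 0 ≤ r := Real.sqrt_nonneg _
  have h1 : w = (r - 1) * (r + 1) := by linarith
  have h2 : r - 1 - w / 2 = -((r - 1) ^ 2 / 2) := by rw [h1]; ring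
  rw [h2, abs_neg, abs_of_nonneg (by positivity), h1, mul_pow]
  nlinarith [sq_nonneg (r - 1), mul_nonneg (sq_nonneg (r - 1)) hr0,
    mul_nonneg (sq_nonneg (r - 1)) (mul_nonneg hr0 hr0)]

namespace CausalSetup

open Function

variable {V : Type*} [Fintype V] [LinearOrder V] {𝓧 : V → Type*} [∀ v, MeasurableSpace (𝓧 v)]
variable (S : CausalSetup V 𝓧) {p q : (∀ v, 𝓧 v) → ℝ≥0∞}

/-- The path `(1 + t s) p` through `p`. -/
noncomputable def linearPath (p : (∀ v, 𝓧 v) → ℝ≥0∞) (s : (∀ v, 𝓧 v) → ℝ) (t : ℝ)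
    (x : ∀ v, 𝓧 v) : ℝ≥0∞ := p x * ENNReal.ofReal (1 + t * s x)

theorem ae_likRatio_linearPath (hp : p ∈ S.nonparametricModel) (s : (∀ v, 𝓧 v) → ℝ) (t : ℝ) :
    ∀ᵐ x ∂S.law p, likRatio p (linearPath p s t) x = max (1 + t * s x) 0 := by
  filter_upwards [S.ae_law_ne_zero hp.1,
    S.law_absolutelyContinuous.ae_le (S.ae_lt_top_of_mem hp)] with x h0 htop
  rw [likRatio, linearPath, mul_comm, ENNReal.mul_div_cancel_right h0 htop.ne,
    ENNReal.toReal_ofReal']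

section LinearPath

variable {s : (∀ v, 𝓧 v) → ℝ} (hp : p ∈ S.nonparametricModel) (hs : Measurable s)
include hp hs

theorem law_linearPath (t : ℝ) :
    S.law (linearPath p s t) = (S.law p).withDensity fun x ↦ ENNReal.ofReal (1 + t * s x) :=
  withDensity_mul _ hp.1 ((hs.const_mul t).const_add 1).ennreal_ofReal

theorem linearPath_mem {t M : ℝ} (hM : ∀ x, |s x| ≤ M) (h0 : ∫ x, s x ∂S.law p = 0)
    (ht : |t| * M ≤ 1 / 2) : linearPath p s t ∈ S.nonparametricModel := by
  have := S.isProbabilityMeasure_law hp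
  have hts : ∀ x, |t * s x| ≤ 1 / 2 := fun x ↦ by
    rw [abs_mul]
    exact (mul_le_mul_of_nonneg_left (hM x) (abs_nonneg t)).trans ht
  have hm : Measurable (linearPath p s t) :=
    hp.1.mul ((hs.const_mul t).const_add 1).ennreal_ofReal
  have hsi : Integrable s (S.law p) :=
    Integrable.of_bound hs.aestronglyMeasurable M (ae_of_all _ hM)
  have hi : Integrable (fun x ↦ 1 + t * s x) (S.law p) := (integrable_const 1).add (hsi.const_mul t)
  refine ⟨hm, ?_, ?_⟩
  · have h1 : ∫⁻ x, linearPath p s t x ∂S.base = S.law (linearPath p s t) Set.univ := by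
      rw [law, withDensity_apply _ MeasurableSet.univ, Measure.restrict_univ]
    rw [h1, S.law_linearPath hp hs, withDensity_apply _ MeasurableSet.univ, Measure.restrict_univ,
      ← ofReal_integral_eq_lintegral_ofReal hi (ae_of_all _ fun x ↦ ?_)]
    · rw [integral_add (integrable_const 1) (hsi.const_mul t), integral_const_mul, h0]
      simp
    · change 0 ≤ 1 + t * s x
      linarith [(abs_le.1 (hts x)).1]
  · have hac : S.law (linearPath p s t) ≪ S.law p := by
      rw [S.law_linearPath hp hs]
      exact withDensity_absolutelyContinuous _ _
    have hle : ∀ T x, ENNReal.ofReal (1 / 2) * S.marg p T x ≤ S.marg (linearPath p s t) T x :=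
        fun T x ↦ by
      rw [marg, ← lmarginal_const_mul_of_dependsOn (s := ∅) (g := fun _ ↦ ENNReal.ofReal (1 / 2))
        (fun _ _ _ ↦ rfl) (by simp) hp.1]
      refine lmarginal_mono (fun x ↦ ?_) x
      rw [linearPath, mul_comm]
      gcongr
      linarith [(abs_le.1 (hts x)).1]
    filter_upwards [hac.ae_le hp.2.2] with x hx a h
    have := hle (Finset.univ.erase S.Y) (S.setA a x)
    rw [h, nonpos_iff_eq_zero, mul_eq_zero] at this
    exact this.elim (by simp) (hx a)

/-- Every bounded function of mean zero is the score of a regular submodel of the nonparametric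
model. -/
theorem isRegularPath_linearPath {M : ℝ} (hM : ∀ x, |s x| ≤ M) (h0 : ∫ x, s x ∂S.law p = 0) :
    S.IsRegularPath S.nonparametricModel p (linearPath p s) s := by
  have := S.isProbabilityMeasure_law hp
  obtain ⟨x₀⟩ : Nonempty (∀ v, 𝓧 v) := (S.law p).nonempty_of_neZero
  have hM0 : 0 ≤ M := (abs_nonneg _).trans (hM x₀)
  have hsmall : ∀ᶠ t in 𝓝 (0 : ℝ), |t| * M ≤ 1 / 2 := by
    have : Tendsto (fun t : ℝ ↦ |t| * M) (𝓝 0) (𝓝 (|0| * M)) :=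
      (continuous_abs.mul continuous_const).tendsto 0
    rw [abs_zero, zero_mul] at this
    exact this.eventually_le_const (by norm_num)
  have hts : ∀ t, |t| * M ≤ 1 / 2 → ∀ x, |t * s x| ≤ 1 / 2 := fun t ht x ↦ by
    rw [abs_mul]
    exact (mul_le_mul_of_nonneg_left (hM x) (abs_nonneg t)).trans ht
  have hlik : ∀ t, |t| * M ≤ 1 / 2 →
      ∀ᵐ x ∂S.law p, likRatio p (linearPath p s t) x = 1 + t * s x := fun t ht ↦ by
    filter_upwards [S.ae_likRatio_linearPath hp s t] with x hx
    rw [hx, max_eq_left]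
    linarith [(abs_le.1 (hts t ht x)).1]
  refine ⟨?_, ?_, ?_, ⟨M, ?_⟩, hs, ?_⟩
  · funext x; simp [linearPath]
  · exact hsmall.mono fun t ht ↦ S.linearPath_mem hp hs hM h0 ht
  · refine Eventually.of_forall fun t ↦ ?_
    rw [S.law_linearPath hp hs]
    exact withDensity_absolutelyContinuous _ _
  · filter_upwards [hsmall] with t ht
    filter_upwards [hlik t ht] with x hx
    rw [hx, add_sub_cancel_left, abs_mul, mul_comm]
    exact mul_le_mul_of_nonneg_right (hM x) (abs_nonneg t)
  · have hlim : Tendsto (fun t : ℝ ↦ ENNReal.ofReal (|t| * M ^ 2)) (𝓝[≠] 0) (𝓝 0) := by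
      have : Tendsto (fun t : ℝ ↦ ENNReal.ofReal (|t| * M ^ 2)) (𝓝 0)
          (𝓝 (ENNReal.ofReal (|0| * M ^ 2))) :=
        (ENNReal.continuous_ofReal.comp (continuous_abs.mul continuous_const)).tendsto 0
      rw [abs_zero, zero_mul, ENNReal.ofReal_zero] at this
      exact this.mono_left nhdsWithin_le_nhds
    refine tendsto_of_tendsto_of_tendsto_of_le_of_le' tendsto_const_nhds hlim
      (Eventually.of_forall fun _ ↦ bot_le) ?_
    filter_upwards [hsmall.filter_mono nhdsWithin_le_nhds, self_mem_nhdsWithin] with t ht ht0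
    have ht0 : t ≠ 0 := ht0
    have hb : ∀ᵐ x ∂S.law p,
        ‖(√(likRatio p (linearPath p s t) x) - 1) / t - s x / 2‖ ≤ |t| * M ^ 2 := by
      filter_upwards [hlik t ht] with x hx
      have h1 := Real.abs_sqrt_one_add_sub_le (hts t ht x)
      have h2 : (√(1 + t * s x) - 1) / t - s x / 2 = (√(1 + t * s x) - 1 - t * s x / 2) / t := by
        field_simp
      rw [hx, Real.norm_eq_abs, h2, abs_div, div_le_iff₀ (abs_pos.2 ht0)]
      refine h1.trans ?_
      have h3 : s x ^ 2 ≤ M ^ 2 := sq_le_sq' (by linarith [(abs_le.1 (hM x)).1]) (abs_le.1 (hM x)).2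
      have h4 : |t| * |t| = t ^ 2 := by rw [← sq, sq_abs]
      nlinarith [sq_nonneg t]
    refine (eLpNorm_le_of_ae_bound hb).trans ?_
    simp

end LinearPath

section Efficiency

variable (hfix : S.G.PrimalFixable S.A) (hp : p ∈ S.nonparametricModel)
  (hfin : ∫⁻ x, S.yAbs x ∂S.intervLaw p ≠ ∞)
  (hint : Integrable (fun x ↦ S.indA S.a₀ x * S.y x) (S.law p))
include hfix hp hfin hint

/-- In the nonparametric model the influence function is unique: bounded scores separate
integrable functions of mean zero. -/
theorem IsGradient.ae_eq_Phi {φ : (∀ v, 𝓧 v) → ℝ}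
    (hφ : S.IsGradient S.nonparametricModel (S.psi predecessors) p φ) :
    φ =ᵐ[S.law p] S.Phi predecessors p := by
  have := S.isProbabilityMeasure_law hp
  have hPhi := S.integrable_Phi hfix hp hfin hint
  have hPhi0 := S.integral_Phi_eq_zero hfix hp hfin hint
  obtain ⟨hφ2, hφ0, hφd⟩ := hφ
  have hφ1 : Integrable φ (S.law p) := hφ2.integrable one_le_two
  have key : ∀ s : (∀ v, 𝓧 v) → ℝ, Measurable s → (∃ M, ∀ x, |s x| ≤ M) →
      ∫ x, s x ∂S.law p = 0 →
      ∫ x, φ x * s x ∂S.law p = ∫ x, S.Phi predecessors p x * s x ∂S.law p := by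
    rintro s hs ⟨M, hM⟩ hs0
    have hreg := S.isRegularPath_linearPath hp hs hM hs0
    refine (hφd _ s hreg).unique ?_
    obtain ⟨x₀⟩ : Nonempty (∀ v, 𝓧 v) := (S.law p).nonempty_of_neZero
    have hM0 : 0 ≤ M := (abs_nonneg _).trans (hM x₀)
    have hsmall : ∀ᶠ t in 𝓝[≠] (0 : ℝ), M * |t| ≤ 1 / 2 := by
      have : Tendsto (fun t : ℝ ↦ M * |t|) (𝓝 0) (𝓝 (M * |0|)) :=
        (continuous_const.mul continuous_abs).tendsto 0
      rw [abs_zero, mul_zero] at this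
      exact (this.eventually_le_const (by norm_num)).filter_mono nhdsWithin_le_nhds
    have hlik : ∀ t, M * |t| ≤ 1 / 2 →
        ∀ᵐ x ∂S.law p, likRatio p (linearPath p s t) x - 1 = t * s x := fun t ht ↦ by
      filter_upwards [S.ae_likRatio_linearPath hp s t] with x hx
      have : |t * s x| ≤ 1 / 2 := by
        rw [abs_mul, mul_comm]
        exact (mul_le_mul_of_nonneg_right (hM x) (abs_nonneg t)).trans ht
      rw [hx, max_eq_left, add_sub_cancel_left]
      linarith [(abs_le.1 this).1]
    refine S.hasDerivAt_psi hfix hp hfin hint hreg.at_zero (C := M) ?_ ?_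
    · filter_upwards [hsmall, hreg.mem.filter_mono nhdsWithin_le_nhds,
        hreg.ac.filter_mono nhdsWithin_le_nhds] with t ht hmem hac
      refine ⟨hmem, S.isClose_of_likRatio hp hmem hac (by positivity) ht ?_⟩
      filter_upwards [hlik t ht] with x hx
      rw [hx, abs_mul, mul_comm]
      exact mul_le_mul_of_nonneg_right (hM x) (abs_nonneg t)
    · refine tendsto_const_nhds.congr' ?_
      filter_upwards [hsmall, self_mem_nhdsWithin] with t ht ht0
      have ht0 : t ≠ 0 := ht0
      refine integral_congr_ae ?_
      filter_upwards [hlik t ht] with x hx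
      rw [hx, mul_div_cancel_left₀ _ ht0]
  have hzero : (fun x ↦ φ x - S.Phi predecessors p x) =ᵐ[S.law p] 0 := by
    refine (hφ1.sub hPhi).ae_eq_zero_of_forall_setIntegral_eq_zero fun A hA _ ↦ ?_
    -- the centred indicator of `A` is a bounded score
    set m := (S.law p).real A
    set s : (∀ v, 𝓧 v) → ℝ := fun x ↦ A.indicator 1 x - m with hs
    have hsm : Measurable s := (measurable_one.indicator hA).sub_const m
    have hind : Integrable (A.indicator (1 : (∀ v, 𝓧 v) → ℝ)) (S.law p) :=
      (integrable_const (1 : ℝ)).indicator hA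
    have hs0 : ∫ x, s x ∂S.law p = 0 := by
      rw [hs, integral_sub hind (integrable_const _), integral_indicator_one hA]
      simp [m]
    have hsM : ∀ x, |s x| ≤ 1 + |m| := fun x ↦ by
      refine (abs_sub _ _).trans (add_le_add_left ?_ _)
      by_cases hx : x ∈ A <;> simp [hx]
    have hk := key s hsm ⟨_, hsM⟩ hs0
    have hsplit : ∀ g : (∀ v, 𝓧 v) → ℝ, Integrable g (S.law p) → ∫ x, g x ∂S.law p = 0 →
        ∫ x, g x * s x ∂S.law p = ∫ x in A, g x ∂S.law p := fun g hg hg0 ↦ by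
      have h1 : ∀ x, g x * s x = A.indicator g x - g x * m := fun x ↦ by
        by_cases hx : x ∈ A <;> simp [hs, hx, mul_sub]
      simp only [h1]
      rw [integral_sub (hg.indicator hA) (hg.mul_const m), integral_mul_const, hg0,
        integral_indicator hA, zero_mul, sub_zero]
    rw [hsplit φ hφ1 hφ0, hsplit _ hPhi hPhi0] at hk
    rw [integral_sub' hφ1.integrableOn hPhi.integrableOn, hk, sub_self]
  filter_upwards [hzero] with x hx
  simpa [sub_eq_zero] using hx

/-- Every function in `L²` of mean zero is a limit of bounded scores, so the nonparametric tangent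
space imposes no condition on an influence function. -/
theorem isEIF_iff (φ : (∀ v, 𝓧 v) → ℝ) :
    S.IsEIF S.nonparametricModel (S.psi predecessors) p φ ↔
      MemLp (S.Phi predecessors p) 2 (S.law p) ∧ φ =ᵐ[S.law p] S.Phi predecessors p := by
  have := S.isProbabilityMeasure_law hp
  refine ⟨fun h ↦ ?_, fun ⟨hL2, hφ⟩ ↦ ?_⟩
  · have := IsGradient.ae_eq_Phi S hfix hp hfin hint h.1
    exact ⟨h.1.1.ae_eq this, this⟩
  have hφ2 : MemLp φ 2 (S.law p) := hL2.ae_eq hφ.symm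
  have hgrad := S.isGradient_Phi hfix hp hfin hint hL2
  have hφ0 : ∫ x, φ x ∂S.law p = 0 := (integral_congr_ae hφ).trans hgrad.2.1
  refine ⟨⟨hφ2, hφ0, fun γ s hγ ↦ ?_⟩, fun ε hε ↦ ?_⟩
  · rw [integral_congr_ae (g := fun x ↦ S.Phi predecessors p x * s x)
      (hφ.mono fun x hx ↦ by simp only [hx])]
    exact hgrad.2.2 γ s hγ
  -- a simple function close to `φ`, centred, is a bounded score
  obtain ⟨g, hg, hg2⟩ := hφ2.exists_simpleFunc_eLpNorm_sub_lt (by simp)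
    (ε := ENNReal.ofReal (ε / 2)) (by simpa using hε)
  set m := ∫ x, g x ∂S.law p with hm
  have hdiff : MemLp (fun x ↦ φ x - g x) 2 (S.law p) := hφ2.sub hg2
  have hm_le : ‖m‖ₑ ≤ ENNReal.ofReal (ε / 2) := by
    have h1 : m = -∫ x, (φ x - g x) * 1 ∂S.law p := by
      simp only [mul_one]
      rw [integral_sub (hφ2.integrable one_le_two) (hg2.integrable one_le_two), hφ0, zero_sub,
        neg_neg]
    rw [h1, enorm_neg]
    refine (enorm_integral_mul_le hdiff.1 aestronglyMeasurable_const).trans ?_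
    rw [eLpNorm_const _ (by simp) (NeZero.ne _)]
    have hg' : eLpNorm (fun x ↦ φ x - g x) 2 (S.law p) ≤ ENNReal.ofReal (ε / 2) := hg.le
    simpa using hg'
  obtain ⟨M, hM⟩ : ∃ M, ∀ x, ‖g x‖ ≤ M := g.exists_forall_norm_le
  refine ⟨fun x ↦ g x - m, Submodule.subset_span ⟨_, S.isRegularPath_linearPath hp
    (g.measurable.sub_const m) (M := M + |m|) (fun x ↦ ?_) ?_⟩, ?_⟩
  · exact (abs_sub _ _).trans (add_le_add_left (hM x) _)
  · rw [integral_sub (hg2.integrable one_le_two) (integrable_const _)]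
    simp [hm]
  · have h1 : (fun x ↦ φ x - (g x - m)) = (fun x ↦ φ x - g x) + fun _ ↦ m := by
      funext x; simp only [Pi.add_apply]; ring
    rw [h1]
    refine (eLpNorm_add_le hdiff.1 aestronglyMeasurable_const one_le_two).trans ?_
    rw [eLpNorm_const _ (by simp) (NeZero.ne _), ← add_halves ε,
      ENNReal.ofReal_add (by positivity) (by positivity)]
    refine add_le_add hg.le ?_
    simpa using hm_le

end Efficiency

end CausalSetup

/-! ### Laws with the topological factorization -/

namespace CausalSetup

open Function

variable {V : Type*} [Fintype V] [LinearOrder V] {𝓧 : V → Type*} [∀ v, MeasurableSpace (𝓧 v)]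
variable (S : CausalSetup V 𝓧) {p q : (∀ v, 𝓧 v) → ℝ≥0∞}

theorem _root_.ADMG.markovPillow_subset_predecessors (G : ADMG V) (v : V) :
    G.markovPillow v ⊆ predecessors v := fun w hw ↦ by
  simp only [ADMG.markovPillow, Finset.mem_filter, Finset.mem_univ, true_and] at hw
  simpa using lt_of_le_of_ne hw.2.1 hw.1

/-- A conditional density has mass one, or zero where the conditioning density vanishes or is
infinite. -/
theorem lintegral_cond_update_le_one (hp : Measurable p) {T : Finset V} {v : V} (hv : v ∉ T)
    (x : ∀ v, 𝓧 v) : ∫⁻ z, S.cond p T v (update x v z) ∂S.ν v ≤ 1 := by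
  have h : ∀ z, S.cond p T v (update x v z) =
      S.marg p (insert v T) (update x v z) * (S.marg p T x)⁻¹ := fun z ↦ by
    rw [cond, (S.dependsOn_marg p T).apply_update (by simpa using hv), div_eq_mul_inv]
  simp only [h]
  have hm : Measurable fun z ↦ S.marg p (insert v T) (update x v z) :=
    (S.measurable_marg hp _).comp (measurable_update x)
  rw [lintegral_mul_const _ hm,
    S.lintegral_marg_update hp hv, ← div_eq_mul_inv]
  exact ENNReal.div_self_le_one

section Pillow

variable {c : V → Finset V} (hc : ∀ v, c v ⊆ predecessors v)
include hc

theorem dependsOn_cond_Iic (p : (∀ v, 𝓧 v) → ℝ≥0∞) (v : V) :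
    DependsOn (S.cond p (c v) v) (Set.Iic v) :=
  (S.dependsOn_cond p (c v) v).mono fun w hw ↦ by
    rcases Finset.mem_insert.1 (Finset.mem_coe.1 hw) with rfl | h
    · exact le_rfl
    · exact (mem_predecessors.1 (hc v h)).le

omit hc in
theorem measurable_prod_cond (hp : Measurable p) (T : Finset V) :
    Measurable fun x ↦ ∏ w ∈ T, S.cond p (c w) w x :=
  Finset.measurable_fun_prod _ fun _ _ ↦ S.measurable_cond hp _ _

theorem lintegral_prod_cond_update_le (hp : Measurable p) {T : Finset V} {v : V}
    (hT : ∀ w ∈ T, w < v) (x : ∀ v, 𝓧 v) :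
    ∫⁻ z, ∏ w ∈ insert v T, S.cond p (c w) w (update x v z) ∂S.ν v ≤
      ∏ w ∈ T, S.cond p (c w) w x := by
  have hv : v ∉ T := fun h ↦ lt_irrefl _ (hT v h)
  have h : ∀ z, ∏ w ∈ insert v T, S.cond p (c w) w (update x v z) =
      S.cond p (c v) v (update x v z) * ∏ w ∈ T, S.cond p (c w) w x := fun z ↦ by
    rw [Finset.prod_insert hv]
    congr 1
    exact Finset.prod_congr rfl fun w hw ↦
      (S.dependsOn_cond_Iic hc p w).apply_update (by simpa using hT w hw) x z
  simp only [h]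
  have hm : Measurable fun z ↦ S.cond p (c v) v (update x v z) :=
    (S.measurable_cond hp _ _).comp (measurable_update x)
  rw [lintegral_mul_const _ hm]
  refine mul_le_of_le_one_left bot_le (S.lintegral_cond_update_le_one hp (fun h ↦ ?_) x)
  exact lt_irrefl v (by simpa using hc v h)

theorem lmarginal_prod_cond_le_one (hp : Measurable p) (T : Finset V) (x : ∀ v, 𝓧 v) :
    lmarginal S.ν T (fun x ↦ ∏ w ∈ T, S.cond p (c w) w x) x ≤ 1 := by
  induction T using Finset.induction_on_max with
  | empty => simp
  | insert v T hT ih =>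
    rw [lmarginal_insert' _ (S.measurable_prod_cond hp _) fun h ↦ lt_irrefl _ (hT v h)]
    exact (lmarginal_mono (S.lintegral_prod_cond_update_le hc hp hT) x).trans ih

/-- If `p` factorizes over the conditional densities given `c v`, then so do the marginal densities
of the initial segments of the order. They are dominated by the products of conditional densities,
and the two have the same total mass. -/
theorem ae_marg_eq_prod_cond (hp : p ∈ S.nonparametricModel)
    (hfac : ∀ᵐ x ∂S.base, p x = ∏ v, S.cond p (c v) v x) (v : V) :
    (∀ᵐ x ∂S.base, S.marg p (upTo v) x = ∏ w ∈ upTo v, S.cond p (c w) w x) ∧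
    ∀ᵐ x ∂S.base, S.marg p (predecessors v) x = ∏ w ∈ predecessors v, S.cond p (c w) w x := by
  have hm := hp.1
  have hstep : ∀ v, (∀ᵐ x ∂S.base, S.marg p (upTo v) x ≤ ∏ w ∈ upTo v, S.cond p (c w) w x) →
      ∀ᵐ x ∂S.base, S.marg p (predecessors v) x ≤ ∏ w ∈ predecessors v, S.cond p (c w) w x := by
    intro v h
    filter_upwards [ae_ae_update (μ := S.ν) h v] with x hx
    rw [← S.lintegral_marg_update hm (v := v) (by simp)]
    exact (lintegral_mono_ae hx).trans
      (S.lintegral_prod_cond_update_le hc hm (fun w hw ↦ by simpa using hw) x)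
  have hle : ∀ v, ∀ᵐ x ∂S.base, S.marg p (upTo v) x ≤ ∏ w ∈ upTo v, S.cond p (c w) w x := by
    intro v
    induction v using S.down_induction with
    | hY =>
      filter_upwards [hfac] with x hx
      rw [S.upTo_Y, S.marg_univ]
      exact hx.le
    | h v w hvw ih =>
      have := hstep w ih
      rwa [predecessors_eq_upTo hvw] at this
  have heq : ∀ T : Finset V, (∀ᵐ x ∂S.base, S.marg p T x ≤ ∏ w ∈ T, S.cond p (c w) w x) →
      ∀ᵐ x ∂S.base, S.marg p T x = ∏ w ∈ T, S.cond p (c w) w x := fun T h ↦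
    ae_eq_of_ae_le_of_lmarginal_le (μ := S.ν) (S.measurable_marg hm T) (S.measurable_prod_cond hm T)
      (T := T) h (fun x ↦ by rw [S.lmarginal_marg hm, hp.2.1]; simp)
      fun x ↦ by
        rw [S.lmarginal_marg hm, hp.2.1]
        exact S.lmarginal_prod_cond_le_one hc hm T x
  exact ⟨heq _ (hle v), heq _ (hstep v (hle v))⟩

end Pillow

/-- The conditional densities given `c v` agree at `x` with those given all predecessors, wherever
the latter are defined. -/
def Agree (c : V → Finset V) (p : (∀ v, 𝓧 v) → ℝ≥0∞) (x : ∀ v, 𝓧 v) : Prop :=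
  ∀ a v, S.marg p (predecessors v) (S.setA a x) ≠ 0 →
    S.f c p v a x = S.f predecessors p v a x

/-- The ordered local Markov property: given its Markov pillow, a variable is independent of its
other predecessors. -/
theorem ae_agree (hp : p ∈ S.graphModel) : ∀ᵐ x ∂S.base, S.Agree S.G.markovPillow p x := by
  have hmk := fun v ↦ S.ae_marg_eq_prod_cond S.G.markovPillow_subset_predecessors hp.1 hp.2 v
  have key : ∀ᵐ x ∂S.base, ∀ v, S.marg p (predecessors v) x ≠ 0 →
      S.cond p (S.G.markovPillow v) v x = S.cond p (predecessors v) v x := by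
    refine ae_all_iff.2 fun v ↦ ?_
    filter_upwards [(hmk v).1, (hmk v).2,
      S.ae_marg_lt_top hp.1.1 (by simp [hp.1.2.1]) (predecessors v)] with x h1 h2 h3 h0
    have h4 : S.marg p (insert v (predecessors v)) x =
        S.cond p (S.G.markovPillow v) v x * S.marg p (predecessors v) x := by
      have h1' : S.marg p (insert v (predecessors v)) x =
          ∏ w ∈ insert v (predecessors v), S.cond p (S.G.markovPillow w) w x := h1
      rw [h1', Finset.prod_insert (by simp), ← h2]
    have h5 : S.cond p (predecessors v) v x =
        S.marg p (insert v (predecessors v)) x / S.marg p (predecessors v) x := rfl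
    rw [h5, h4, ENNReal.mul_div_cancel_right h0 h3.ne]
  filter_upwards [S.ae_setA key] with x hx a v h0
  rw [f, f, hx a v h0]

section Agree

variable {c : V → Finset V} {x : ∀ v, 𝓧 v}

/-- At a regular point in the support, the products of conditional densities agree: either all
factors agree, or the first factor that is undefined follows a vanishing one. -/
theorem Agree.prod_post_eq {S : CausalSetup V 𝓧} (h : S.Agree c p x) (hx : S.RegularPoint p x)
    (hA : S.marg p (upTo S.A) (S.setA S.a₁ x) ≠ 0) :
    ∏ v ∈ S.post, S.f c p v (S.lvl v) x = ∏ v ∈ S.post, S.f predecessors p v (S.lvl v) x := by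
  rw [S.post_eq]
  have key : ∀ v, S.A ≤ v →
      ∏ w ∈ Finset.univ.filter (fun w ↦ S.A < w ∧ w ≤ v), S.f c p w (S.lvl w) x =
      ∏ w ∈ Finset.univ.filter (fun w ↦ S.A < w ∧ w ≤ v), S.f predecessors p w (S.lvl w) x := by
    intro v hv
    induction v, hv using S.up_induction with
    | hA =>
      have : (Finset.univ.filter (fun w ↦ S.A < w ∧ w ≤ S.A)) = ∅ := by ext w; simp
      simp [this]
    | h v w hv hvw ih =>
      rw [S.filter_covBy hv hvw, Finset.prod_insert (by simp [hvw.1]),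
        Finset.prod_insert (by simp [hvw.1]), ih]
      by_cases h0 : S.interv p v x = 0
      · have h1 := (mul_eq_zero.1 h0).resolve_left hA
        have h2 : ∏ w ∈ Finset.univ.filter (fun w ↦ S.A < w ∧ w ≤ v),
            S.f predecessors p w (S.lvl w) x = 0 := by
          simp only [f]
          rw [← ENNReal.toReal_prod, h1, ENNReal.toReal_zero]
        rw [h2, mul_zero, mul_zero]
      · rw [h]
        rw [predecessors_eq_upTo hvw]
        exact (hx.interv_ne_zero_iff hv (hvw.1.trans_le (S.Y_last w)) _).1 h0
  exact key S.Y S.A_lt_Y.le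

/-- The integrand of the target is the same for both choices of conditioning sets, at almost every
value of the variables integrated out. -/
theorem ae_psi_integrand_eq (hp : p ∈ S.nonparametricModel) (h : ∀ᵐ x ∂S.base, S.Agree c p x) :
    ∀ᵐ x ∂S.law p, S.propensity c p S.a₁ x = S.propensity predecessors p S.a₁ x ∧
      ∀ᵐ z ∂Measure.pi (fun i : S.post ↦ S.ν i),
        ∏ v ∈ S.post, S.f c p v (S.lvl v) (updateFinset x S.post z) =
        ∏ v ∈ S.post, S.f predecessors p v (S.lvl v) (updateFinset x S.post z) := by
  filter_upwards [S.law_absolutelyContinuous.ae_le (S.ae_regularPoint hp),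
    S.law_absolutelyContinuous.ae_le h, S.ae_law_marg_ne_zero hp.1 (upTo S.A),
    S.law_absolutelyContinuous.ae_le (ae_ae_updateFinset (μ := S.ν) (S.ae_regularPoint hp) S.post),
    S.law_absolutelyContinuous.ae_le (ae_ae_updateFinset (μ := S.ν) h S.post)]
    with x hx hag h0 hx' hag'
  have hA : S.marg p (upTo S.A) (S.setA S.a₁ x) ≠ 0 := by
    refine hx.pos (S.level (x S.A)) S.a₁ (by simpa using S.A_lt_Y) ?_
    rwa [S.setA_eq_self rfl]
  refine ⟨hag _ _ (hx.subset _ (predecessors_subset_upTo _) hA), ?_⟩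
  filter_upwards [hx', hag'] with z hz hz'
  refine hz'.prod_post_eq hz ?_
  have hd : Disjoint ((upTo S.A : Set V) \ {S.A}) (S.post : Set V) := by
    rw [Set.disjoint_left]
    rintro v ⟨hv, -⟩ hv'
    simp only [Finset.mem_coe, mem_upTo] at hv
    simp only [post, Finset.coe_filter, Finset.mem_univ, true_and, Set.mem_ofPred_eq] at hv'
    exact absurd hv (not_le.2 hv')
  rwa [((S.dependsOn_marg p (upTo S.A)).comp_setA S S.a₁).apply_updateFinset hd]

theorem psi_congr (hp : p ∈ S.nonparametricModel) (h : ∀ᵐ x ∂S.base, S.Agree c p x) :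
    S.psi predecessors p = S.psi c p := by
  rw [psi, psi]
  congr 1
  refine integral_congr_ae ?_
  filter_upwards [S.ae_psi_integrand_eq hp h] with x hx
  rw [hx.1, gIntegral, gIntegral]
  congr 1
  exact integral_congr_ae (hx.2.mono fun z hz ↦ by simp only [hz])

theorem TargetFinite.congr {S : CausalSetup V 𝓧} (hp : p ∈ S.nonparametricModel)
    (h : ∀ᵐ x ∂S.base, S.Agree c p x) (hfin : S.TargetFinite c p) :
    S.TargetFinite predecessors p := by
  refine ⟨lt_of_le_of_lt (le_of_eq (lintegral_congr_ae ?_)) hfin.1, hfin.2⟩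
  filter_upwards [S.ae_psi_integrand_eq hp h] with x hx
  rw [hx.1]
  congr 1
  exact lintegral_congr_ae (hx.2.mono fun z hz ↦ by simp only [hz])

/-- The sequential regressions agree wherever the intervened density is nonzero; a factor that is
undefined is met only behind a vanishing one. -/
theorem ae_nextB_congr (hp : p ∈ S.nonparametricModel) (h : ∀ᵐ x ∂S.base, S.Agree c p x) {v : V}
    (hv : S.A ≤ v) : ∀ᵐ x ∂S.base, S.interv p v x ≠ 0 →
      S.nextB c p v x = S.nextB predecessors p v x := by
  induction v using S.down_induction with
  | hY => simp [S.nextB_Y]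
  | h v w hvw ih =>
    filter_upwards [ae_ae_update (μ := S.ν) (ih (hv.trans hvw.1.le)) w,
      ae_ae_update (μ := S.ν) (S.ae_regularPoint hp) w, ae_ae_update (μ := S.ν) h w]
      with x hz hreg hag h0
    rw [S.nextB_covBy c p hvw, S.nextB_covBy predecessors p hvw]
    refine integral_congr_ae ?_
    filter_upwards [hz, hreg, hag] with z hz hreg hag
    have hG : S.interv p v (update x w z) ≠ 0 := by
      rwa [(S.dependsOn_interv p hv).apply_update (by simp [hvw.1])]
    have hf : S.f c p w (S.lvl w) (update x w z) =
        S.f predecessors p w (S.lvl w) (update x w z) := by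
      refine hag _ _ ?_
      rw [predecessors_eq_upTo hvw]
      exact (hreg.interv_ne_zero_iff hv (hvw.1.trans_le (S.Y_last w)) _).1 hG
    rw [hf]
    by_cases hc : S.cond p (predecessors w) w (S.setA (S.lvl w) (update x w z)) = 0
    · simp [f, hc]
    · rw [hz]
      rw [S.interv_covBy p hv hvw]
      exact mul_ne_zero hG hc

theorem ae_Phi_congr (hfix : S.G.PrimalFixable S.A) (hp : p ∈ S.nonparametricModel)
    (h : ∀ᵐ x ∂S.base, S.Agree c p x) : S.Phi c p =ᵐ[S.law p] S.Phi predecessors p := by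
  have hB : ∀ᵐ x ∂S.base, ∀ v, S.A ≤ v → S.interv p v x ≠ 0 →
      S.nextB c p v x = S.nextB predecessors p v x :=
    ae_all_iff.2 fun v ↦ by
      by_cases hv : S.A ≤ v
      · simpa [hv] using S.ae_nextB_congr hp h hv
      · simp [hv]
  have h0 : ∀ᵐ x ∂S.law p, ∀ T, S.marg p T x ≠ 0 :=
    ae_all_iff.2 fun T ↦ S.ae_law_marg_ne_zero hp.1 T
  filter_upwards [h0, S.law_absolutelyContinuous.ae_le hB,
    S.law_absolutelyContinuous.ae_le h,
    S.law_absolutelyContinuous.ae_le (S.ae_regularPoint hp)] with x h0 hB hag hx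
  have hpos : ∀ a {T}, S.Y ∉ T → S.marg p T (S.setA a x) ≠ 0 := fun a T hT ↦ by
    refine hx.pos (S.level (x S.A)) a hT ?_
    rw [S.setA_eq_self rfl]
    exact h0 T
  have hf : ∀ v a, S.f c p v a x = S.f predecessors p v a x := fun v a ↦
    hag a v (hpos a (by simpa using S.Y_last v))
  have hR : ∀ v, S.R c p v x = S.R predecessors p v x := fun v ↦ by
    simp only [R, ratio, ratioA, propensity, hf]
  have hN : ∀ v, S.A ≤ v → S.nextB c p v x = S.nextB predecessors p v x := fun v hv ↦ by
    rcases (S.Y_last v).eq_or_lt with rfl | hY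
    · rw [S.nextB_Y, S.nextB_Y]
    · exact hB v hv ((hx.interv_ne_zero_iff hv hY S.a₀).2 (hpos _ (by simpa using hY)))
  rw [S.Phi_eq hfix, S.Phi_eq hfix, hN _ le_rfl, S.psi_congr hp h]
  congr 3
  refine Finset.sum_congr rfl fun v hv ↦ ?_
  have hAv : S.A < v := by simpa [post] using hv
  obtain ⟨u, hu, huv⟩ := S.exists_covBy_of_A_lt hAv
  rw [← S.nextB_covBy c p huv, ← S.nextB_covBy predecessors p huv, hN v hAv.le, hN u hu, hR]

end Agree

/-- Every law factorizes over the conditional densities given all predecessors. -/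
theorem ae_eq_prod_cond_predecessors (hp : p ∈ S.nonparametricModel) :
    ∀ᵐ x ∂S.base, p x = ∏ v, S.cond p (predecessors v) v x := by
  filter_upwards [S.ae_regularPoint hp] with x hx
  have hup : ∀ v, S.marg p (upTo v) x =
      S.marg p (predecessors v) x * S.cond p (predecessors v) v x := fun v ↦ by
    have := hx.marg_upTo (S.level (x S.A)) v
    rwa [S.setA_eq_self rfl] at this
  have key : ∀ v, S.marg p (predecessors v) x =
      ∏ w ∈ predecessors v, S.cond p (predecessors w) w x := by
    intro v
    induction v using (wellFounded_lt (α := V)).induction with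
    | _ v ih =>
      rcases (predecessors v).eq_empty_or_nonempty with h | ⟨w, hw⟩
      · rw [h, S.marg_empty, hp.2.1, Finset.prod_empty]
      · obtain ⟨u, -, huv⟩ := exists_le_covBy_of_lt (mem_predecessors.1 hw)
        rw [predecessors_eq_upTo huv, hup, ih u huv.1, upTo, Finset.prod_insert (by simp), mul_comm]
  have h1 := hup S.Y
  rw [S.upTo_Y, S.marg_univ, key] at h1
  rw [h1, ← S.upTo_Y, upTo, Finset.prod_insert (by simp), mul_comm]

theorem IsRegularPath.mono {S : CausalSetup V 𝓧} {𝓜 𝓜' : Set ((∀ v, 𝓧 v) → ℝ≥0∞)}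
    {γ : ℝ → (∀ v, 𝓧 v) → ℝ≥0∞} {s : (∀ v, 𝓧 v) → ℝ} (h : 𝓜 ⊆ 𝓜')
    (hγ : S.IsRegularPath 𝓜 p γ s) : S.IsRegularPath 𝓜' p γ s :=
  { hγ with mem := hγ.mem.mono fun _ ht ↦ h ht }

end CausalSetup

theorem mainTheorem4 {V : Type*} [Fintype V] [LinearOrder V]
    {𝓧 : V → Type*} [∀ v, MeasurableSpace (𝓧 v)] (S : CausalSetup V 𝓧)
    (hfix : S.G.PrimalFixable S.A)
    (p : (∀ v, 𝓧 v) → ℝ≥0∞) (hp : p ∈ S.graphModel)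
    (hfin : S.TargetFinite S.G.markovPillow p) :
    -- if the graph imposes no restriction: the efficient influence function of the target
    ((∀ v, S.G.markovPillow v = predecessors v) →
      S.graphModel = S.nonparametricModel ∧
      ∀ φ : (∀ v, 𝓧 v) → ℝ,
        S.IsEIF S.nonparametricModel (S.psi S.G.markovPillow) p φ ↔
          MemLp (S.Phi S.G.markovPillow p) 2 (S.law p) ∧
            φ =ᵐ[S.law p] S.Phi S.G.markovPillow p) ∧
    -- for every graph: the target extends to the nonparametric model, by conditioning on all
    -- predecessors, and the same function is the efficient influence function of the extension
    ((∀ q ∈ S.graphModel, S.psi predecessors q = S.psi S.G.markovPillow q) ∧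
      ∀ φ : (∀ v, 𝓧 v) → ℝ,
        S.IsEIF S.nonparametricModel (S.psi predecessors) p φ ↔
          MemLp (S.Phi S.G.markovPillow p) 2 (S.law p) ∧
            φ =ᵐ[S.law p] S.Phi S.G.markovPillow p) ∧
    -- for every graph: it is an influence function of the target on the model of the graph
    (MemLp (S.Phi S.G.markovPillow p) 2 (S.law p) →
      S.IsGradient S.graphModel (S.psi S.G.markovPillow) p (S.Phi S.G.markovPillow p)) := by
  have hp' : p ∈ S.nonparametricModel := hp.1
  have hag := S.ae_agree hp
  have hPhi := S.ae_Phi_congr hfix hp' hag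
  have hfin' : ∫⁻ x, S.yAbs x ∂S.intervLaw p ≠ ∞ :=
    S.lintegral_yAbs_intervLaw_ne_top hp' (hfin.congr hp' hag)
  have hpsi : ∀ q ∈ S.graphModel, S.psi predecessors q = S.psi S.G.markovPillow q :=
    fun q hq ↦ S.psi_congr hq.1 (S.ae_agree hq)
  refine ⟨fun h ↦ ?_, ⟨hpsi, fun φ ↦ ?_⟩, fun hL2 ↦ ?_⟩
  · have hmp : S.G.markovPillow = predecessors := funext h
    refine ⟨Set.Subset.antisymm (fun q hq ↦ hq.1) fun q hq ↦ ⟨hq, ?_⟩, fun φ ↦ ?_⟩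
    · simpa only [hmp] using S.ae_eq_prod_cond_predecessors hq
    · rw [hmp]
      exact S.isEIF_iff hfix hp' hfin' hfin.2 φ
  · rw [S.isEIF_iff hfix hp' hfin' hfin.2 φ]
    exact and_congr ⟨fun h ↦ h.ae_eq hPhi.symm, fun h ↦ h.ae_eq hPhi⟩
      ⟨fun h ↦ h.trans hPhi.symm, fun h ↦ h.trans hPhi⟩
  · have hgrad := S.isGradient_Phi hfix hp' hfin' hfin.2 (hL2.ae_eq hPhi)
    refine ⟨hL2, (integral_congr_ae hPhi).trans hgrad.2.1, fun γ s hγ ↦ ?_⟩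
    rw [integral_congr_ae (g := fun x ↦ S.Phi predecessors p x * s x)
      (hPhi.mono fun x hx ↦ by simp only [hx])]
    refine (hgrad.2.2 γ s (hγ.mono fun q hq ↦ hq.1)).congr_of_eventuallyEq ?_
    exact hγ.mem.mono fun t ht ↦ (hpsi (γ t) ht).symm
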